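/- **Data.** Let $n,l,m_1,m_2$ be dimensions with $m_1,m_2\ge 1$, $m=m_1+m_2$, $t_f>0$. Let $A_1(t)\in\mathbb R^{n\times n}$, $A_2(t)\in\mathbb R^{n\times m}$, $A_3(t)\in\mathbb R^{m\times n}$, $A_4(t)\in\mathbb R^{m\times m}$, $C_1(t)\in\mathbb R^{n\times l}$, $C_2(t)\in\mathbb R^{m\times l}$, symmetric $D_1(t)\in\mathbb R^{n\times n}$, $G(t)\in\mathbb R^{l\times l}$ and $D_2(t)=\mathrm{diag}(\lambda_1(t),\dots,\lambda_m(t))$ be given on $[0,t_f]$, and let $F_1\in\mathbb R^{n\times n}$ be symmetric. Assume that $F_1$ and $D_1(t)$ are positive semi-definite, $G(t)$ is positive definite, $\lambda_p(t)>0$ for $p\le m_1$ and $\lambda_r(t)=0$ for $r>m_1$, for all $t\in[0,t_f]$. Put $$A=\begin{pmatrix}A_1&A_2\\A_3&A_4\end{pmatrix}=\begin{pmatrix}\bar A_1&\bar A_2&\bar A_3\\ \bar A_4&\bar A_5&\bar A_6\\ \bar A_7&\bar A_8&\bar A_9\end{pmatrix},\quad S_v=\begin{pmatrix}C_1\\C_2\end{pmatrix}G^{-1}\begin{pmatrix}C_1\\C_2\end{pmatrix}^T=\begin{pmatrix}S_{v,1}&S_{v,2}&S_{v,3}\\S_{v,2}^T&S_{v,4}&S_{v,5}\\S_{v,3}^T&S_{v,5}^T&S_{v,6}\end{pmatrix},$$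 partitioned with respect to $n,m_1,m_2$, $D=\mathrm{diag}(D_1,D_2)$, $S_u(\varepsilon)=\varepsilon^{-2}\,\mathrm{diag}(0,I_m)$, and $\Lambda=\mathrm{diag}(\lambda_1,\dots,\lambda_{m_1})$. **Transformed problem.** For $\varepsilon>0$, substituting $$K=\begin{pmatrix}K_1&\varepsilon K_2&\varepsilon K_3\\ \varepsilon K_2^T&\varepsilon K_4&\varepsilon^2K_5\\ \varepsilon K_3^T&\varepsilon^2K_5^T&\varepsilon^2K_6\end{pmatrix}$$ into $K'=-KA-A^TK+K(S_u(\varepsilon)-S_v)K-D$, $K(t_f)=\mathrm{diag}(F_1,0)$, with $\bar A_3\equiv0$, gives the terminal-value problem $$\begin{aligned}K_1'&=-K_1\bar A_1-\bar A_1^TK_1+K_2K_2^T+K_3K_3^T-K_1S_{v,1}K_1-D_1-\varepsilon\mathcal G_1,\\ \varepsilon K_2'&=-K_1\bar A_2+K_2K_4-\varepsilon\mathcal G_2,\\ K_3'&=-K_2\bar A_6-K_3\bar A_9-\bar A_1^TK_3+K_2K_5+K_3K_6-K_1S_{v,1}K_3-\varepsilon\mathcal G_3,\\ \varepsilon K_4'&=K_4^2-\Lambda-\varepsilon\mathcal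 G_4,\\ \varepsilon K_5'&=-K_4\bar A_6-\bar A_2^TK_3+K_4K_5-\varepsilon\mathcal G_5,\\ K_6'&=-K_5^T\bar A_6-K_6\bar A_9-\bar A_6^TK_5-\bar A_9^TK_6+K_5^TK_5+K_6^2-K_3^TS_{v,1}K_3-\varepsilon\mathcal G_6,\end{aligned}$$ $K_1(t_f)=F_1$, $K_\alpha(t_f)=0$ $(\alpha=2,\dots,6)$, where $\mathcal G_1,\dots,\mathcal G_6$ are the polynomials in $\varepsilon$, the $K_\alpha$, $K_\alpha^T$ and the blocks of $A$, $A^T$, $S_v$ that collect the remaining terms of the blocks $(1,1),(1,2),(1,3),(2,2),(2,3),(3,3)$ of the substituted equation. **Assumptions.** $\bar A_3(t)=0$ on $[0,t_f]$ (A2); the functions $A_i$ $(i=1,\dots,4)$, $C_j,D_j$ $(j=1,2)$, $G$ are continuously differentiable on $[0,t_f]$ (A3); the problem $$(K_{1,0}^o)'=-K_{1,0}^o\bar A_1-\bar A_1^TK_{1,0}^o+K_{1,0}^o\big[\bar A_2\Lambda^{-1}\bar A_2^T-S_{v,1}\big]K_{1,0}^o-D_1,\qquad K_{1,0}^o(t_f)=F_1,$$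 has a solution $K_{1,0}^o$ on all of $[0,t_f]$ (A4). **Approximation.** Let $K_{6,0}^o$ denote the solution on $[0,t_f]$ of $(K_{6,0}^o)'=-K_{6,0}^o\bar A_9-\bar A_9^TK_{6,0}^o+(K_{6,0}^o)^2-\bar A_6^T\bar A_6$, $K_{6,0}^o(t_f)=0$. Put $K_{2,0}^o=K_{1,0}^o\bar A_2\Lambda^{-1/2}$, $K_{3,0}^o=0$, $K_{4,0}^o=\Lambda^{1/2}$, $K_{5,0}^o=\bar A_6$. With $\mathcal H_1(\tau)=\exp(\Lambda^{1/2}(t_f)\tau)$, $\mathcal H_2(\tau)=(I+\mathcal H_1^2(\tau))^{-1}$ put $K_{1,0}^b=K_{3,0}^b=K_{6,0}^b=0$ and $$K_{2,0}^b=-2F_1\bar A_2(t_f)\Lambda^{-1/2}(t_f)\mathcal H_1^2\mathcal H_2,\quad K_{4,0}^b=-2\Lambda^{1/2}(t_f)\mathcal H_1^2\mathcal H_2,\quad K_{5,0}^b=-2\mathcal H_1\mathcal H_2\bar A_6(t_f).$$ Put $K_{\alpha,0}(t,\varepsilon)=K_{\alpha,0}^o(t)+K_{\alpha,0}^b((t-t_f)/\varepsilon)$,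 $\alpha=1,\dots,6$. **Claim.** The solution $K_{6,0}^o$ exists on $[0,t_f]$ and is unique, and there are $\varepsilon_0>0$ and $a>0$ such that for every $\varepsilon\in(0,\varepsilon_0]$ the transformed problem has a unique solution $(K_1,\dots,K_6)(t,\varepsilon)$ on the whole of $[0,t_f]$; its blocks $K_1,K_4,K_6$ are symmetric, and $$\|K_\alpha(t,\varepsilon)-K_{\alpha,0}(t,\varepsilon)\|\le a\,\varepsilon,\qquad t\in[0,t_f],\ \alpha=1,\dots,6,$$ where $\|\cdot\|$ is the Euclidean (Frobenius) norm and $a$ does not depend on $\varepsilon$ or $t$. -/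

import Mathlib

open Set Matrix

-- The norm of a matrix is its Euclidean (Frobenius) norm.
attribute [local instance] Matrix.frobeniusNormedAddCommGroup Matrix.frobeniusNormedSpace

namespace CheapControl

noncomputable section

/-- The data of the cheap control game. The slow state is `x ∈ ℝⁿ`; the fast state is
`y ∈ ℝᵐ`, `m = m₁ + m₂`, whose coordinates are indexed by `Fin m₁ ⊕ Fin m₂`; the maximizer's
control is `v ∈ ℝˡ`. The function `lam` gives the diagonal entries of `D₂(t)`. -/
structure GameData (n m₁ m₂ l : ℕ) where
  /-- the final time -/
  tf : ℝ
  A1 : ℝ → Matrix (Fin n) (Fin n) ℝ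
  A2 : ℝ → Matrix (Fin n) (Fin m₁ ⊕ Fin m₂) ℝ
  A3 : ℝ → Matrix (Fin m₁ ⊕ Fin m₂) (Fin n) ℝ
  A4 : ℝ → Matrix (Fin m₁ ⊕ Fin m₂) (Fin m₁ ⊕ Fin m₂) ℝ
  C1 : ℝ → Matrix (Fin n) (Fin l) ℝ
  C2 : ℝ → Matrix (Fin m₁ ⊕ Fin m₂) (Fin l) ℝ
  F1 : Matrix (Fin n) (Fin n) ℝ
  D1 : ℝ → Matrix (Fin n) (Fin n) ℝ
  lam : ℝ → Fin m₁ ⊕ Fin m₂ → ℝ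
  G : ℝ → Matrix (Fin l) (Fin l) ℝ

variable {n m₁ m₂ l : ℕ}

namespace GameData

variable (g : GameData n m₁ m₂ l)

/-- `D₂(t) = diag(λ₁(t), …, λₘ(t))`. -/
def D2 (t : ℝ) : Matrix (Fin m₁ ⊕ Fin m₂) (Fin m₁ ⊕ Fin m₂) ℝ := diagonal (g.lam t)

/-- The standing assumptions on the cost functional of the game: `F₁`, `D₁(t)` are (symmetric)
positive semi-definite, `G(t)` is (symmetric) positive definite, the first `m₁` diagonal entries
of `D₂(t)` are positive and the other ones vanish. -/
structure Standing : Prop where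
  tf_pos : 0 < g.tf
  F1_posSemidef : g.F1.PosSemidef
  D1_posSemidef : ∀ t ∈ Icc 0 g.tf, (g.D1 t).PosSemidef
  G_posDef : ∀ t ∈ Icc 0 g.tf, (g.G t).PosDef
  lam_pos : ∀ t ∈ Icc 0 g.tf, ∀ p : Fin m₁, 0 < g.lam t (Sum.inl p)
  lam_zero : ∀ t ∈ Icc 0 g.tf, ∀ r : Fin m₂, g.lam t (Sum.inr r) = 0

/-! The blocks `Ā₁, …, Ā₉` of the matrix `A(t)` of the dynamics. -/

def Abar1 (t : ℝ) : Matrix (Fin n) (Fin n) ℝ := g.A1 t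
def Abar2 (t : ℝ) : Matrix (Fin n) (Fin m₁) ℝ := (g.A2 t).toCols₁
def Abar3 (t : ℝ) : Matrix (Fin n) (Fin m₂) ℝ := (g.A2 t).toCols₂
def Abar4 (t : ℝ) : Matrix (Fin m₁) (Fin n) ℝ := (g.A3 t).toRows₁
def Abar5 (t : ℝ) : Matrix (Fin m₁) (Fin m₁) ℝ := (g.A4 t).toBlocks₁₁
def Abar6 (t : ℝ) : Matrix (Fin m₁) (Fin m₂) ℝ := (g.A4 t).toBlocks₁₂
def Abar7 (t : ℝ) : Matrix (Fin m₂) (Fin n) ℝ := (g.A3 t).toRows₂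
def Abar8 (t : ℝ) : Matrix (Fin m₂) (Fin m₁) ℝ := (g.A4 t).toBlocks₂₁
def Abar9 (t : ℝ) : Matrix (Fin m₂) (Fin m₂) ℝ := (g.A4 t).toBlocks₂₂

/-- The block `Ā₃(t)` of `A(t)` in the upper right corner vanishes on `[0, t_f]`. -/
def BlockVanishes : Prop := ∀ t ∈ Icc 0 g.tf, g.Abar3 t = 0

/-- The data are continuously differentiable on `[0, t_f]`. -/
structure SmoothData : Prop where
  A1_contDiff : ContDiffOn ℝ 1 g.A1 (Icc 0 g.tf)
  A2_contDiff : ContDiffOn ℝ 1 g.A2 (Icc 0 g.tf)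
  A3_contDiff : ContDiffOn ℝ 1 g.A3 (Icc 0 g.tf)
  A4_contDiff : ContDiffOn ℝ 1 g.A4 (Icc 0 g.tf)
  C1_contDiff : ContDiffOn ℝ 1 g.C1 (Icc 0 g.tf)
  C2_contDiff : ContDiffOn ℝ 1 g.C2 (Icc 0 g.tf)
  D1_contDiff : ContDiffOn ℝ 1 g.D1 (Icc 0 g.tf)
  D2_contDiff : ContDiffOn ℝ 1 g.D2 (Icc 0 g.tf)
  G_contDiff : ContDiffOn ℝ 1 g.G (Icc 0 g.tf)

/-- `S_v(t) = C(t) G⁻¹(t) Cᵀ(t)`, where `C(t)` is `C₁(t)` on top of `C₂(t)`. -/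
def Sv (t : ℝ) : Matrix (Fin n ⊕ (Fin m₁ ⊕ Fin m₂)) (Fin n ⊕ (Fin m₁ ⊕ Fin m₂)) ℝ :=
  fromRows (g.C1 t) (g.C2 t) * (g.G t)⁻¹ * (fromRows (g.C1 t) (g.C2 t))ᵀ

/-! The blocks `S_{v,1}, …, S_{v,6}` of the symmetric matrix `S_v(t)`. -/

def S1 (t : ℝ) : Matrix (Fin n) (Fin n) ℝ := (g.Sv t).toBlocks₁₁
def S2 (t : ℝ) : Matrix (Fin n) (Fin m₁) ℝ := (g.Sv t).toBlocks₁₂.toCols₁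
def S3 (t : ℝ) : Matrix (Fin n) (Fin m₂) ℝ := (g.Sv t).toBlocks₁₂.toCols₂
def S4 (t : ℝ) : Matrix (Fin m₁) (Fin m₁) ℝ := (g.Sv t).toBlocks₂₂.toBlocks₁₁
def S5 (t : ℝ) : Matrix (Fin m₁) (Fin m₂) ℝ := (g.Sv t).toBlocks₂₂.toBlocks₁₂
def S6 (t : ℝ) : Matrix (Fin m₂) (Fin m₂) ℝ := (g.Sv t).toBlocks₂₂.toBlocks₂₂

/-- `Λ(t) = diag(λ₁(t), …, λ_{m₁}(t))`. -/
def Lam (t : ℝ) : Matrix (Fin m₁) (Fin m₁) ℝ := diagonal fun p => g.lam t (Sum.inl p)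

/-- `Λ^{1/2}(t) = diag(√λ₁(t), …, √λ_{m₁}(t))`. -/
def LamSqrt (t : ℝ) : Matrix (Fin m₁) (Fin m₁) ℝ :=
  diagonal fun p => √(g.lam t (Sum.inl p))

end GameData

/-- A six-tuple of matrices `K₁, …, K₆` of the dimensions of the blocks of `K`. -/
structure Blocks (n m₁ m₂ : ℕ) where
  K1 : Matrix (Fin n) (Fin n) ℝ
  K2 : Matrix (Fin n) (Fin m₁) ℝ
  K3 : Matrix (Fin n) (Fin m₂) ℝ
  K4 : Matrix (Fin m₁) (Fin m₁) ℝ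
  K5 : Matrix (Fin m₁) (Fin m₂) ℝ
  K6 : Matrix (Fin m₂) (Fin m₂) ℝ

namespace GameData

variable (g : GameData n m₁ m₂ l)

/-! The functions `𝒢₁, …, 𝒢₆` in the transformed Riccati system. -/

def R1 (ε t : ℝ) (k : Blocks n m₁ m₂) : Matrix (Fin n) (Fin n) ℝ :=
  k.K2 * g.Abar4 t + k.K3 * g.Abar7 t + (g.Abar4 t)ᵀ * k.K2ᵀ + (g.Abar7 t)ᵀ * k.K3ᵀ
  + k.K1 * g.S2 t * k.K2ᵀ + k.K1 * g.S3 t * k.K3ᵀ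
  + k.K2 * (g.S2 t)ᵀ * k.K1 + k.K3 * (g.S3 t)ᵀ * k.K1
  + ε • (k.K2 * g.S4 t * k.K2ᵀ + k.K2 * g.S5 t * k.K3ᵀ
    + k.K3 * (g.S5 t)ᵀ * k.K2ᵀ + k.K3 * g.S6 t * k.K3ᵀ)

def R2 (ε t : ℝ) (k : Blocks n m₁ m₂) : Matrix (Fin n) (Fin m₁) ℝ :=
  k.K2 * g.Abar5 t + k.K3 * g.Abar8 t + (g.Abar1 t)ᵀ * k.K2 + (g.Abar4 t)ᵀ * k.K4
  - k.K3 * k.K5ᵀ + k.K1 * g.S1 t * k.K2 + k.K1 * g.S2 t * k.K4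
  + ε • ((g.Abar7 t)ᵀ * k.K5ᵀ + k.K1 * g.S3 t * k.K5ᵀ
    + k.K2 * (g.S2 t)ᵀ * k.K2 + k.K2 * g.S4 t * k.K4
    + k.K3 * (g.S3 t)ᵀ * k.K2 + k.K3 * (g.S5 t)ᵀ * k.K4)
  + ε ^ 2 • (k.K2 * g.S5 t * k.K5ᵀ + k.K3 * g.S6 t * k.K5ᵀ)

def R3 (ε t : ℝ) (k : Blocks n m₁ m₂) : Matrix (Fin n) (Fin m₂) ℝ :=
  (g.Abar4 t)ᵀ * k.K5 + (g.Abar7 t)ᵀ * k.K6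
  + k.K1 * g.S2 t * k.K5 + k.K1 * g.S3 t * k.K6
  + k.K2 * (g.S2 t)ᵀ * k.K3 + k.K3 * (g.S3 t)ᵀ * k.K3
  + ε • (k.K2 * g.S4 t * k.K5 + k.K2 * g.S5 t * k.K6
    + k.K3 * (g.S5 t)ᵀ * k.K5 + k.K3 * g.S6 t * k.K6)

def R4 (ε t : ℝ) (k : Blocks n m₁ m₂) : Matrix (Fin m₁) (Fin m₁) ℝ :=
  k.K2ᵀ * g.Abar2 t + (g.Abar2 t)ᵀ * k.K2 + k.K4 * g.Abar5 t + (g.Abar5 t)ᵀ * k.K4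
  + ε • (k.K5 * g.Abar8 t + (g.Abar8 t)ᵀ * k.K5ᵀ - k.K5 * k.K5ᵀ
    + k.K2ᵀ * g.S1 t * k.K2 + k.K2ᵀ * g.S2 t * k.K4
    + k.K4 * (g.S2 t)ᵀ * k.K2 + k.K4 * g.S4 t * k.K4)
  + ε ^ 2 • (k.K2ᵀ * g.S3 t * k.K5ᵀ + k.K4 * g.S5 t * k.K5ᵀ
    + k.K5 * (g.S3 t)ᵀ * k.K2 + k.K5 * (g.S5 t)ᵀ * k.K4)
  + ε ^ 3 • (k.K5 * g.S6 t * k.K5ᵀ)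

def R5 (ε t : ℝ) (k : Blocks n m₁ m₂) : Matrix (Fin m₁) (Fin m₂) ℝ :=
  k.K5 * g.Abar9 t + (g.Abar5 t)ᵀ * k.K5 + (g.Abar8 t)ᵀ * k.K6 - k.K5 * k.K6
  + k.K2ᵀ * g.S1 t * k.K3 + k.K4 * (g.S2 t)ᵀ * k.K3
  + ε • (k.K2ᵀ * g.S2 t * k.K5 + k.K2ᵀ * g.S3 t * k.K6
    + k.K4 * g.S4 t * k.K5 + k.K4 * g.S5 t * k.K6 + k.K5 * (g.S3 t)ᵀ * k.K3)
  + ε ^ 2 • (k.K5 * (g.S5 t)ᵀ * k.K5 + k.K5 * g.S6 t * k.K6)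

def R6 (ε t : ℝ) (k : Blocks n m₁ m₂) : Matrix (Fin m₂) (Fin m₂) ℝ :=
  k.K3ᵀ * g.S2 t * k.K5 + k.K3ᵀ * g.S3 t * k.K6
  + k.K5ᵀ * (g.S2 t)ᵀ * k.K3 + k.K6 * (g.S3 t)ᵀ * k.K3
  + ε • (k.K5ᵀ * g.S4 t * k.K5 + k.K5ᵀ * g.S5 t * k.K6
    + k.K6 * (g.S5 t)ᵀ * k.K5 + k.K6 * g.S6 t * k.K6)

/-- The right-hand sides of the transformed system, whose left-hand sides are
`K₁', ε K₂', K₃', ε K₄', ε K₅', K₆'`. -/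
def rhs (ε t : ℝ) (k : Blocks n m₁ m₂) : Blocks n m₁ m₂ where
  K1 := -(k.K1 * g.Abar1 t) - (g.Abar1 t)ᵀ * k.K1 + k.K2 * k.K2ᵀ + k.K3 * k.K3ᵀ
    - k.K1 * g.S1 t * k.K1 - g.D1 t - ε • g.R1 ε t k
  K2 := -(k.K1 * g.Abar2 t) + k.K2 * k.K4 - ε • g.R2 ε t k
  K3 := -(k.K2 * g.Abar6 t) - k.K3 * g.Abar9 t - (g.Abar1 t)ᵀ * k.K3 + k.K2 * k.K5
    + k.K3 * k.K6 - k.K1 * g.S1 t * k.K3 - ε • g.R3 ε t k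
  K4 := k.K4 ^ 2 - g.Lam t - ε • g.R4 ε t k
  K5 := -(k.K4 * g.Abar6 t) - (g.Abar2 t)ᵀ * k.K3 + k.K4 * k.K5 - ε • g.R5 ε t k
  K6 := -(k.K5ᵀ * g.Abar6 t) - k.K6 * g.Abar9 t - (g.Abar6 t)ᵀ * k.K5 - (g.Abar9 t)ᵀ * k.K6
    + k.K5ᵀ * k.K5 + k.K6 ^ 2 - k.K3ᵀ * g.S1 t * k.K3 - ε • g.R6 ε t k

/-- `K = (K₁, …, K₆)` solves the terminal-value problem for the transformed (singularly
perturbed) Riccati system on the whole interval `[0, t_f]`. -/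
structure IsSolution (ε : ℝ) (K : ℝ → Blocks n m₁ m₂) : Prop where
  deriv1 : ∀ t ∈ Icc 0 g.tf,
    HasDerivWithinAt (fun s => (K s).K1) (g.rhs ε t (K t)).K1 (Icc 0 g.tf) t
  deriv2 : ∀ t ∈ Icc 0 g.tf,
    HasDerivWithinAt (fun s => (K s).K2) (ε⁻¹ • (g.rhs ε t (K t)).K2) (Icc 0 g.tf) t
  deriv3 : ∀ t ∈ Icc 0 g.tf,
    HasDerivWithinAt (fun s => (K s).K3) (g.rhs ε t (K t)).K3 (Icc 0 g.tf) t
  deriv4 : ∀ t ∈ Icc 0 g.tf,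
    HasDerivWithinAt (fun s => (K s).K4) (ε⁻¹ • (g.rhs ε t (K t)).K4) (Icc 0 g.tf) t
  deriv5 : ∀ t ∈ Icc 0 g.tf,
    HasDerivWithinAt (fun s => (K s).K5) (ε⁻¹ • (g.rhs ε t (K t)).K5) (Icc 0 g.tf) t
  deriv6 : ∀ t ∈ Icc 0 g.tf,
    HasDerivWithinAt (fun s => (K s).K6) (g.rhs ε t (K t)).K6 (Icc 0 g.tf) t
  terminal : K g.tf = ⟨g.F1, 0, 0, 0, 0, 0⟩

/-- `K` solves the terminal-value problem for the reduced game-theoretic Riccati equation on the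
whole interval `[0, t_f]`; its solution is the outer term `K_{1,0}^o`. -/
structure IsOuterK1 (K : ℝ → Matrix (Fin n) (Fin n) ℝ) : Prop where
  deriv : ∀ t ∈ Icc 0 g.tf,
    HasDerivWithinAt K
      (-(K t * g.Abar1 t) - (g.Abar1 t)ᵀ * K t
        + K t * (g.Abar2 t * (g.Lam t)⁻¹ * (g.Abar2 t)ᵀ - g.S1 t) * K t - g.D1 t)
      (Icc 0 g.tf) t
  terminal : K g.tf = g.F1

/-- `K` solves the terminal-value problem for the control-theoretic Riccati equation on the
whole interval `[0, t_f]`; its solution is the outer term `K_{6,0}^o`. -/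
structure IsOuterK6 (K : ℝ → Matrix (Fin m₂) (Fin m₂) ℝ) : Prop where
  deriv : ∀ t ∈ Icc 0 g.tf,
    HasDerivWithinAt K
      (-(K t * g.Abar9 t) - (g.Abar9 t)ᵀ * K t + K t ^ 2 - (g.Abar6 t)ᵀ * g.Abar6 t)
      (Icc 0 g.tf) t
  terminal : K g.tf = 0

/-- The outer solution `K_{α,0}^o(t)`, `α = 1, …, 6`, built from `K_{1,0}^o` and `K_{6,0}^o`
(as `K_{3,0}^o ≡ 0`, the term `Λ^{-1/2} Ā₂ᵀ K_{3,0}^o` of `K_{5,0}^o` is absent). -/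
def outer (K10 : ℝ → Matrix (Fin n) (Fin n) ℝ) (K60 : ℝ → Matrix (Fin m₂) (Fin m₂) ℝ)
    (t : ℝ) : Blocks n m₁ m₂ where
  K1 := K10 t
  K2 := K10 t * g.Abar2 t * (g.LamSqrt t)⁻¹
  K3 := 0
  K4 := g.LamSqrt t
  K5 := g.Abar6 t
  K6 := K60 t

/-- `ℋ₁(τ) = exp(Λ^{1/2}(t_f) τ)`. -/
def H1 (τ : ℝ) : Matrix (Fin m₁) (Fin m₁) ℝ := NormedSpace.exp (τ • g.LamSqrt g.tf)

/-- `ℋ₂(τ) = (I + ℋ₁²(τ))⁻¹`. -/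
def H2 (τ : ℝ) : Matrix (Fin m₁) (Fin m₁) ℝ := (1 + g.H1 τ ^ 2)⁻¹

/-- The boundary corrections `K_{α,0}^b(τ)`, `α = 1, …, 6`. -/
def boundary (τ : ℝ) : Blocks n m₁ m₂ where
  K1 := 0
  K2 := (-2 : ℝ) • (g.F1 * g.Abar2 g.tf * (g.LamSqrt g.tf)⁻¹ * g.H1 τ ^ 2 * g.H2 τ)
  K3 := 0
  K4 := (-2 : ℝ) • (g.LamSqrt g.tf * g.H1 τ ^ 2 * g.H2 τ)
  K5 := (-2 : ℝ) • (g.H1 τ * g.H2 τ * g.Abar6 g.tf)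
  K6 := 0

/-- The zero-order asymptotic approximation
`K_{α,0}(t, ε) = K_{α,0}^o(t) + K_{α,0}^b((t - t_f) / ε)`, `α = 1, …, 6`. -/
def approx (K10 : ℝ → Matrix (Fin n) (Fin n) ℝ) (K60 : ℝ → Matrix (Fin m₂) (Fin m₂) ℝ)
    (ε t : ℝ) : Blocks n m₁ m₂ :=
  let o := g.outer K10 K60 t
  let b := g.boundary ((t - g.tf) / ε)
  ⟨o.K1 + b.K1, o.K2 + b.K2, o.K3 + b.K3, o.K4 + b.K4, o.K5 + b.K5, o.K6 + b.K6⟩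

end GameData

/-! The functions `𝒢₁, …, 𝒢₆` are the right ones: the transformed system is the original Riccati
equation, written for the blocks of its symmetric solution. -/

namespace Blocks

/-- The block matrix `K` with the blocks `K₁, εK₂, εK₃, εK₄, ε²K₅, ε²K₆` on and above its
diagonal. -/
def toMatrix (ε : ℝ) (k : Blocks n m₁ m₂) :
    Matrix (Fin n ⊕ (Fin m₁ ⊕ Fin m₂)) (Fin n ⊕ (Fin m₁ ⊕ Fin m₂)) ℝ :=
  fromBlocks k.K1 (fromCols (ε • k.K2) (ε • k.K3))
    (fromRows (ε • k.K2ᵀ) (ε • k.K3ᵀ))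
    (fromBlocks (ε • k.K4) (ε ^ 2 • k.K5) (ε ^ 2 • k.K5ᵀ) (ε ^ 2 • k.K6))

end Blocks

namespace GameData

variable (g : GameData n m₁ m₂ l)

/-- The right-hand side `-K A - Aᵀ K + K (S_u(ε) - S_v) K - D` of the Riccati equation of the
game, where `S_u(ε) = ε⁻² B Bᵀ`. -/
def riccati (ε t : ℝ) (K : Matrix (Fin n ⊕ (Fin m₁ ⊕ Fin m₂)) (Fin n ⊕ (Fin m₁ ⊕ Fin m₂)) ℝ) :
    Matrix (Fin n ⊕ (Fin m₁ ⊕ Fin m₂)) (Fin n ⊕ (Fin m₁ ⊕ Fin m₂)) ℝ :=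
  let A := fromBlocks (g.A1 t) (g.A2 t) (g.A3 t) (g.A4 t)
  let B : Matrix (Fin n ⊕ (Fin m₁ ⊕ Fin m₂)) (Fin m₁ ⊕ Fin m₂) ℝ := fromRows 0 1;
  (-(K * A) - Aᵀ * K + K * (((ε ^ 2)⁻¹ : ℝ) • (B * Bᵀ) - g.Sv t) * K
    - fromBlocks (g.D1 t) 0 0 (g.D2 t))

theorem riccati_toMatrix (hg : g.Standing) (h2 : g.BlockVanishes) {ε : ℝ} (hε : ε ≠ 0) {t : ℝ}
    (ht : t ∈ Icc 0 g.tf) (k : Blocks n m₁ m₂) (h_K1 : k.K1ᵀ = k.K1) (h_K4 : k.K4ᵀ = k.K4)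
    (h_K6 : k.K6ᵀ = k.K6) :
    g.riccati ε t (k.toMatrix ε) =
      let r := g.rhs ε t k
      Blocks.toMatrix ε ⟨r.K1, ε⁻¹ • r.K2, r.K3, ε⁻¹ • r.K4, ε⁻¹ • r.K5, r.K6⟩ := by
  have h_sv : (g.Sv t)ᵀ = g.Sv t := by
    have h_G : ((g.G t)⁻¹)ᵀ = (g.G t)⁻¹ := by
      rw [transpose_nonsing_inv]
      congr 1
      exact (hg.G_posDef t ht).1
    simp only [Sv, transpose_mul, transpose_transpose, h_G, Matrix.mul_assoc]
  have h_svb : g.Sv t = fromBlocks (g.S1 t) (fromCols (g.S2 t) (g.S3 t))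
      (fromRows (g.S2 t)ᵀ (g.S3 t)ᵀ) (fromBlocks (g.S4 t) (g.S5 t) (g.S5 t)ᵀ (g.S6 t)) := by
    ext i j
    rcases i with i | i | i <;> rcases j with j | j | j <;>
      first
      | rfl
      | exact (congrFun (congrFun h_sv _) _).symm
  have h_A2 : g.A2 t = fromCols (g.Abar2 t) 0 := by
    rw [← h2 t ht]; exact (fromCols_toCols _).symm
  have h_A3 : g.A3 t = fromRows (g.Abar4 t) (g.Abar7 t) := (fromRows_toRows _).symm
  have h_A4 : g.A4 t = fromBlocks (g.Abar5 t) (g.Abar6 t) (g.Abar8 t) (g.Abar9 t) :=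
    (fromBlocks_toBlocks _).symm
  have h_D2 : g.D2 t = fromBlocks (g.Lam t) 0 0 0 := by
    ext i j
    rcases i with i | i <;> rcases j with j | j <;>
      simp [D2, Lam, diagonal_apply, hg.lam_zero t ht]
  have h_BB : (fromRows 0 1 : Matrix (Fin n ⊕ (Fin m₁ ⊕ Fin m₂)) (Fin m₁ ⊕ Fin m₂) ℝ)
      * (fromRows 0 1 : Matrix (Fin n ⊕ (Fin m₁ ⊕ Fin m₂)) (Fin m₁ ⊕ Fin m₂) ℝ)ᵀ
      = fromBlocks 0 (fromCols 0 0) (fromRows 0 0) (fromBlocks 1 0 0 1) := by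
    ext i j
    rcases i with i | i | i <;> rcases j with j | j | j <;>
      simp [Matrix.mul_apply, Matrix.one_apply]
  have h_S1 : (g.S1 t)ᵀ = g.S1 t := by
    ext i j; exact congrFun (congrFun h_sv (Sum.inl i)) (Sum.inl j)
  have h_S4 : (g.S4 t)ᵀ = g.S4 t := by
    ext i j; exact congrFun (congrFun h_sv (Sum.inr (Sum.inl i))) (Sum.inr (Sum.inl j))
  have h_S6 : (g.S6 t)ᵀ = g.S6 t := by
    ext i j; exact congrFun (congrFun h_sv (Sum.inr (Sum.inr i))) (Sum.inr (Sum.inr j))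
  dsimp only [riccati, rhs, R1, R2, R3, R4, R5, R6, Blocks.toMatrix]
  rw [h_BB, h_svb, h_A2, h_A3, h_A4, h_D2]
  have h_A1 : g.A1 t = g.Abar1 t := rfl
  rw [h_A1]
  clear h_svb h_sv h_A1 h_A2 h_A3 h_A4 h_BB h_D2
  generalize g.S1 t = S1, g.S2 t = S2, g.S3 t = S3, g.S4 t = S4, g.S5 t = S5, g.S6 t = S6,
    g.Abar1 t = a1, g.Abar2 t = a2, g.Abar4 t = a4, g.Abar5 t = a5, g.Abar6 t = a6,
    g.Abar7 t = a7, g.Abar8 t = a8, g.Abar9 t = a9, g.D1 t = D1, g.Lam t = L at h_S1 h_S4 h_S6 ⊢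
  obtain ⟨k1, k2, k3, k4, k5, k6⟩ := k
  dsimp only at h_K1 h_K4 h_K6 ⊢
  have e_cc : ∀ {p q r : ℕ} (A A' : Matrix (Fin p) (Fin q) ℝ) (B B' : Matrix (Fin p) (Fin r) ℝ),
      fromCols A B + fromCols A' B' = fromCols (A + A') (B + B') := by
    intro p q r A A' B B'; ext i j; rcases j with j | j <;> rfl
  have e_rr : ∀ {p q r : ℕ} (A A' : Matrix (Fin q) (Fin p) ℝ) (B B' : Matrix (Fin r) (Fin p) ℝ),
      fromRows A B + fromRows A' B' = fromRows (A + A') (B + B') := by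
    intro p q r A A' B B'; ext i j; rcases i with i | i <;> rfl
  have e_cs : ∀ {p q r : ℕ} (c : ℝ) (A : Matrix (Fin p) (Fin q) ℝ) (B : Matrix (Fin p) (Fin r) ℝ),
      c • fromCols A B = fromCols (c • A) (c • B) := by
    intro p q r c A B; ext i j; rcases j with j | j <;> rfl
  have e_rs : ∀ {p q r : ℕ} (c : ℝ) (A : Matrix (Fin q) (Fin p) ℝ) (B : Matrix (Fin r) (Fin p) ℝ),
      c • fromRows A B = fromRows (c • A) (c • B) := by
    intro p q r c A B; ext i j; rcases i with i | i <;> rfl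
  simp only [sub_eq_add_neg, fromBlocks_multiply, fromCols_mul_fromRows, fromBlocks_transpose,
    transpose_fromCols, transpose_fromRows, fromCols_fromRows_eq_fromBlocks, fromRows_mul, mul_fromCols,
    fromCols_mul_fromBlocks, fromBlocks_mul_fromRows, fromBlocks_add, fromBlocks_neg,
    fromBlocks_smul, fromRows_neg, fromCols_neg, e_cc, e_rr, e_cs, e_rs,
    neg_zero, add_zero]
  simp only [fromBlocks_inj]
  refine ⟨?_, (fromCols_ext_iff ..).2 ⟨?_, ?_⟩, (fromRows_ext_iff ..).2 ⟨?_, ?_⟩,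
    ?_, ?_, ?_, ?_⟩
  all_goals
    simp only [transpose_zero, Matrix.mul_zero, Matrix.zero_mul, smul_zero, zero_add,
      Matrix.mul_one, Matrix.mul_add, Matrix.add_mul, Matrix.mul_neg, Matrix.neg_mul,
      Matrix.smul_mul, Matrix.mul_smul, transpose_add, transpose_neg, transpose_smul,
      transpose_mul, transpose_transpose, h_K1, h_K4, h_K6, h_S1, h_S4, h_S6, pow_two (M := Matrix _ _ ℝ),
      Matrix.mul_assoc]
  all_goals
    ext i j
    simp only [Matrix.add_apply, Matrix.neg_apply, Matrix.smul_apply, smul_eq_mul]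
    field_simp
    ring

end GameData

end

end CheapControl

open CheapControl

/-! In reversed time `s = t_f - t` the boundary layer sits at `s = 0`, and the solution is sought in
a tube around the approximation. Let `φ` and `ψ` denote the scalar layer profiles. The approximation
of `K₄` is the diagonal matrix `d = Λ^{1/2}(t_f - s) - Λ^{1/2}(t_f) φ(-s/ε)`, and the errors of the
fast blocks satisfy `ε δ₂' = -(δ₂ d + f₂)`, `ε δ₄' = -(d δ₄ + δ₄ d + f₄)`, `ε δ₅' = -(d δ₅ + f₅)`.
As `d` is diagonal, these linear parts decouple into scalar equations.

Three observations give the estimate. First, `d` vanishes at `s = 0`, but its entries are at least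
`β - M e^{-βs/ε}`; integrated against `1/ε`, the missing damping amounts to at most `M/β`, so it
costs only a factor independent of `ε` (`fast_scalar_bound`). Second, the layer terms are frozen at
`t_f`, which leaves residuals of size `s e^{-βs/ε} ≤ ε/β` in the fast equations (`mul_exp_neg_le`).
Third, the layer enters the slow equations with size `e^{-βs/ε}`, which is not small, but its
integral is `O(ε)` (`slow_gronwall`).

The system closes in triangular order. The forcing `f₄` is bounded by `‖δ₄‖² + Cε`, so a small a
priori bound on `δ₄` already makes it `O(ε)`; then `δ₂` and `δ₅` are bounded by the past of the slow
error; then Grönwall bounds the slow error (`two_scale_estimate`). The outcome is that a solution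
staying within a fixed `η` of the approximation stays within `Aε` of it (`exists_apriori_bound`).
For `Aε < η` it can never leave the tube, so a solution of the equation cut off outside the tube is
a solution of the true one on the whole interval (`exists_solution_of_apriori`).

Uniqueness comes from the local Lipschitz property of the polynomial right-hand side. Symmetry comes
from the same argument applied to the difference of a block and its transpose. The outer term
`K_{6,0}^o` is `Y X⁻¹` for the linear Hamiltonian system of its Riccati equation, where a monotone
quantity shows that `X` remains invertible (`isUnit_hamiltonian`). -/

namespace CheapControl

/-! ### Calculus of matrix-valued functions in the Frobenius norm. -/

section MatrixCalculus

variable {a b c : Type*} [Fintype a] [Fintype b] [Fintype c]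

/-- Matrix multiplication as a continuous bilinear map. -/
noncomputable def mulCLM (a b c : Type*) [Fintype a] [Fintype b] [Fintype c] :
    Matrix a b ℝ →L[ℝ] Matrix b c ℝ →L[ℝ] Matrix a c ℝ :=
  LinearMap.mkContinuous₂ (LinearMap.mk₂ ℝ (fun A B => A * B) Matrix.add_mul
    (fun r A B => Matrix.smul_mul r A B) Matrix.mul_add (fun r A B => Matrix.mul_smul A r B)) 1
    fun A B => by simpa using frobenius_norm_mul A B

/-- Transposition as a continuous linear map. -/
noncomputable def transposeCLM (a b : Type*) [Fintype a] [Fintype b] :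
    Matrix a b ℝ →L[ℝ] Matrix b a ℝ :=
  (transposeLinearEquiv a b ℝ ℝ).toLinearMap.mkContinuous 1
    fun A => by simp

theorem continuousOn_matrix_mul {X : Type*} [TopologicalSpace X] {s : Set X}
    {f : X → Matrix a b ℝ} {g : X → Matrix b c ℝ}
    (hf : ContinuousOn f s) (hg : ContinuousOn g s) : ContinuousOn (fun x => f x * g x) s :=
  ((mulCLM a b c).continuous.comp_continuousOn hf).clm_apply hg

theorem continuousOn_matrix_transpose {X : Type*} [TopologicalSpace X] {s : Set X}
    {f : X → Matrix a b ℝ} (hf : ContinuousOn f s) :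
    ContinuousOn (fun x => (f x)ᵀ) s :=
  (transposeCLM a b).continuous.comp_continuousOn hf

theorem hasDerivWithinAt_matrix_mul {f : ℝ → Matrix a b ℝ}
    {g : ℝ → Matrix b c ℝ} {f' : Matrix a b ℝ}
    {g' : Matrix b c ℝ} {s : Set ℝ} {t : ℝ} (hf : HasDerivWithinAt f f' s t)
    (hg : HasDerivWithinAt g g' s t) :
    HasDerivWithinAt (fun t => f t * g t) (f t * g' + f' * g t) s t :=
  (mulCLM a b c).hasDerivWithinAt_of_bilinear hf hg

theorem hasDerivWithinAt_matrix_transpose {f : ℝ → Matrix a b ℝ}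
    {f' : Matrix a b ℝ} {s : Set ℝ} {t : ℝ} (hf : HasDerivWithinAt f f' s t) :
    HasDerivWithinAt (fun t => (f t)ᵀ) f'ᵀ s t :=
  (transposeCLM a b).hasFDerivAt.comp_hasDerivWithinAt t hf

theorem norm_entry_le {ι κ : Type*} [Fintype ι] [Fintype κ] (A : Matrix ι κ ℝ) (i : ι) (j : κ) :
    |A i j| ≤ ‖A‖ := by
  have h : ‖A i j‖ ^ 2 ≤ ∑ i, ∑ j, ‖A i j‖ ^ 2 :=
    (Finset.single_le_sum (f := fun j => ‖A i j‖ ^ 2) (fun _ _ => by positivity)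
      (Finset.mem_univ j)).trans
    (Finset.single_le_sum (f := fun i => ∑ j, ‖A i j‖ ^ 2)
      (fun _ _ => by positivity) (Finset.mem_univ i))
  rw [frobenius_norm_def, ← Real.sqrt_eq_rpow, ← Real.norm_eq_abs]
  refine Real.le_sqrt_of_sq_le ?_
  simpa using h

/-- Reading off an entry as a continuous linear map. -/
noncomputable def entryCLM {ι κ : Type*} [Fintype ι] [Fintype κ] (i : ι) (j : κ) :
    Matrix ι κ ℝ →L[ℝ] ℝ :=
  (entryLinearMap ℝ ℝ i j).mkContinuous 1 fun A => by simpa using norm_entry_le A i j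

theorem hasDerivWithinAt_entry {ι κ : Type*} [Fintype ι] [Fintype κ] {f : ℝ → Matrix ι κ ℝ}
    {f' : Matrix ι κ ℝ} {s : Set ℝ} {t : ℝ} (hf : HasDerivWithinAt f f' s t) (i : ι) (j : κ) :
    HasDerivWithinAt (fun t => f t i j) (f' i j) s t :=
  (entryCLM i j).hasFDerivAt.comp_hasDerivWithinAt t hf

/-- The factor `a * b` is crude, coming from the triangle inequality over matrix units; only its
independence of `ε` and `t` matters later. -/
theorem norm_matrix_le_of_entry_le {a b : ℕ} {C : ℝ} {A : Matrix (Fin a) (Fin b) ℝ}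
    (hA : ∀ i j, |A i j| ≤ C) : ‖A‖ ≤ a * b * C := by
  have h : A = ∑ i, ∑ j, A i j • Matrix.single i j (1 : ℝ) := by
    conv_lhs => rw [matrix_eq_sum_single A]
    simp [Matrix.smul_single]
  have hs : ∀ (i : Fin a) (j : Fin b), ‖Matrix.single i j (1 : ℝ)‖ = 1 := by
    intro i j
    rw [frobenius_norm_def, Finset.sum_eq_single i, Finset.sum_eq_single j]
    · simp
    · intro k _ hk; simp [hk.symm]
    · simp
    · intro k _ hk; simp [hk.symm]
    · simp
  rw [h]
  calc ‖∑ i, ∑ j, A i j • Matrix.single i j (1 : ℝ)‖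
      ≤ ∑ i : Fin a, ∑ j : Fin b, C := by
        refine norm_sum_le_of_le _ fun i _ => norm_sum_le_of_le _ fun j _ => ?_
        rw [norm_smul, hs, mul_one]; exact hA i j
    _ = a * b * C := by simp [mul_assoc]

theorem norm_diagonal_le {a : ℕ} {C : ℝ} (hC : 0 ≤ C) {v : Fin a → ℝ} (hv : ∀ i, |v i| ≤ C) :
    ‖(diagonal v : Matrix (Fin a) (Fin a) ℝ)‖ ≤ a * a * C :=
  norm_matrix_le_of_entry_le fun i j => by
    by_cases h : i = j
    · subst h; simpa using hv i
    · simpa [h] using hC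

theorem continuousOn_matrix {ι κ : Type*} [Fintype ι] [Fintype κ] {X : Type*}
    [TopologicalSpace X] {s : Set X} {f : X → Matrix ι κ ℝ} :
    ContinuousOn f s ↔ ∀ i j, ContinuousOn (fun x => f x i j) s :=
  ⟨fun h i j => (entryCLM i j).continuous.comp_continuousOn h, fun h => by
    refine continuousOn_pi.2 fun i => continuousOn_pi.2 fun j => h i j⟩

end MatrixCalculus

/-! ### Vector fields that are locally Lipschitz uniformly in a parameter. -/

section UnifLip

variable {P E F : Type*} [TopologicalSpace P] [NormedAddCommGroup E] [NormedAddCommGroup F]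

/-- A family of maps `V p`, `p ∈ s`, that is continuous in `p`, and bounded and Lipschitz on every
ball uniformly in `p`. -/
structure UnifLip (s : Set P) (V : P → E → F) : Prop where
  cont : ∀ x, ContinuousOn (fun p => V p x) s
  bdd : ∀ R, ∃ M, ∀ p ∈ s, ∀ x, ‖x‖ ≤ R → ‖V p x‖ ≤ M
  lip : ∀ R, ∃ L, ∀ p ∈ s, ∀ x y, ‖x‖ ≤ R → ‖y‖ ≤ R → ‖V p x - V p y‖ ≤ L * ‖x - y‖

namespace UnifLip

variable {s : Set P} {V W : P → E → F}

theorem exists_bound (h : UnifLip s V) (R : ℝ) :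
    ∃ M, 0 ≤ M ∧ ∀ p ∈ s, ∀ x, ‖x‖ ≤ R → ‖V p x‖ ≤ M := by
  obtain ⟨M, hM⟩ := h.bdd R
  exact ⟨max M 0, le_max_right _ _, fun p hp x hx => (hM p hp x hx).trans (le_max_left _ _)⟩

theorem exists_lipschitz (h : UnifLip s V) (R : ℝ) :
    ∃ L, 0 ≤ L ∧ ∀ p ∈ s, ∀ x y, ‖x‖ ≤ R → ‖y‖ ≤ R → ‖V p x - V p y‖ ≤ L * ‖x - y‖ := by
  obtain ⟨L, hL⟩ := h.lip R
  exact ⟨max L 0, le_max_right _ _, fun p hp x y hx hy => (hL p hp x y hx hy).trans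
    (mul_le_mul_of_nonneg_right (le_max_left _ _) (norm_nonneg _))⟩

theorem add (hV : UnifLip s V) (hW : UnifLip s W) : UnifLip s fun p x => V p x + W p x where
  cont x := (hV.cont x).add (hW.cont x)
  bdd R := by
    obtain ⟨M, hM⟩ := hV.bdd R
    obtain ⟨N, hN⟩ := hW.bdd R
    exact ⟨M + N, fun p hp x hx =>
      (norm_add_le _ _).trans (add_le_add (hM p hp x hx) (hN p hp x hx))⟩
  lip R := by
    obtain ⟨M, hM⟩ := hV.lip R
    obtain ⟨N, hN⟩ := hW.lip R
    refine ⟨M + N, fun p hp x y hx hy => ?_⟩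
    rw [add_sub_add_comm, add_mul]
    exact (norm_add_le _ _).trans (add_le_add (hM p hp x y hx hy) (hN p hp x y hx hy))

theorem neg (hV : UnifLip s V) : UnifLip s fun p x => -V p x where
  cont x := (hV.cont x).neg
  bdd R := by simpa only [norm_neg] using hV.bdd R
  lip R := by
    obtain ⟨M, hM⟩ := hV.lip R
    refine ⟨M, fun p hp x y hx hy => ?_⟩
    rw [← neg_sub', norm_neg]
    exact hM p hp x y hx hy

theorem sub (hV : UnifLip s V) (hW : UnifLip s W) : UnifLip s fun p x => V p x - W p x := by
  simpa only [sub_eq_add_neg] using hV.add hW.neg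

theorem coeff {c : P → F} (hs : IsCompact s) (hc : ContinuousOn c s) :
    UnifLip s fun p (_ : E) => c p where
  cont _ := hc
  bdd R := by
    obtain ⟨M, hM⟩ := hs.exists_bound_of_continuousOn hc
    exact ⟨M, fun p hp _ _ => hM p hp⟩
  lip R := ⟨0, by simp⟩

theorem smul [NormedSpace ℝ F] {c : P → ℝ} (hs : IsCompact s) (hc : ContinuousOn c s)
    (hV : UnifLip s V) : UnifLip s fun p x => c p • V p x where
  cont x := hc.smul (hV.cont x)
  bdd R := by
    obtain ⟨M, hM⟩ := hs.exists_bound_of_continuousOn hc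
    obtain ⟨N, hN⟩ := hV.bdd R
    refine ⟨M * N, fun p hp x hx => ?_⟩
    rw [norm_smul]
    exact mul_le_mul (hM p hp) (hN p hp x hx) (norm_nonneg _) ((norm_nonneg _).trans (hM p hp))
  lip R := by
    obtain ⟨M, hM⟩ := hs.exists_bound_of_continuousOn hc
    obtain ⟨N, hN⟩ := hV.lip R
    refine ⟨M * N, fun p hp x y hx hy => ?_⟩
    rw [← smul_sub, norm_smul, mul_assoc]
    exact mul_le_mul (hM p hp) (hN p hp x y hx hy) (norm_nonneg _)
      ((norm_nonneg _).trans (hM p hp))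

theorem fst {E₁ E₂ : Type*} [NormedAddCommGroup E₁] [NormedAddCommGroup E₂]
    {V : P → E → E₁ × E₂} (hV : UnifLip s V) : UnifLip s fun p x => (V p x).1 where
  cont x := continuous_fst.comp_continuousOn (hV.cont x)
  bdd R := (hV.bdd R).imp fun _ h p hp x hx => (norm_fst_le _).trans (h p hp x hx)
  lip R := (hV.lip R).imp fun _ h p hp x y hx hy =>
    (norm_fst_le (V p x - V p y)).trans (h p hp x y hx hy)

theorem snd {E₁ E₂ : Type*} [NormedAddCommGroup E₁] [NormedAddCommGroup E₂]
    {V : P → E → E₁ × E₂} (hV : UnifLip s V) : UnifLip s fun p x => (V p x).2 where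
  cont x := continuous_snd.comp_continuousOn (hV.cont x)
  bdd R := (hV.bdd R).imp fun _ h p hp x hx => (norm_snd_le _).trans (h p hp x hx)
  lip R := (hV.lip R).imp fun _ h p hp x y hx hy =>
    (norm_snd_le (V p x - V p y)).trans (h p hp x y hx hy)

theorem id : UnifLip s fun (_ : P) (x : E) => x where
  cont _ := continuousOn_const
  bdd R := ⟨R, fun _ _ _ h => h⟩
  lip R := ⟨1, fun _ _ _ _ _ _ => by simp⟩

theorem prodMk {E₁ E₂ : Type*} [NormedAddCommGroup E₁] [NormedAddCommGroup E₂]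
    {V : P → E → E₁} {W : P → E → E₂} (hV : UnifLip s V) (hW : UnifLip s W) :
    UnifLip s fun p x => (V p x, W p x) where
  cont x := (hV.cont x).prodMk (hW.cont x)
  bdd R := by
    obtain ⟨M, hM⟩ := hV.bdd R
    obtain ⟨N, hN⟩ := hW.bdd R
    exact ⟨max M N, fun p hp x hx => norm_prod_le_iff.2
      ⟨(hM p hp x hx).trans (le_max_left _ _), (hN p hp x hx).trans (le_max_right _ _)⟩⟩
  lip R := by
    obtain ⟨M, hM⟩ := hV.lip R
    obtain ⟨N, hN⟩ := hW.lip R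
    refine ⟨max M N, fun p hp x y hx hy => norm_prod_le_iff.2 ⟨?_, ?_⟩⟩
    · exact (hM p hp x y hx hy).trans
        (mul_le_mul_of_nonneg_right (le_max_left _ _) (norm_nonneg _))
    · exact (hN p hp x y hx hy).trans
        (mul_le_mul_of_nonneg_right (le_max_right _ _) (norm_nonneg _))

theorem matrix_transpose {a b : ℕ} {V : P → E → Matrix (Fin a) (Fin b) ℝ} (hV : UnifLip s V) :
    UnifLip s fun p x => (V p x)ᵀ where
  cont x := continuousOn_matrix_transpose (hV.cont x)
  bdd R := by simpa only [frobenius_norm_transpose] using hV.bdd R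
  lip R := by simpa only [← transpose_sub, frobenius_norm_transpose] using hV.lip R

theorem matrix_mul {a b c : ℕ} {V : P → E → Matrix (Fin a) (Fin b) ℝ}
    {W : P → E → Matrix (Fin b) (Fin c) ℝ} (hV : UnifLip s V) (hW : UnifLip s W) :
    UnifLip s fun p x => V p x * W p x where
  cont x := continuousOn_matrix_mul (hV.cont x) (hW.cont x)
  bdd R := by
    obtain ⟨M, hM⟩ := hV.bdd R
    obtain ⟨N, hN⟩ := hW.bdd R
    exact ⟨M * N, fun p hp x hx => (frobenius_norm_mul _ _).trans <|
      mul_le_mul (hM p hp x hx) (hN p hp x hx) (norm_nonneg _)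
        ((norm_nonneg _).trans (hM p hp x hx))⟩
  lip R := by
    obtain ⟨M, hM₀, hM⟩ := hV.exists_bound R
    obtain ⟨N, hN₀, hN⟩ := hW.exists_bound R
    obtain ⟨A, hA⟩ := hV.lip R
    obtain ⟨B, hB⟩ := hW.lip R
    refine ⟨A * N + M * B, fun p hp x y hx hy => ?_⟩
    have h : V p x * W p x - V p y * W p y
        = (V p x - V p y) * W p x + V p y * (W p x - W p y) := by
      rw [Matrix.sub_mul, Matrix.mul_sub]; abel
    rw [h]
    calc _ ≤ ‖V p x - V p y‖ * ‖W p x‖ + ‖V p y‖ * ‖W p x - W p y‖ :=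
          (norm_add_le _ _).trans (add_le_add (frobenius_norm_mul _ _) (frobenius_norm_mul _ _))
      _ ≤ (A * ‖x - y‖) * N + M * (B * ‖x - y‖) := by
          have := hA p hp x y hx hy
          have := hB p hp x y hx hy
          have := hN p hp x hx
          have := hM p hp y hy
          have := (norm_nonneg _).trans (hA p hp x y hx hy)
          gcongr
      _ = _ := by ring

theorem comp_param {Q : Type*} [TopologicalSpace Q] {u : Set Q} {f : Q → P} (hV : UnifLip s V)
    (hf : ContinuousOn f u) (hm : MapsTo f u s) : UnifLip u fun q x => V (f q) x where
  cont x := (hV.cont x).comp hf hm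
  bdd R := (hV.bdd R).imp fun _ h q hq => h (f q) (hm hq)
  lip R := (hV.lip R).imp fun _ h q hq => h (f q) (hm hq)

/-- Moving the point costs at most the uniform Lipschitz constant times the displacement; moving the
parameter at a fixed point is covered by `cont`. Picard–Lindelöf needs this because the cut-off of
the field is centred at a moving point. -/
theorem continuousOn_comp (hV : UnifLip s V) {c : P → E} {R : ℝ} (hc : ContinuousOn c s)
    (hR : ∀ p ∈ s, ‖c p‖ ≤ R) : ContinuousOn (fun p => V p (c p)) s := by
  obtain ⟨L, hL₀, hL⟩ := hV.exists_lipschitz R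
  intro p hp
  have h1 : Filter.Tendsto (fun q => L * ‖c q - c p‖ + ‖V q (c p) - V p (c p)‖)
      (nhdsWithin p s) (nhds 0) := by
    have hc' := (tendsto_iff_norm_sub_tendsto_zero.1 (hc p hp)).const_mul L
    have hV' := tendsto_iff_norm_sub_tendsto_zero.1 (hV.cont (c p) p hp)
    simpa using hc'.add hV'
  refine tendsto_iff_norm_sub_tendsto_zero.2 ?_
  refine squeeze_zero' (.of_forall fun _ => norm_nonneg _) ?_ h1
  filter_upwards [self_mem_nhdsWithin] with q hq
  calc ‖V q (c q) - V p (c p)‖ = ‖(V q (c q) - V q (c p)) + (V q (c p) - V p (c p))‖ := by abel_nf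
    _ ≤ _ := (norm_add_le _ _).trans (add_le_add (hL q hq _ _ (hR q hq) (hR p hp)) le_rfl)

end UnifLip

end UnifLip

/-! ### The radial cut-off. -/

section Retraction

variable {E : Type*} [NormedAddCommGroup E] [NormedSpace ℝ E]

/-- The radial retraction onto the closed ball of radius `R`. -/
noncomputable def radial (R : ℝ) (x : E) : E := (R / max R ‖x‖) • x

theorem radial_of_norm_le {R : ℝ} (hR : 0 < R) {x : E} (hx : ‖x‖ ≤ R) : radial R x = x := by
  rw [radial, max_eq_left hx, div_self hR.ne', one_smul]

theorem norm_radial_le {R : ℝ} (hR : 0 < R) (x : E) : ‖radial R x‖ ≤ R := by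
  have hm : 0 < max R ‖x‖ := lt_max_of_lt_left hR
  rw [radial, norm_smul, Real.norm_of_nonneg (by positivity), div_mul_eq_mul_div,
    div_le_iff₀ hm]
  exact mul_le_mul_of_nonneg_left (le_max_right _ _) hR.le

/-- The difference splits into the scaled difference of the points and the change of the scaling
factor; each is at most `‖x - y‖`, whence the 2. No inner product is used, as the state space
carries a maximum norm. -/
theorem norm_radial_sub_le {R : ℝ} (hR : 0 < R) (x y : E) :
    ‖radial R x - radial R y‖ ≤ 2 * ‖x - y‖ := by
  set a := max R ‖x‖ with ha
  set b := max R ‖y‖ with hb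
  have ha₀ : 0 < a := lt_max_of_lt_left hR
  have hb₀ : 0 < b := lt_max_of_lt_left hR
  have hab : |b - a| ≤ ‖x - y‖ := by
    have h1 : |max R ‖y‖ - max R ‖x‖| ≤ |‖y‖ - ‖x‖| := by
      simpa using abs_max_sub_max_le_abs ‖y‖ ‖x‖ R |> fun h => by
        simpa [max_comm] using h
    rw [norm_sub_rev]
    exact h1.trans (abs_norm_sub_norm_le y x)
  have key : radial R x - radial R y = (R / a) • (x - y) + ((b - a) * R / (a * b)) • y := by
    rw [radial, radial, ← ha, ← hb]
    have : (b - a) * R / (a * b) = R / a - R / b := by field_simp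
    rw [this, smul_sub, sub_smul]; abel
  rw [key, two_mul]
  refine (norm_add_le _ _).trans (add_le_add ?_ ?_)
  · rw [norm_smul, Real.norm_of_nonneg (by positivity)]
    exact mul_le_of_le_one_left (norm_nonneg _) ((div_le_one ha₀).2 (le_max_left _ _))
  · rw [norm_smul, Real.norm_eq_abs, abs_div, abs_mul, abs_of_pos hR, abs_of_pos (mul_pos ha₀ hb₀)]
    refine le_trans ?_ hab
    rw [div_mul_eq_mul_div, div_le_iff₀ (mul_pos ha₀ hb₀), mul_assoc]
    exact mul_le_mul_of_nonneg_left (mul_le_mul (le_max_left _ _) (le_max_right _ _)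
      (norm_nonneg _) ha₀.le) (abs_nonneg _)

end Retraction

/-! ### Existence from a priori bounds, time reversal and uniqueness. -/

section Existence

variable {E : Type*} [NormedAddCommGroup E] [NormedSpace ℝ E]

theorem hasDerivWithinAt_Ici_of_Icc {f : ℝ → E} {f' : E} {a b t : ℝ} (ht : t ∈ Ico a b)
    (h : HasDerivWithinAt f f' (Icc a b) t) : HasDerivWithinAt f f' (Ici t) t :=
  h.mono_of_mem_nhdsWithin <| Filter.mem_of_superset (Icc_mem_nhdsGE ht.2)
    (Icc_subset_Icc_left ht.1)

/-- A solution of an initial value problem exists on the whole of `[0, T]` as soon as every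
solution on a shorter interval that stays within distance `R` of a reference curve stays in fact
within a smaller distance `r`. -/
theorem exists_solution_of_apriori [CompleteSpace E] {T R r : ℝ} (hT : 0 ≤ T) (hr : 0 ≤ r)
    (hrR : r < R) {V : ℝ → E → E} (hV : UnifLip (Icc 0 T) V) {y : ℝ → E}
    (hy : ContinuousOn y (Icc 0 T)) (x₀ : E)
    (hap : ∀ S ∈ Icc 0 T, ∀ x : ℝ → E, x 0 = x₀ → ContinuousOn x (Icc 0 S) →
      (∀ s ∈ Ico 0 S, HasDerivWithinAt x (V s (x s)) (Ici s) s) →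
      (∀ s ∈ Icc 0 S, ‖x s - y s‖ ≤ R) → ∀ s ∈ Icc 0 S, ‖x s - y s‖ ≤ r)
    (h0 : ‖x₀ - y 0‖ ≤ r) :
    ∃ x : ℝ → E, x 0 = x₀ ∧ (∀ s ∈ Icc 0 T, HasDerivWithinAt x (V s (x s)) (Icc 0 T) s) ∧
      ∀ s ∈ Icc 0 T, ‖x s - y s‖ ≤ r := by
  have hR : 0 < R := hr.trans_lt hrR
  obtain ⟨Y, hY⟩ := isCompact_Icc.exists_bound_of_continuousOn hy
  have hball : ∀ s ∈ Icc 0 T, ∀ x : E, ‖y s + radial R (x - y s)‖ ≤ Y + R := fun s hs x =>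
    (norm_add_le _ _).trans (add_le_add (hY s hs) (norm_radial_le hR _))
  obtain ⟨M, hM₀, hM⟩ := hV.exists_bound (Y + R)
  obtain ⟨L, hL₀, hL⟩ := hV.exists_lipschitz (Y + R)
  -- The field cut off outside the tube of radius `R` around `y` is bounded by `M` and Lipschitz
  -- with constant `2L` everywhere, so a solution cannot travel farther than `M * T` and exists on
  -- all of `[0, T]`.
  have hpl : IsPicardLindelof (fun s x => V s (y s + radial R (x - y s)))
      (⟨0, left_mem_Icc.2 hT⟩ : Icc (0 : ℝ) T) x₀ ⟨M * T, mul_nonneg hM₀ hT⟩ 0 ⟨M, hM₀⟩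
      ⟨L * 2, by positivity⟩ := by
    refine ⟨fun s hs => LipschitzOnWith.of_dist_le_mul fun x _ z _ => ?_, fun x _ => ?_,
      fun s hs x _ => ?_, ?_⟩
    · rw [dist_eq_norm, dist_eq_norm]
      refine (hL s hs _ _ (hball s hs x) (hball s hs z)).trans ?_
      change _ ≤ L * 2 * ‖x - z‖
      rw [mul_assoc]
      refine mul_le_mul_of_nonneg_left ?_ hL₀
      rw [add_sub_add_left_eq_sub]
      refine (norm_radial_sub_le hR _ _).trans_eq ?_
      rw [sub_sub_sub_cancel_right]
    · refine hV.continuousOn_comp (R := Y + R) (hy.add ?_) fun s hs => hball s hs x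
      have hrad : Continuous (radial R : E → E) :=
        (LipschitzWith.of_dist_le_mul (K := 2) fun x z => by
          rw [dist_eq_norm, dist_eq_norm]; exact norm_radial_sub_le hR x z).continuous
      exact hrad.comp_continuousOn (continuousOn_const.sub hy)
    · exact hM s hs _ (hball s hs x)
    · change M * max (T - 0) (0 - 0) ≤ M * T - 0
      rw [sub_zero, sub_zero, sub_zero, max_eq_left hT]
  obtain ⟨x, hx0, hx⟩ := hpl.exists_eq_forall_mem_Icc_hasDerivWithinAt₀
  have hxc : ContinuousOn x (Icc 0 T) := fun s hs => (hx s hs).continuousWithinAt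
  have hsol : ∀ s ∈ Icc 0 T, ‖x s - y s‖ ≤ R → V s (y s + radial R (x s - y s)) = V s (x s) := by
    intro s _ h
    rw [radial_of_norm_le hR h, add_sub_cancel]
  have hap' : ∀ S ∈ Icc 0 T, (∀ s ∈ Icc 0 S, ‖x s - y s‖ ≤ R) →
      ∀ s ∈ Icc 0 S, ‖x s - y s‖ ≤ r := by
    intro S hS hin
    refine hap S hS x hx0 (hxc.mono (Icc_subset_Icc_right hS.2)) (fun s hs => ?_) hin
    have hsT : s ∈ Ico 0 T := ⟨hs.1, hs.2.trans_le hS.2⟩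
    have := hasDerivWithinAt_Ici_of_Icc hsT (hx s ⟨hsT.1, hsT.2.le⟩)
    rwa [hsol s ⟨hsT.1, hsT.2.le⟩ (hin s ⟨hs.1, hs.2.le⟩)] at this
  have hg : ContinuousOn (fun s => ‖x s - y s‖) (Icc 0 T) := (hxc.sub hy).norm
  have hin : ∀ s ∈ Icc 0 T, ‖x s - y s‖ ≤ R := by
    by_contra! hcon
    obtain ⟨s₁, hs₁, hlt⟩ := hcon
    have hcl : IsCompact (Icc 0 s₁ ∩ (fun s => ‖x s - y s‖) ⁻¹' Ici R) :=
      isCompact_Icc.of_isClosed_subset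
        ((hg.mono (Icc_subset_Icc_right hs₁.2)).preimage_isClosed_of_isClosed isClosed_Icc
          isClosed_Ici) inter_subset_left
    -- `S` is the first time at which the distance to `y` is at least `R`. Up to `S` the cut-off is
    -- inactive, so the a priori estimate applies and gives distance at most `r < R` at `S`, a
    -- contradiction.
    obtain ⟨S, ⟨hSs, hSR⟩, hmin⟩ := hcl.exists_isLeast ⟨s₁, ⟨hs₁.1, le_rfl⟩, hlt.le⟩
    have hST : S ∈ Icc 0 T := ⟨hSs.1, hSs.2.trans hs₁.2⟩
    have hle : ∀ s ∈ Icc 0 S, ‖x s - y s‖ ≤ R := by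
      intro s hs
      rcases hs.2.lt_or_eq with h | rfl
      · by_contra! h'
        exact absurd (hmin ⟨⟨hs.1, hs.2.trans hSs.2⟩, h'.le⟩) (not_le.2 h)
      · by_contra! h'
        -- At the endpoint itself minimality alone does not exclude a value above `R`; the
        -- intermediate value theorem would then give an earlier time with value exactly `R`.
        obtain ⟨u, hu, hu'⟩ := intermediate_value_Icc hs.1
          (hg.mono (Icc_subset_Icc_right hST.2)) (show R ∈ Icc _ _ from
            ⟨by rw [hx0]; exact h0.trans hrR.le, h'.le⟩)
        have hus : u = s := le_antisymm hu.2 (hmin ⟨⟨hu.1, hu.2.trans hSs.2⟩, hu'.ge⟩)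
        rw [hus] at hu'
        exact absurd hu' h'.ne'
    exact absurd (hap' S hST hle S ⟨hST.1, le_rfl⟩) (not_le.2 (hrR.trans_le hSR))
  refine ⟨x, hx0, fun s hs => ?_, hap' T ⟨hT, le_rfl⟩ hin⟩
  have := hx s hs
  rwa [hsol s hs (hin s hs)] at this

theorem hasDerivWithinAt_reverse {f : ℝ → E} {f' : E} {T s : ℝ}
    (h : HasDerivWithinAt f f' (Icc 0 T) (T - s)) :
    HasDerivWithinAt (fun r => f (T - r)) (-f') (Icc 0 T) s := by
  have h1 : HasDerivWithinAt (fun r : ℝ => T - r) (-1) (Icc 0 T) s :=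
    ((hasDerivAt_id s).const_sub T).hasDerivWithinAt
  have h2 := HasDerivWithinAt.scomp (h := fun r => T - r) (t' := Icc 0 T) s h h1
    (fun r hr => ⟨by linarith [hr.2], by linarith [hr.1]⟩)
  simpa [Function.comp_def] using h2

theorem reverse_mem_Icc {T s : ℝ} (hs : s ∈ Icc 0 T) : T - s ∈ Icc 0 T :=
  ⟨by linarith [hs.2], by linarith [hs.1]⟩

/-- A function with zero terminal value whose derivative it dominates vanishes. -/
theorem eq_zero_of_terminal {f f' : ℝ → E} {T C : ℝ}
    (hf : ∀ t ∈ Icc 0 T, HasDerivWithinAt f (f' t) (Icc 0 T) t) (h0 : f T = 0)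
    (hC : ∀ t ∈ Icc 0 T, ‖f' t‖ ≤ C * ‖f t‖) : ∀ t ∈ Icc 0 T, f t = 0 := by
  intro t ht
  have hrev : ∀ s ∈ Icc 0 T, HasDerivWithinAt (fun r => f (T - r)) (-f' (T - s)) (Icc 0 T) s :=
    fun s hs => hasDerivWithinAt_reverse (hf _ (reverse_mem_Icc hs))
  have := eq_zero_of_abs_deriv_le_mul_abs_self_of_eq_zero_right (K := C)
    (f := fun r => f (T - r)) (f' := fun s => -f' (T - s))
    (fun s hs => (hrev s hs).continuousWithinAt)
    (fun s hs => hasDerivWithinAt_Ici_of_Icc hs (hrev s ⟨hs.1, hs.2.le⟩)) (by simpa using h0)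
    (fun s hs => by simpa using hC _ (reverse_mem_Icc ⟨hs.1, hs.2.le⟩)) (T - t)
    (reverse_mem_Icc ht)
  simpa using this

/-- Two solutions lie in a common ball, where the field is Lipschitz, so their difference is
dominated by itself. -/
theorem eqOn_of_terminal {V : ℝ → E → E} {T : ℝ} (hV : UnifLip (Icc 0 T) V) {x y : ℝ → E}
    (hx : ∀ t ∈ Icc 0 T, HasDerivWithinAt x (V t (x t)) (Icc 0 T) t)
    (hy : ∀ t ∈ Icc 0 T, HasDerivWithinAt y (V t (y t)) (Icc 0 T) t) (h : x T = y T) :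
    EqOn x y (Icc 0 T) := by
  obtain ⟨X, hX⟩ := isCompact_Icc.exists_bound_of_continuousOn
    (fun t ht => (hx t ht).continuousWithinAt : ContinuousOn x (Icc 0 T))
  obtain ⟨Y, hY⟩ := isCompact_Icc.exists_bound_of_continuousOn
    (fun t ht => (hy t ht).continuousWithinAt : ContinuousOn y (Icc 0 T))
  obtain ⟨L, hL⟩ := hV.lip (max X Y)
  intro t ht
  refine sub_eq_zero.1 (eq_zero_of_terminal (f := fun t => x t - y t) (C := L)
    (fun t ht => (hx t ht).sub (hy t ht)) (by simp [h]) (fun t ht => ?_) t ht)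
  exact hL t ht _ _ ((hX t ht).trans (le_max_left _ _)) ((hY t ht).trans (le_max_right _ _))

end Existence

end CheapControl

namespace CheapControl

/-! ### Fast and slow differential inequalities. -/

section Estimates

open Real

/-- The barrier solves `ε B' = M e^{-βs/ε} B`: it grows just enough to compensate the missing
damping in the layer, by a total factor of at most `e^{M/β}` whatever `ε` is (for `s ≥ 0`, `M ≥ 0`,
`β > 0`, `ε > 0`). -/
theorem hasDerivAt_fast_barrier (A M β ε s : ℝ) (hβ : β ≠ 0) :
    HasDerivAt (fun s => A * exp (M / β * (1 - exp (-(β * s / ε)))))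
      (A * exp (M / β * (1 - exp (-(β * s / ε)))) * (ε⁻¹ * (M * exp (-(β * s / ε))))) s := by
  have h1 : HasDerivAt (fun s : ℝ => -(β * s / ε)) (-(β / ε)) s := by
    have := (((hasDerivAt_id s).const_mul β).div_const ε).fun_neg
    simpa using this
  have h2 := (((h1.exp.const_sub 1).const_mul (M / β)).exp).const_mul A
  exact h2.congr_deriv (by field_simp)

/-- Where `z` touches a barrier of initial height `G / β` with `G > F`, one has `β z ≥ G > F ≥ -f`.
Hence `-(d z + f) < M e^{-βs/ε} z`, which is `ε` times the slope of the barrier, and `z` cannot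
cross. -/
theorem fast_scalar_upper_bound {β M ε S F : ℝ} (hβ : 0 < β) (hM : 0 ≤ M) (hε : 0 < ε)
    (hF : 0 ≤ F) {z d f : ℝ → ℝ} (hz : ContinuousOn z (Icc 0 S)) (h0 : z 0 = 0)
    (hz' : ∀ s ∈ Ico 0 S, HasDerivWithinAt z (-(ε⁻¹ * (d s * z s + f s))) (Ici s) s)
    (hd : ∀ s ∈ Ico 0 S, β - M * exp (-(β * s / ε)) ≤ d s) (hf : ∀ s ∈ Ico 0 S, |f s| ≤ F) :
    ∀ s ∈ Icc 0 S, z s ≤ F * (exp (M / β) / β) := by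
  intro s hs
  -- The comparison needs a strict inequality of slopes and a positive barrier, also when `F = 0`;
  -- the bound for `F` is recovered at the end by letting `G` decrease to `F`.
  have key : ∀ G, F < G → z s ≤ G * (exp (M / β) / β) := by
    intro G hG
    have hG₀ : 0 < G := hF.trans_lt hG
    have hB := fun s => hasDerivAt_fast_barrier (G / β) M β ε s hβ.ne'
    have hle := image_le_of_deriv_right_lt_deriv_boundary' hz hz'
      (B := fun s => G / β * exp (M / β * (1 - exp (-(β * s / ε))))) (by rw [h0]; positivity)
      (fun s _ => (hB s).continuousAt.continuousWithinAt) (fun s _ => (hB s).hasDerivWithinAt)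
      (fun s hs hzs => by
        have hpos : 0 < z s := by rw [hzs]; positivity
        have hzG : G ≤ β * z s := by
          rw [hzs, ← mul_assoc, mul_div_cancel₀ _ hβ.ne']
          refine le_mul_of_one_le_right hG₀.le (one_le_exp ?_)
          refine mul_nonneg (by positivity) (sub_nonneg.2 (exp_le_one_iff.2 ?_))
          have := hs.1
          exact neg_nonpos.2 (by positivity)
        rw [← hzs]
        have h1 := mul_le_mul_of_nonneg_right (hd s hs) hpos.le
        have h2 := (abs_le.1 (hf s hs)).1
        have h3 : -(d s * z s + f s) < z s * (M * exp (-(β * s / ε))) := by linarith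
        calc -(ε⁻¹ * (d s * z s + f s)) = ε⁻¹ * -(d s * z s + f s) := by ring
          _ < ε⁻¹ * (z s * (M * exp (-(β * s / ε)))) :=
              mul_lt_mul_of_pos_left h3 (inv_pos.2 hε)
          _ = _ := by ring) hs
    refine hle.trans ?_
    rw [div_mul_eq_mul_div, mul_div_assoc]
    gcongr
    have := exp_pos (-(β * s / ε))
    exact mul_le_of_le_one_right (by positivity) (by linarith)
  refine le_of_forall_gt_imp_ge_of_dense fun c hc => ?_
  have hpos : 0 < exp (M / β) / β := by positivity
  have := key (c / (exp (M / β) / β)) ((lt_div_iff₀ hpos).2 hc)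
  rwa [div_mul_cancel₀ _ hpos.ne'] at this

/-- A scalar fast equation `ε z' = -(d z + f)` whose damping `d` is bounded from below by a positive
constant away from an initial layer. -/
theorem fast_scalar_bound {β M ε S F : ℝ} (hβ : 0 < β) (hM : 0 ≤ M) (hε : 0 < ε)
    (hF : 0 ≤ F) {z d f : ℝ → ℝ} (hz : ContinuousOn z (Icc 0 S)) (h0 : z 0 = 0)
    (hz' : ∀ s ∈ Ico 0 S, HasDerivWithinAt z (-(ε⁻¹ * (d s * z s + f s))) (Ici s) s)
    (hd : ∀ s ∈ Ico 0 S, β - M * exp (-(β * s / ε)) ≤ d s) (hf : ∀ s ∈ Ico 0 S, |f s| ≤ F) :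
    ∀ s ∈ Icc 0 S, |z s| ≤ F * (exp (M / β) / β) := by
  intro s hs
  refine abs_le'.2 ⟨fast_scalar_upper_bound hβ hM hε hF hz h0 hz' hd hf s hs, ?_⟩
  refine fast_scalar_upper_bound (z := fun s => -z s) (f := fun s => -f s) hβ hM hε hF hz.neg
    (by simp [h0]) (fun s hs => ?_) hd (by simpa using hf) s hs
  exact (hz' s hs).fun_neg.congr_deriv (by ring)

/-- When the linear part acts entry by entry, as multiplication by diagonal matrices does, the
scalar estimate applies to each entry with its own damping. -/
theorem fast_matrix_bound {a b : ℕ} {β M ε S F : ℝ} (hβ : 0 < β) (hM : 0 ≤ M) (hε : 0 < ε)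
    (hF : 0 ≤ F) {z z' f : ℝ → Matrix (Fin a) (Fin b) ℝ} {d : ℝ → Fin a → Fin b → ℝ}
    (hz : ContinuousOn z (Icc 0 S)) (h0 : z 0 = 0)
    (hz' : ∀ s ∈ Ico 0 S, HasDerivWithinAt z (z' s) (Ici s) s)
    (hzd : ∀ s ∈ Ico 0 S, ∀ i j, z' s i j = -(ε⁻¹ * (d s i j * z s i j + f s i j)))
    (hd : ∀ s ∈ Ico 0 S, ∀ i j, β - M * exp (-(β * s / ε)) ≤ d s i j)
    (hf : ∀ s ∈ Ico 0 S, ‖f s‖ ≤ F) :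
    ∀ s ∈ Icc 0 S, ‖z s‖ ≤ a * b * (exp (M / β) / β) * F := by
  intro s hs
  rw [mul_assoc, mul_comm _ F]
  refine norm_matrix_le_of_entry_le fun i j => ?_
  refine fast_scalar_bound (z := fun s => z s i j) (d := fun s => d s i j)
    (f := fun s => f s i j) hβ hM hε hF
    ((entryCLM i j).continuous.comp_continuousOn hz) (by simp [h0]) (fun s hs => ?_)
    (fun s hs => hd s hs i j) (fun s hs => (norm_entry_le _ i j).trans (hf s hs)) s hs
  rw [← hzd s hs]
  exact hasDerivWithinAt_entry (hz' s hs) i j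

/-- A Grönwall estimate in which the derivative is controlled by the past of the function and by a
forcing that is small outside an initial layer. -/
theorem slow_gronwall {Y : Type*} [NormedAddCommGroup Y] [NormedSpace ℝ Y] {C β T : ℝ}
    (hC : 0 ≤ C) (hβ : 0 < β) (hT : 0 ≤ T) : ∃ A, 0 ≤ A ∧ ∀ ε, 0 < ε → ∀ S ∈ Icc 0 T,
      ∀ x x' : ℝ → Y, ContinuousOn x (Icc 0 S) → x 0 = 0 →
      (∀ s ∈ Ico 0 S, HasDerivWithinAt x (x' s) (Ici s) s) →
      (∀ s ∈ Ico 0 S, ∀ B, 0 ≤ B → (∀ r ∈ Icc 0 s, ‖x r‖ ≤ B) →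
        ‖x' s‖ ≤ C * (ε + exp (-(β * s / ε)) + B)) →
      ∀ s ∈ Icc 0 S, ‖x s‖ ≤ A * ε := by
  -- The weight `e^{-κs}` makes the contribution of the past at most half of the weighted maximum,
  -- since `C / κ ≤ 1/2`.
  set κ := 2 * C + 1 with hκ
  have hκ₀ : 0 < κ := by positivity
  -- `D * ε` bounds the integral of `C * (ε + e^{-βs/ε})` over `[0, T]`; the layer term contributes
  -- only `ε / β`.
  set D := C * (T + 1 / β) with hD
  have hD₀ : 0 ≤ D := by positivity
  refine ⟨2 * D * exp (κ * T), by positivity, fun ε hε S hS x x' hx h0 hx' hb => ?_⟩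
  obtain ⟨s₁, hs₁, hmax⟩ := isCompact_Icc.exists_isMaxOn (nonempty_Icc.2 hS.1)
    (ContinuousOn.mul (Continuous.continuousOn (by fun_prop : Continuous fun s => exp (-(κ * s))))
      hx.norm)
  set N := exp (-(κ * s₁)) * ‖x s₁‖ with hN
  have hN₀ : 0 ≤ N := by positivity
  have hxN : ∀ s ∈ Icc 0 S, ‖x s‖ ≤ N * exp (κ * s) := by
    intro s hs
    have h1 : exp (-(κ * s)) * ‖x s‖ ≤ N := hmax hs
    calc ‖x s‖ = exp (-(κ * s)) * ‖x s‖ * exp (κ * s) := by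
          rw [mul_right_comm, ← exp_add]; simp
      _ ≤ _ := by gcongr
  have hB : ∀ s : ℝ, HasDerivAt (fun s => C * (ε * s + ε / β * (1 - exp (-(β * s / ε)))
      + N / κ * (exp (κ * s) - 1))) (C * (ε + exp (-(β * s / ε)) + N * exp (κ * s))) s := by
    intro s
    have h1 : HasDerivAt (fun s : ℝ => -(β * s / ε)) (-(β / ε)) s := by
      have := (((hasDerivAt_id s).const_mul β).div_const ε).fun_neg
      simpa using this
    have h2 : HasDerivAt (fun s : ℝ => κ * s) κ s := by
      simpa using (hasDerivAt_id s).const_mul κ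
    have h3 : HasDerivAt (fun s : ℝ => ε * s) ε s := by
      simpa using (hasDerivAt_id s).const_mul ε
    have := ((h3.add ((h1.exp.const_sub 1).const_mul (ε / β))).add
      ((h2.exp.sub_const 1).const_mul (N / κ))).const_mul C
    exact this.congr_deriv (by field_simp)
  -- The bound `N e^{κs}` is increasing in `s`, so at time `s` it bounds the whole past and may
  -- serve as `B`.
  have hle := image_norm_le_of_norm_deriv_right_le_deriv_boundary' hx hx' (by simp [h0])
    (fun s _ => (hB s).continuousAt.continuousWithinAt) (fun s _ => (hB s).hasDerivWithinAt)
    (fun s hs => hb s hs (N * exp (κ * s)) (by positivity) fun r hr =>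
      (hxN r ⟨hr.1, hr.2.trans hs.2.le⟩).trans (by have := hr.2; gcongr))
  have hbound : ∀ s ∈ Icc 0 S, ‖x s‖ ≤ D * ε + N / 2 * exp (κ * s) := by
    intro s hs
    refine (hle hs).trans ?_
    have e1 := exp_pos (-(β * s / ε))
    have e2 : C * (ε * s) ≤ C * (ε * T) := by
      have := hs.2.trans hS.2
      gcongr
    have e3 : C * (ε / β * (1 - exp (-(β * s / ε)))) ≤ C * (ε / β) := by
      refine mul_le_mul_of_nonneg_left ?_ hC
      exact mul_le_of_le_one_right (by positivity) (by linarith)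
    have e4 : C * (N / κ * (exp (κ * s) - 1)) ≤ N / 2 * exp (κ * s) := by
      have h1 : C / κ ≤ 1 / 2 := by
        rw [div_le_div_iff₀ hκ₀ two_pos]; linarith
      calc C * (N / κ * (exp (κ * s) - 1)) ≤ C * (N / κ * exp (κ * s)) := by
            gcongr; linarith
        _ = C / κ * (N * exp (κ * s)) := by ring
        _ ≤ 1 / 2 * (N * exp (κ * s)) := by gcongr
        _ = _ := by ring
    have e5 : D * ε = C * (ε * T) + C * (ε / β) := by rw [hD]; ring
    rw [e5]; linarith
  -- At the maximum point `s₁` the bound reads `N e^{κs₁} ≤ Dε + (N/2) e^{κs₁}`, and half of the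
  -- left-hand side is absorbed.
  have hNle : N ≤ 2 * D * ε := by
    have h1 := hbound s₁ hs₁
    have h2 : ‖x s₁‖ = N * exp (κ * s₁) := by
      rw [hN, mul_right_comm, ← exp_add]; simp
    rw [h2] at h1
    have h3 : N * exp (κ * s₁) ≤ 2 * D * ε := by linarith
    refine le_trans ?_ h3
    exact le_mul_of_one_le_right hN₀ (one_le_exp (mul_nonneg hκ₀.le hs₁.1))
  intro s hs
  calc ‖x s‖ ≤ N * exp (κ * s) := hxN s hs
    _ ≤ 2 * D * ε * exp (κ * T) := by
        have := hs.2.trans hS.2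
        gcongr
    _ = _ := by ring

/-- The a priori estimate for the error of the approximation: `y` collects the slow components, and
`δ₂`, `δ₄`, `δ₅` are the fast ones. -/
theorem two_scale_estimate {Y : Type*} [NormedAddCommGroup Y] [NormedSpace ℝ Y] (n m₁ m₂ : ℕ)
    {β M C T : ℝ} (hβ : 0 < β) (hM : 0 ≤ M) (hC : 0 ≤ C) (hT : 0 ≤ T) :
    ∃ η ∈ Ioc (0 : ℝ) 1, ∃ A > 0, ∀ ε, 0 < ε → ∀ S ∈ Icc 0 T,
      ∀ (y y' : ℝ → Y) (δ₂ f₂ : ℝ → Matrix (Fin n) (Fin m₁) ℝ)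
        (δ₄ f₄ : ℝ → Matrix (Fin m₁) (Fin m₁) ℝ) (δ₅ f₅ : ℝ → Matrix (Fin m₁) (Fin m₂) ℝ)
        (k : ℝ → Fin m₁ → ℝ),
      ContinuousOn y (Icc 0 S) → ContinuousOn δ₂ (Icc 0 S) → ContinuousOn δ₄ (Icc 0 S) →
      ContinuousOn δ₅ (Icc 0 S) → y 0 = 0 → δ₂ 0 = 0 → δ₄ 0 = 0 → δ₅ 0 = 0 →
      (∀ s ∈ Ico 0 S, HasDerivWithinAt y (y' s) (Ici s) s) →
      (∀ s ∈ Ico 0 S, HasDerivWithinAt δ₂ (-(ε⁻¹ • (δ₂ s * diagonal (k s) + f₂ s))) (Ici s) s) →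
      (∀ s ∈ Ico 0 S, HasDerivWithinAt δ₄
        (-(ε⁻¹ • (diagonal (k s) * δ₄ s + δ₄ s * diagonal (k s) + f₄ s))) (Ici s) s) →
      (∀ s ∈ Ico 0 S, HasDerivWithinAt δ₅ (-(ε⁻¹ • (diagonal (k s) * δ₅ s + f₅ s))) (Ici s) s) →
      (∀ s ∈ Ico 0 S, ∀ i, β - M * exp (-(β * s / ε)) ≤ k s i) →
      (∀ s ∈ Ico 0 S, ‖f₂ s‖ ≤ C * (‖y s‖ + ‖δ₄ s‖ + ε)) →
      (∀ s ∈ Ico 0 S, ‖f₄ s‖ ≤ ‖δ₄ s‖ ^ 2 + C * ε) →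
      (∀ s ∈ Ico 0 S, ‖f₅ s‖ ≤ C * (‖y s‖ + ‖δ₄ s‖ + ε)) →
      (∀ s ∈ Ico 0 S,
        ‖y' s‖ ≤ C * (ε + exp (-(β * s / ε)) + (‖y s‖ + ‖δ₂ s‖ + ‖δ₄ s‖ + ‖δ₅ s‖))) →
      (∀ s ∈ Icc 0 S, ‖δ₄ s‖ ≤ η) →
      ∀ s ∈ Icc 0 S, ‖y s‖ ≤ A * ε ∧ ‖δ₂ s‖ ≤ A * ε ∧ ‖δ₄ s‖ ≤ A * ε ∧ ‖δ₅ s‖ ≤ A * ε := by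
  -- The damping of `δ₄` is `k i + k j`, which loses `M e^{-βs/ε}` twice. Using `2 * M` for the
  -- other two blocks as well lets one constant serve all three.
  set Γ := exp (2 * M / β) / β with hΓ
  have hΓ₀ : 0 < Γ := by positivity
  set Γ₄ := m₁ * m₁ * Γ with hΓ₄
  have hΓ₄₀ : 0 ≤ Γ₄ := by positivity
  set A₄ := 2 * Γ₄ * C with hA₄
  have hA₄₀ : 0 ≤ A₄ := by positivity
  set Q := (n * m₁ * Γ + m₁ * m₂ * Γ) * C with hQ
  have hQ₀ : 0 ≤ Q := by positivity
  set C' := C * (1 + 2 * Q * (A₄ + 1) + A₄ + 2 * Q) with hC'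
  have hC'₀ : 0 ≤ C' := by positivity
  obtain ⟨A₁, hA₁, hslow⟩ := slow_gronwall (Y := Y) hC'₀ hβ hT
  -- The threshold `η` is chosen so that `Γ₄ η ≤ 1/2`, which absorbs the quadratic term of `f₄`.
  refine ⟨min 1 (1 / (2 * Γ₄ + 1)), ⟨by positivity, min_le_left _ _⟩,
    A₁ + A₄ + Q * (A₁ + A₄ + 1) + 1, by positivity, ?_⟩
  intro ε hε S hS y y' δ₂ f₂ δ₄ f₄ δ₅ f₅ k hy h2 h4 h5 y0 h20 h40 h50 hy' h2' h4' h5' hk hf2 hf4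
    hf5 hfy hη
  have hηΓ : Γ₄ * min 1 (1 / (2 * Γ₄ + 1)) ≤ 1 / 2 := by
    refine (mul_le_mul_of_nonneg_left (min_le_right _ _) hΓ₄₀).trans ?_
    rw [mul_one_div, div_le_div_iff₀ (by positivity) two_pos]; linarith
  set η := min 1 (1 / (2 * Γ₄ + 1)) with hηd
  have hM2 : (0 : ℝ) ≤ 2 * M := by positivity
  have hd4 : ∀ s ∈ Ico 0 S, ∀ i j, β - 2 * M * exp (-(β * s / ε)) ≤ k s i + k s j := by
    intro s hs i j
    have := hk s hs i
    have := hk s hs j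
    linarith
  have hd1 : ∀ s ∈ Ico 0 S, ∀ i, β - 2 * M * exp (-(β * s / ε)) ≤ k s i := by
    intro s hs i
    have := hk s hs i
    have : 0 ≤ M * exp (-(β * s / ε)) := by positivity
    linarith
  -- With `‖δ₄‖ ≤ η`, the quadratic term is at most `η` times the maximum of `‖δ₄‖`. The fast bound
  -- at the maximum point then closes the estimate of `δ₄` without the other blocks.
  obtain ⟨s₁, hs₁, hmax⟩ := isCompact_Icc.exists_isMaxOn (nonempty_Icc.2 hS.1) h4.norm
  have hmax' : ∀ s ∈ Icc 0 S, ‖δ₄ s‖ ≤ ‖δ₄ s₁‖ := fun s hs => hmax hs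
  have hb4 : ∀ s ∈ Icc 0 S, ‖δ₄ s‖ ≤ A₄ * ε := by
    have h := fast_matrix_bound (d := fun s i j => k s i + k s j) (f := f₄)
      (F := η * ‖δ₄ s₁‖ + C * ε) hβ hM2 hε (by positivity) h4 h40 h4'
      (fun s _ i j => by
        simp only [Matrix.neg_apply, Matrix.smul_apply, Matrix.add_apply, diagonal_mul,
          mul_diagonal, smul_eq_mul]; ring) hd4
      (fun s hs => (hf4 s hs).trans (by
        have e1 := hη s ⟨hs.1, hs.2.le⟩
        have e2 := hmax' s ⟨hs.1, hs.2.le⟩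
        rw [pow_two]; gcongr)) s₁ hs₁
    rw [← hΓ, ← hΓ₄] at h
    have h' : Γ₄ * η * ‖δ₄ s₁‖ ≤ 1 / 2 * ‖δ₄ s₁‖ := by gcongr
    intro s hs
    refine (hmax' s hs).trans ?_
    have : Γ₄ * (η * ‖δ₄ s₁‖ + C * ε) = Γ₄ * η * ‖δ₄ s₁‖ + Γ₄ * C * ε := by ring
    rw [hA₄]; linarith
  -- A fast component at time `s` depends on the slow error over all of `[0, s]`, so the bound is in
  -- terms of a bound `B` on that past, not of the value at `s`.
  have hfast : ∀ s ∈ Icc 0 S, ∀ B, 0 ≤ B → (∀ r ∈ Icc 0 s, ‖y r‖ ≤ B) →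
      ‖δ₂ s‖ ≤ Q * (B + (A₄ + 1) * ε) ∧ ‖δ₅ s‖ ≤ Q * (B + (A₄ + 1) * ε) := by
    intro s hs B hB hyB
    have hsub : Icc 0 s ⊆ Icc 0 S := Icc_subset_Icc_right hs.2
    have hsub' : Ico 0 s ⊆ Ico 0 S := Ico_subset_Ico_right hs.2
    have hF : ∀ r ∈ Ico 0 s, C * (‖y r‖ + ‖δ₄ r‖ + ε) ≤ C * (B + (A₄ + 1) * ε) := by
      intro r hr
      have e1 := hyB r ⟨hr.1, hr.2.le⟩
      have e2 := hb4 r (hsub ⟨hr.1, hr.2.le⟩)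
      refine mul_le_mul_of_nonneg_left ?_ hC
      linarith
    have hF₀ : 0 ≤ C * (B + (A₄ + 1) * ε) := by positivity
    have g2 := fast_matrix_bound (d := fun s _ j => k s j) (f := f₂) hβ hM2 hε hF₀ (h2.mono hsub)
      h20 (fun r hr => h2' r (hsub' hr))
      (fun s _ i j => by
        simp only [Matrix.neg_apply, Matrix.smul_apply, Matrix.add_apply,
          mul_diagonal, smul_eq_mul]; ring)
      (fun r hr _ j => hd1 r (hsub' hr) j)
      (fun r hr => (hf2 r (hsub' hr)).trans (hF r hr)) s ⟨hs.1, le_rfl⟩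
    have g5 := fast_matrix_bound (d := fun s i _ => k s i) (f := f₅) hβ hM2 hε hF₀ (h5.mono hsub)
      h50 (fun r hr => h5' r (hsub' hr))
      (fun s _ i j => by
        simp only [Matrix.neg_apply, Matrix.smul_apply, Matrix.add_apply,
          diagonal_mul, smul_eq_mul])
      (fun r hr i _ => hd1 r (hsub' hr) i)
      (fun r hr => (hf5 r (hsub' hr)).trans (hF r hr)) s ⟨hs.1, le_rfl⟩
    rw [← hΓ] at g2 g5
    constructor
    · refine g2.trans ?_
      rw [hQ, mul_assoc (_ + _) C]
      refine mul_le_mul_of_nonneg_right (le_add_of_nonneg_right (by positivity)) hF₀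
    · refine g5.trans ?_
      rw [hQ, mul_assoc (_ + _) C]
      refine mul_le_mul_of_nonneg_right (le_add_of_nonneg_left (by positivity)) hF₀
  -- Substituting the bounds of the fast blocks leaves an inequality for the slow error alone, in
  -- the history form that `slow_gronwall` accepts.
  have hbY := hslow ε hε S hS y y' hy y0 hy' (fun s hs B hB hyB => by
    have hsI : s ∈ Icc 0 S := ⟨hs.1, hs.2.le⟩
    obtain ⟨g2, g5⟩ := hfast s hsI B hB hyB
    have g1 := hyB s ⟨hs.1, le_rfl⟩
    have g4 := hb4 s hsI
    refine (hfy s hs).trans ?_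
    rw [hC', mul_assoc]
    refine mul_le_mul_of_nonneg_left ?_ hC
    set e := exp (-(β * s / ε))
    have he : 0 < e := exp_pos _
    have p1 : 0 ≤ (2 * Q * (A₄ + 1) + A₄ + 2 * Q) * e := by positivity
    have p2 : 0 ≤ (2 * Q * (A₄ + 1) + A₄) * B := by positivity
    have p3 : 0 ≤ 2 * Q * ε := by positivity
    linarith)
  intro s hs
  obtain ⟨g2, g5⟩ := hfast s hs (A₁ * ε) (by positivity) fun r hr =>
    hbY r ⟨hr.1, hr.2.trans hs.2⟩
  have g1 := hbY s hs
  have g4 := hb4 s hs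
  have p1 : 0 ≤ A₁ * ε := by positivity
  have p2 : 0 ≤ A₄ * ε := by positivity
  have p3 : 0 ≤ Q * (A₁ + A₄ + 1) * ε := by positivity
  have e : Q * (A₁ * ε + (A₄ + 1) * ε) = Q * (A₁ + A₄ + 1) * ε := by ring
  rw [e] at g2 g5
  refine ⟨?_, ?_, ?_, ?_⟩ <;> linarith

end Estimates

end CheapControl

namespace CheapControl

/-! ### Global solvability of the control-theoretic Riccati equation. -/

section Riccati

section

attribute [local instance] Matrix.frobeniusNormedRing Matrix.frobeniusNormedAlgebra

theorem hasDerivWithinAt_matrix_inv {m : ℕ} {X : ℝ → Matrix (Fin m) (Fin m) ℝ}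
    {X' : Matrix (Fin m) (Fin m) ℝ} {s : Set ℝ} {t : ℝ} (hX : HasDerivWithinAt X X' s t)
    (h : IsUnit (X t)) :
    HasDerivWithinAt (fun t => (X t)⁻¹) (-((X t)⁻¹ * X' * (X t)⁻¹)) s t := by
  obtain ⟨u, hu⟩ := h
  have h1 := hasFDerivAt_ringInverse (𝕜 := ℝ) u
  rw [hu] at h1
  have h2 := h1.comp_hasDerivWithinAt t hX
  have h3 : ((u⁻¹ : (Matrix (Fin m) (Fin m) ℝ)ˣ) : Matrix (Fin m) (Fin m) ℝ) = (X t)⁻¹ := by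
    rw [← hu, coe_units_inv]
  simp only [Function.comp_def, ← nonsing_inv_eq_ringInverse] at h2
  refine h2.congr_deriv ?_
  simp [h3]

end

variable {m k : ℕ} {T : ℝ}

/-- The Hamiltonian system of a Riccati equation, in reversed time. -/
theorem exists_hamiltonian (hT : 0 ≤ T) {A : ℝ → Matrix (Fin m) (Fin m) ℝ}
    {B : ℝ → Matrix (Fin k) (Fin m) ℝ} (hA : ContinuousOn A (Icc 0 T))
    (hB : ContinuousOn B (Icc 0 T)) :
    ∃ X Y : ℝ → Matrix (Fin m) (Fin m) ℝ, X 0 = 1 ∧ Y 0 = 0 ∧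
      (∀ s ∈ Icc 0 T, HasDerivWithinAt X (Y s - A s * X s) (Icc 0 T) s) ∧
      ∀ s ∈ Icc 0 T, HasDerivWithinAt Y ((A s)ᵀ * Y s + (B s)ᵀ * B s * X s) (Icc 0 T) s := by
  set V : ℝ → Matrix (Fin m) (Fin m) ℝ × Matrix (Fin m) (Fin m) ℝ →
      Matrix (Fin m) (Fin m) ℝ × Matrix (Fin m) (Fin m) ℝ :=
    fun s x => (x.2 - A s * x.1, (A s)ᵀ * x.2 + (B s)ᵀ * B s * x.1) with hVdef
  have hQ := continuousOn_matrix_mul (continuousOn_matrix_transpose hB) hB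
  have hV : UnifLip (Icc 0 T) V :=
    (UnifLip.id.snd.sub ((UnifLip.coeff isCompact_Icc hA).matrix_mul UnifLip.id.fst)).prodMk
      (((UnifLip.coeff isCompact_Icc hA).matrix_transpose.matrix_mul UnifLip.id.snd).add
        ((UnifLip.coeff isCompact_Icc hQ).matrix_mul UnifLip.id.fst))
  obtain ⟨a, ha⟩ := isCompact_Icc.exists_bound_of_continuousOn hA
  obtain ⟨q, hq⟩ := isCompact_Icc.exists_bound_of_continuousOn hQ
  have h0T : (0 : ℝ) ∈ Icc 0 T := ⟨le_rfl, hT⟩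
  have ha₀ : 0 ≤ a := (norm_nonneg _).trans (ha 0 h0T)
  have hq₀ : 0 ≤ q := (norm_nonneg _).trans (hq 0 h0T)
  have hlin : ∀ s ∈ Icc 0 T, ∀ x, ‖V s x‖ ≤ (1 + a + q) * ‖x‖ := by
    intro s hs x
    have e1 := norm_fst_le x
    have e2 := norm_snd_le x
    have hx := norm_nonneg x
    refine norm_prod_le_iff.2 ⟨?_, ?_⟩
    · calc ‖x.2 - A s * x.1‖ ≤ ‖x.2‖ + ‖A s‖ * ‖x.1‖ :=
            (norm_sub_le _ _).trans (add_le_add le_rfl (frobenius_norm_mul _ _))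
        _ ≤ ‖x‖ + a * ‖x‖ := by
            have := ha s hs
            gcongr
        _ ≤ _ := by have := mul_nonneg hq₀ hx; linarith
    · calc ‖(A s)ᵀ * x.2 + (B s)ᵀ * B s * x.1‖ ≤ ‖(A s)ᵀ‖ * ‖x.2‖ + ‖(B s)ᵀ * B s‖ * ‖x.1‖ :=
            (norm_add_le _ _).trans (add_le_add (frobenius_norm_mul _ _) (frobenius_norm_mul _ _))
        _ ≤ a * ‖x‖ + q * ‖x‖ := by
            have := ha s hs
            have := hq s hs
            rw [frobenius_norm_transpose]
            gcongr
        _ ≤ _ := by linarith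
  set x₀ : Matrix (Fin m) (Fin m) ℝ × Matrix (Fin m) (Fin m) ℝ := (1, 0) with hx₀
  set L := 1 + a + q
  have hL : 0 ≤ L := by positivity
  have hE : ∀ s ≤ T, ‖x₀‖ * Real.exp (L * s) ≤ ‖x₀‖ * Real.exp (L * T) := fun s hs => by gcongr
  -- The system is linear, so Grönwall bounds every solution by `‖x₀‖ e^{LT}`; this is the a priori
  -- bound around the zero reference curve, and any larger `R` will do.
  obtain ⟨x, hx0, hx, -⟩ := exists_solution_of_apriori hT (r := ‖x₀‖ * Real.exp (L * T))
    (R := ‖x₀‖ * Real.exp (L * T) + 1) (by positivity) (lt_add_one _) hV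
    (y := fun _ => 0) continuousOn_const x₀ (fun S hS x hx0 hxc hx _ s hs => by
      have := norm_le_gronwallBound_of_norm_deriv_right_le (δ := ‖x₀‖) (K := L) (ε := 0) hxc hx
        (by rw [hx0]) (fun r hr => by
          simpa using hlin r ⟨hr.1, hr.2.le.trans hS.2⟩ (x r)) s hs
      rw [gronwallBound_ε0, sub_zero] at this
      rw [sub_zero]
      exact this.trans (hE s (hs.2.trans hS.2)))
    (by simpa using hE 0 hT)
  refine ⟨fun s => (x s).1, fun s => (x s).2, by simp [hx0, hx₀], by simp [hx0, hx₀],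
    fun s hs => ?_, fun s hs => ?_⟩
  · exact (hasFDerivAt_fst (𝕜 := ℝ) (p := x s)).comp_hasDerivWithinAt s (hx s hs)
  · exact (hasFDerivAt_snd (𝕜 := ℝ) (p := x s)).comp_hasDerivWithinAt s (hx s hs)

theorem transpose_mul_self_apply_eq (w : Matrix (Fin m) (Fin 1) ℝ) :
    (wᵀ * w) 0 0 = ∑ i, w i 0 ^ 2 := by
  simp [Matrix.mul_apply, pow_two]

/-- Suppose `X(S) v = 0`, and put `u = X v`, `w = Y v`. Then `(uᵀ w)' = |w|² + |B u|² ≥ 0`, while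
`uᵀ w` vanishes at `0` and at `S`. Hence it is constant and `w = 0`, so `u' = -A u` with `u(S) = 0`;
therefore `u` vanishes identically, and `v = u(0) = 0`. -/
theorem isUnit_hamiltonian {A : ℝ → Matrix (Fin m) (Fin m) ℝ}
    {B : ℝ → Matrix (Fin k) (Fin m) ℝ} (hA : ContinuousOn A (Icc 0 T))
    {X Y : ℝ → Matrix (Fin m) (Fin m) ℝ} (hX0 : X 0 = 1) (hY0 : Y 0 = 0)
    (hX : ∀ s ∈ Icc 0 T, HasDerivWithinAt X (Y s - A s * X s) (Icc 0 T) s)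
    (hY : ∀ s ∈ Icc 0 T, HasDerivWithinAt Y ((A s)ᵀ * Y s + (B s)ᵀ * B s * X s) (Icc 0 T) s)
    {S : ℝ} (hS : S ∈ Icc 0 T) : IsUnit (X S) := by
  by_contra hcon
  rw [isUnit_iff_isUnit_det, isUnit_iff_ne_zero, not_not, ← exists_mulVec_eq_zero_iff] at hcon
  obtain ⟨v, hv0, hv⟩ := hcon
  -- The kernel vector is written as a one-column matrix, so that the matrix product rule applies.
  set W : Matrix (Fin m) (Fin 1) ℝ := replicateCol (Fin 1) v with hW
  have hXW : X S * W = 0 := by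
    rw [hW, ← replicateCol_mulVec, hv]; rfl
  refine hv0 ?_
  suffices hW0 : W = 0 by
    ext i
    exact congrFun (congrFun hW0 i) 0
  -- On the degenerate interval derivatives within it are not unique, so `S = 0` is settled by `X 0
  -- = 1`.
  rcases hS.1.eq_or_lt with rfl | hSpos
  · simpa [hX0] using hXW
  have hsub : Icc 0 S ⊆ Icc 0 T := Icc_subset_Icc_right hS.2
  set u := fun s => X s * W with hu
  set w := fun s => Y s * W with hw
  have hu' : ∀ s ∈ Icc 0 S, HasDerivWithinAt u (w s - A s * u s) (Icc 0 S) s := by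
    intro s hs
    have := hasDerivWithinAt_matrix_mul ((hX s (hsub hs)).mono hsub)
      (hasDerivWithinAt_const s (Icc 0 S) W)
    refine this.congr_deriv ?_
    simp only [hu, hw, Matrix.mul_zero, zero_add, Matrix.sub_mul, Matrix.mul_assoc]
  have hw' : ∀ s ∈ Icc 0 S,
      HasDerivWithinAt w ((A s)ᵀ * w s + (B s)ᵀ * (B s * u s)) (Icc 0 S) s := by
    intro s hs
    have := hasDerivWithinAt_matrix_mul ((hY s (hsub hs)).mono hsub)
      (hasDerivWithinAt_const s (Icc 0 S) W)
    refine this.congr_deriv ?_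
    simp only [hu, hw, Matrix.mul_zero, zero_add, Matrix.add_mul, Matrix.mul_assoc]
  set h := fun s => ((u s)ᵀ * w s) 0 0 with hh
  have hh' : ∀ s ∈ Icc 0 S, HasDerivWithinAt h
      (∑ i, w s i 0 ^ 2 + ∑ i, (B s * u s) i 0 ^ 2) (Icc 0 S) s := by
    intro s hs
    have h1 := hasDerivWithinAt_matrix_mul (hasDerivWithinAt_matrix_transpose (hu' s hs))
      (hw' s hs)
    refine (hasDerivWithinAt_entry h1 0 0).congr_deriv ?_
    rw [← transpose_mul_self_apply_eq, ← transpose_mul_self_apply_eq,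
      ← Matrix.add_apply]
    refine congrFun (congrFun (?_ : (_ : Matrix (Fin 1) (Fin 1) ℝ) = _) 0) 0
    simp only [transpose_sub, transpose_mul, Matrix.mul_add, Matrix.sub_mul, Matrix.mul_assoc]
    abel
  have hmono : MonotoneOn h (Icc 0 S) := by
    refine monotoneOn_of_deriv_nonneg (convex_Icc 0 S)
      (fun s hs => (hh' s hs).continuousWithinAt)
      (fun s hs => ((hh' s (interior_subset hs)).differentiableWithinAt).mono interior_subset)
      fun s hs => ?_
    rw [((hh' s (interior_subset hs)).hasDerivAt (mem_interior_iff_mem_nhds.1 hs)).deriv]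
    positivity
  have hhS : h S = 0 := by
    change ((X S * W)ᵀ * w S) 0 0 = 0
    simp [hXW]
  have hh0 : h 0 = 0 := by simp [hh, hw, hY0]
  have hzero : ∀ s ∈ Icc 0 S, h s = 0 := fun s hs => le_antisymm
    ((hmono hs ⟨hSpos.le, le_rfl⟩ hs.2).trans_eq hhS)
    (hh0.symm.trans_le (hmono ⟨le_rfl, hSpos.le⟩ hs hs.1))
  have hwz : ∀ s ∈ Icc 0 S, w s = 0 := by
    intro s hs
    have h1 : HasDerivWithinAt h 0 (Icc 0 S) s :=
      (hasDerivWithinAt_const s (Icc 0 S) (0 : ℝ)).congr hzero (hzero s hs)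
    have h2 := (uniqueDiffOn_Icc hSpos s hs).eq_deriv _ (hh' s hs) h1
    have h3 : 0 ≤ ∑ i, (B s * u s) i 0 ^ 2 := by positivity
    have h4 : 0 ≤ ∑ i, w s i 0 ^ 2 := by positivity
    have h5 : ∑ i, w s i 0 ^ 2 = 0 := by linarith
    rw [Finset.sum_eq_zero_iff_of_nonneg (fun _ _ => by positivity)] at h5
    ext i j
    rw [Subsingleton.elim j 0]
    exact pow_eq_zero_iff two_ne_zero |>.1 (h5 i (Finset.mem_univ i))
  obtain ⟨a, ha⟩ := isCompact_Icc.exists_bound_of_continuousOn hA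
  have := eq_zero_of_terminal (f := u) (C := a) hu' hXW (fun s hs => by
    rw [hwz s hs, zero_sub, norm_neg]
    exact (frobenius_norm_mul _ _).trans
      (mul_le_mul_of_nonneg_right (ha s (hsub hs)) (norm_nonneg _))) 0 ⟨le_rfl, hSpos.le⟩
  simpa [hu, hX0] using this

/-- The control-theoretic Riccati equation with zero terminal value is solvable on every compact
interval. -/
theorem exists_riccati (hT : 0 ≤ T) {A : ℝ → Matrix (Fin m) (Fin m) ℝ}
    {B : ℝ → Matrix (Fin k) (Fin m) ℝ} (hA : ContinuousOn A (Icc 0 T))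
    (hB : ContinuousOn B (Icc 0 T)) :
    ∃ K : ℝ → Matrix (Fin m) (Fin m) ℝ,
      (∀ t ∈ Icc 0 T, HasDerivWithinAt K
        (-(K t * A t) - (A t)ᵀ * K t + K t ^ 2 - (B t)ᵀ * B t) (Icc 0 T) t) ∧ K T = 0 := by
  have hrev : ContinuousOn (fun s : ℝ => T - s) (Icc 0 T) := by fun_prop
  have hmaps : MapsTo (fun s : ℝ => T - s) (Icc 0 T) (Icc 0 T) := fun s hs => reverse_mem_Icc hs
  have hA' := hA.comp hrev hmaps
  obtain ⟨X, Y, hX0, hY0, hX, hY⟩ := exists_hamiltonian hT hA' (hB.comp hrev hmaps)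
  -- In reversed time `(Y X⁻¹)' = Y' X⁻¹ - Y X⁻¹ X' X⁻¹`; inserting the Hamiltonian system makes
  -- this the negative of the Riccati right-hand side.
  refine ⟨fun t => Y (T - t) * (X (T - t))⁻¹, fun t ht => ?_, by simp [hY0]⟩
  have ht' := reverse_mem_Icc ht
  have hunit := isUnit_hamiltonian hA' hX0 hY0 hX hY ht'
  have hdet : IsUnit (X (T - t)).det := (isUnit_iff_isUnit_det _).1 hunit
  have h1 := hasDerivWithinAt_reverse (hasDerivWithinAt_matrix_mul (hY _ ht')
    (hasDerivWithinAt_matrix_inv (hX _ ht') hunit))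
  refine h1.congr_deriv ?_
  simp only [Function.comp_apply, sub_sub_cancel]
  have e : X (T - t) * (X (T - t))⁻¹ = 1 := mul_nonsing_inv _ hdet
  simp only [pow_two, Matrix.sub_mul, Matrix.add_mul, Matrix.mul_sub, Matrix.mul_neg,
    Matrix.mul_assoc, e, Matrix.mul_one]
  abel

end Riccati

end CheapControl

namespace CheapControl

/-! ### The transformed system as an ODE: Lipschitz bounds, uniqueness, symmetry. -/

section System

/-- The normed space of the unknowns of the transformed system. -/
abbrev State (n m₁ m₂ : ℕ) : Type :=
  Matrix (Fin n) (Fin n) ℝ × Matrix (Fin n) (Fin m₁) ℝ × Matrix (Fin n) (Fin m₂) ℝ ×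
    Matrix (Fin m₁) (Fin m₁) ℝ × Matrix (Fin m₁) (Fin m₂) ℝ × Matrix (Fin m₂) (Fin m₂) ℝ

variable {n m₁ m₂ l : ℕ}

/-- The six-tuple of blocks with the given components. -/
def blocksOf (x : State n m₁ m₂) : Blocks n m₁ m₂ :=
  ⟨x.1, x.2.1, x.2.2.1, x.2.2.2.1, x.2.2.2.2.1, x.2.2.2.2.2⟩

/-- The components of a six-tuple of blocks. -/
def stateOf (k : Blocks n m₁ m₂) : State n m₁ m₂ := (k.K1, k.K2, k.K3, k.K4, k.K5, k.K6)

namespace GameData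

variable {g : GameData n m₁ m₂ l}

/-- The coefficients of the transformed system are continuous on `[0, t_f]`. -/
structure ContData (g : GameData n m₁ m₂ l) : Prop where
  a1 : ContinuousOn g.Abar1 (Icc 0 g.tf)
  a2 : ContinuousOn g.Abar2 (Icc 0 g.tf)
  a4 : ContinuousOn g.Abar4 (Icc 0 g.tf)
  a5 : ContinuousOn g.Abar5 (Icc 0 g.tf)
  a6 : ContinuousOn g.Abar6 (Icc 0 g.tf)
  a7 : ContinuousOn g.Abar7 (Icc 0 g.tf)
  a8 : ContinuousOn g.Abar8 (Icc 0 g.tf)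
  a9 : ContinuousOn g.Abar9 (Icc 0 g.tf)
  s1 : ContinuousOn g.S1 (Icc 0 g.tf)
  s2 : ContinuousOn g.S2 (Icc 0 g.tf)
  s3 : ContinuousOn g.S3 (Icc 0 g.tf)
  s4 : ContinuousOn g.S4 (Icc 0 g.tf)
  s5 : ContinuousOn g.S5 (Icc 0 g.tf)
  s6 : ContinuousOn g.S6 (Icc 0 g.tf)
  d1 : ContinuousOn g.D1 (Icc 0 g.tf)
  lam : ContinuousOn g.Lam (Icc 0 g.tf)

theorem continuousOn_Sv (hg : g.Standing) (hs : g.SmoothData) :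
    ContinuousOn g.Sv (Icc 0 g.tf) := by
  have hC : ContinuousOn (fun t => fromRows (g.C1 t) (g.C2 t)) (Icc 0 g.tf) := by
    refine continuousOn_matrix.2 fun i j => ?_
    rcases i with i | i
    · exact continuousOn_matrix.1 hs.C1_contDiff.continuousOn i j
    · exact continuousOn_matrix.1 hs.C2_contDiff.continuousOn i j
  have hG := hs.G_contDiff.continuousOn
  have hdet : ContinuousOn (fun t => (g.G t).det) (Icc 0 g.tf) :=
    (Continuous.matrix_det continuous_id).comp_continuousOn hG
  have hadj : ContinuousOn (fun t => (g.G t).adjugate) (Icc 0 g.tf) :=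
    (Continuous.matrix_adjugate continuous_id).comp_continuousOn hG
  have hinv : ContinuousOn (fun t => (g.G t)⁻¹) (Icc 0 g.tf) := by
    simp only [inv_def, Ring.inverse_eq_inv']
    exact (hdet.inv₀ fun t ht => (hg.G_posDef t ht).det_pos.ne').smul hadj
  exact continuousOn_matrix_mul (continuousOn_matrix_mul hC hinv) (continuousOn_matrix_transpose hC)

theorem contData (hg : g.Standing) (hs : g.SmoothData) : g.ContData where
  a1 := hs.A1_contDiff.continuousOn
  a2 := continuousOn_matrix.2 fun i j =>
    continuousOn_matrix.1 hs.A2_contDiff.continuousOn i (Sum.inl j)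
  a4 := continuousOn_matrix.2 fun i j =>
    continuousOn_matrix.1 hs.A3_contDiff.continuousOn (Sum.inl i) j
  a5 := continuousOn_matrix.2 fun i j =>
    continuousOn_matrix.1 hs.A4_contDiff.continuousOn (Sum.inl i) (Sum.inl j)
  a6 := continuousOn_matrix.2 fun i j =>
    continuousOn_matrix.1 hs.A4_contDiff.continuousOn (Sum.inl i) (Sum.inr j)
  a7 := continuousOn_matrix.2 fun i j =>
    continuousOn_matrix.1 hs.A3_contDiff.continuousOn (Sum.inr i) j
  a8 := continuousOn_matrix.2 fun i j =>
    continuousOn_matrix.1 hs.A4_contDiff.continuousOn (Sum.inr i) (Sum.inl j)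
  a9 := continuousOn_matrix.2 fun i j =>
    continuousOn_matrix.1 hs.A4_contDiff.continuousOn (Sum.inr i) (Sum.inr j)
  s1 := continuousOn_matrix.2 fun i j =>
    continuousOn_matrix.1 (continuousOn_Sv hg hs) (Sum.inl i) (Sum.inl j)
  s2 := continuousOn_matrix.2 fun i j =>
    continuousOn_matrix.1 (continuousOn_Sv hg hs) (Sum.inl i) (Sum.inr (Sum.inl j))
  s3 := continuousOn_matrix.2 fun i j =>
    continuousOn_matrix.1 (continuousOn_Sv hg hs) (Sum.inl i) (Sum.inr (Sum.inr j))
  s4 := continuousOn_matrix.2 fun i j =>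
    continuousOn_matrix.1 (continuousOn_Sv hg hs) (Sum.inr (Sum.inl i)) (Sum.inr (Sum.inl j))
  s5 := continuousOn_matrix.2 fun i j =>
    continuousOn_matrix.1 (continuousOn_Sv hg hs) (Sum.inr (Sum.inl i)) (Sum.inr (Sum.inr j))
  s6 := continuousOn_matrix.2 fun i j =>
    continuousOn_matrix.1 (continuousOn_Sv hg hs) (Sum.inr (Sum.inr i)) (Sum.inr (Sum.inr j))
  d1 := hs.D1_contDiff.continuousOn
  lam := continuousOn_matrix.2 fun i j => by
    have h := continuousOn_matrix.1 hs.D2_contDiff.continuousOn (Sum.inl i) (Sum.inl j)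
    refine h.congr fun t _ => ?_
    simp [Lam, D2, diagonal_apply]

/-- The range of the parameters `(ε, t)`. -/
def paramSet (g : GameData n m₁ m₂ l) : Set (ℝ × ℝ) := Icc 0 1 ×ˢ Icc 0 g.tf

theorem isCompact_paramSet : IsCompact g.paramSet := isCompact_Icc.prod isCompact_Icc

theorem unifLip_coeff {F : Type*} [NormedAddCommGroup F] {c : ℝ → F}
    (hc : ContinuousOn c (Icc 0 g.tf)) :
    UnifLip g.paramSet fun p (_ : State n m₁ m₂) => c p.2 :=
  UnifLip.coeff isCompact_paramSet (hc.comp continuousOn_snd fun _ hp => hp.2)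

/-- This and the next lemmas specialise the closure rules to matrix-valued families with scalar
factors `ε` and `ε ^ k`, so that polynomial right-hand sides can be handled by recursion on their
terms. -/
theorem unifLip_add {a b : ℕ} {V W : ℝ × ℝ → State n m₁ m₂ → Matrix (Fin a) (Fin b) ℝ}
    (hV : UnifLip g.paramSet V) (hW : UnifLip g.paramSet W) :
    UnifLip g.paramSet fun p x => V p x + W p x := hV.add hW

theorem unifLip_sub {a b : ℕ} {V W : ℝ × ℝ → State n m₁ m₂ → Matrix (Fin a) (Fin b) ℝ}
    (hV : UnifLip g.paramSet V) (hW : UnifLip g.paramSet W) :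
    UnifLip g.paramSet fun p x => V p x - W p x := hV.sub hW

theorem unifLip_neg {a b : ℕ} {V : ℝ × ℝ → State n m₁ m₂ → Matrix (Fin a) (Fin b) ℝ}
    (hV : UnifLip g.paramSet V) : UnifLip g.paramSet fun p x => -V p x := hV.neg

theorem unifLip_smul {a b : ℕ} {V : ℝ × ℝ → State n m₁ m₂ → Matrix (Fin a) (Fin b) ℝ}
    (hV : UnifLip g.paramSet V) : UnifLip g.paramSet fun p x => p.1 • V p x :=
  UnifLip.smul isCompact_paramSet continuous_fst.continuousOn hV

theorem unifLip_smul_pow {a b : ℕ} {V : ℝ × ℝ → State n m₁ m₂ → Matrix (Fin a) (Fin b) ℝ} (k : ℕ)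
    (hV : UnifLip g.paramSet V) : UnifLip g.paramSet fun p x => p.1 ^ k • V p x :=
  UnifLip.smul isCompact_paramSet (continuous_fst.pow k).continuousOn hV

-- The remainders are polynomials in the state with coefficients continuous in `(ε, t)`. Treating
-- `ε` as a parameter in the compact interval `[0, 1]` makes their bounds uniform in `ε`.
set_option maxHeartbeats 1000000 in
theorem unifLip_remainders (hc : g.ContData) :
    UnifLip g.paramSet (fun p x => g.R1 p.1 p.2 (blocksOf x)) ∧
    UnifLip g.paramSet (fun p x => g.R2 p.1 p.2 (blocksOf x)) ∧
    UnifLip g.paramSet (fun p x => g.R3 p.1 p.2 (blocksOf x)) ∧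
    UnifLip g.paramSet (fun p x => g.R4 p.1 p.2 (blocksOf x)) ∧
    UnifLip g.paramSet (fun p x => g.R5 p.1 p.2 (blocksOf x)) ∧
    UnifLip g.paramSet (fun p x => g.R6 p.1 p.2 (blocksOf x)) := by
  have x1 : UnifLip g.paramSet fun _ (x : State n m₁ m₂) => x.1 := UnifLip.id.fst
  have x2 : UnifLip g.paramSet fun _ (x : State n m₁ m₂) => x.2.1 := UnifLip.id.snd.fst
  have x3 : UnifLip g.paramSet fun _ (x : State n m₁ m₂) => x.2.2.1 := UnifLip.id.snd.snd.fst
  have x4 : UnifLip g.paramSet fun _ (x : State n m₁ m₂) => x.2.2.2.1 :=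
    UnifLip.id.snd.snd.snd.fst
  have x5 : UnifLip g.paramSet fun _ (x : State n m₁ m₂) => x.2.2.2.2.1 :=
    UnifLip.id.snd.snd.snd.snd.fst
  have x6 : UnifLip g.paramSet fun _ (x : State n m₁ m₂) => x.2.2.2.2.2 :=
    UnifLip.id.snd.snd.snd.snd.snd
  have a1 := unifLip_coeff hc.a1
  have a2 := unifLip_coeff hc.a2
  have a4 := unifLip_coeff hc.a4
  have a5 := unifLip_coeff hc.a5
  have a6 := unifLip_coeff hc.a6
  have a7 := unifLip_coeff hc.a7
  have a8 := unifLip_coeff hc.a8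
  have a9 := unifLip_coeff hc.a9
  have s1 := unifLip_coeff hc.s1
  have s2 := unifLip_coeff hc.s2
  have s3 := unifLip_coeff hc.s3
  have s4 := unifLip_coeff hc.s4
  have s5 := unifLip_coeff hc.s5
  have s6 := unifLip_coeff hc.s6
  refine ⟨?_, ?_, ?_, ?_, ?_, ?_⟩ <;> simp only [R1, R2, R3, R4, R5, R6, blocksOf] <;>
  repeat' with_reducible first
    | assumption
    | apply unifLip_add
    | apply unifLip_sub
    | apply unifLip_neg
    | apply UnifLip.matrix_mul
    | apply UnifLip.matrix_transpose
    | apply unifLip_smul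
    | apply unifLip_smul_pow

/-- The right-hand side of the transformed system on the space of states, before the division of
its fast components by `ε`. -/
noncomputable def fieldOf (g : GameData n m₁ m₂ l) (p : ℝ × ℝ) (x : State n m₁ m₂) :
    State n m₁ m₂ :=
  stateOf (g.rhs p.1 p.2 (blocksOf x))

set_option maxHeartbeats 1000000 in
theorem unifLip_fieldOf (hc : g.ContData) : UnifLip g.paramSet g.fieldOf := by
  have x1 : UnifLip g.paramSet fun _ (x : State n m₁ m₂) => x.1 := UnifLip.id.fst
  have x2 : UnifLip g.paramSet fun _ (x : State n m₁ m₂) => x.2.1 := UnifLip.id.snd.fst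
  have x3 : UnifLip g.paramSet fun _ (x : State n m₁ m₂) => x.2.2.1 := UnifLip.id.snd.snd.fst
  have x4 : UnifLip g.paramSet fun _ (x : State n m₁ m₂) => x.2.2.2.1 :=
    UnifLip.id.snd.snd.snd.fst
  have x5 : UnifLip g.paramSet fun _ (x : State n m₁ m₂) => x.2.2.2.2.1 :=
    UnifLip.id.snd.snd.snd.snd.fst
  have x6 : UnifLip g.paramSet fun _ (x : State n m₁ m₂) => x.2.2.2.2.2 :=
    UnifLip.id.snd.snd.snd.snd.snd
  have a1 := unifLip_coeff hc.a1
  have a2 := unifLip_coeff hc.a2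
  have a6 := unifLip_coeff hc.a6
  have a9 := unifLip_coeff hc.a9
  have s1 := unifLip_coeff hc.s1
  have d1 := unifLip_coeff hc.d1
  have lm := unifLip_coeff hc.lam
  obtain ⟨r1, r2, r3, r4, r5, r6⟩ := unifLip_remainders hc
  simp only [blocksOf] at r1 r2 r3 r4 r5 r6
  unfold fieldOf stateOf
  refine .prodMk ?_ (.prodMk ?_ (.prodMk ?_ (.prodMk ?_ (.prodMk ?_ ?_)))) <;>
  simp only [rhs, pow_two (M := Matrix _ _ ℝ)] <;>
  simp only [blocksOf] <;>
  repeat' with_reducible first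
    | assumption
    | apply unifLip_add
    | apply unifLip_sub
    | apply unifLip_neg
    | apply UnifLip.matrix_mul
    | apply UnifLip.matrix_transpose
    | apply unifLip_smul

/-- The vector field of the transformed system. -/
noncomputable def field (g : GameData n m₁ m₂ l) (ε t : ℝ) (x : State n m₁ m₂) : State n m₁ m₂ :=
  let r := g.rhs ε t (blocksOf x)
  (r.K1, ε⁻¹ • r.K2, r.K3, ε⁻¹ • r.K4, ε⁻¹ • r.K5, r.K6)

/-- Because of the factors `ε⁻¹` these constants depend on `ε`. They are used only for existence,
uniqueness and symmetry at a fixed `ε`, never for the error estimate. -/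
theorem unifLip_field (hc : g.ContData) {ε : ℝ} (hε : ε ∈ Icc (0 : ℝ) 1) :
    UnifLip (Icc 0 g.tf) (g.field ε) := by
  have h := (unifLip_fieldOf hc).comp_param (u := Icc 0 g.tf) (f := fun t => (ε, t))
    (by fun_prop) fun t ht => ⟨hε, ht⟩
  have hsm : ∀ {a b : ℕ} {V : ℝ → State n m₁ m₂ → Matrix (Fin a) (Fin b) ℝ},
      UnifLip (Icc 0 g.tf) V → UnifLip (Icc 0 g.tf) fun t x => ε⁻¹ • V t x :=
    fun hV => hV.smul isCompact_Icc continuousOn_const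
  exact h.fst.prodMk ((hsm h.snd.fst).prodMk (h.snd.snd.fst.prodMk ((hsm h.snd.snd.snd.fst).prodMk
    ((hsm h.snd.snd.snd.snd.fst).prodMk h.snd.snd.snd.snd.snd))))

theorem IsSolution.hasDerivWithinAt {ε : ℝ} {K : ℝ → Blocks n m₁ m₂} (h : g.IsSolution ε K) :
    ∀ t ∈ Icc 0 g.tf,
      HasDerivWithinAt (fun s => stateOf (K s)) (g.field ε t (stateOf (K t))) (Icc 0 g.tf) t :=
  fun t ht => (h.deriv1 t ht).prodMk ((h.deriv2 t ht).prodMk ((h.deriv3 t ht).prodMk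
    ((h.deriv4 t ht).prodMk ((h.deriv5 t ht).prodMk (h.deriv6 t ht)))))

theorem hasDerivWithinAt_fst {E F : Type*} [NormedAddCommGroup E] [NormedSpace ℝ E]
    [NormedAddCommGroup F] [NormedSpace ℝ F] {x : ℝ → E × F} {x' : E × F} {s : Set ℝ} {t : ℝ}
    (h : HasDerivWithinAt x x' s t) : HasDerivWithinAt (fun t => (x t).1) x'.1 s t :=
  (hasFDerivAt_fst (𝕜 := ℝ) (p := x t)).comp_hasDerivWithinAt t h

theorem hasDerivWithinAt_snd {E F : Type*} [NormedAddCommGroup E] [NormedSpace ℝ E]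
    [NormedAddCommGroup F] [NormedSpace ℝ F] {x : ℝ → E × F} {x' : E × F} {s : Set ℝ} {t : ℝ}
    (h : HasDerivWithinAt x x' s t) : HasDerivWithinAt (fun t => (x t).2) x'.2 s t :=
  (hasFDerivAt_snd (𝕜 := ℝ) (p := x t)).comp_hasDerivWithinAt t h

theorem isSolution_of_hasDerivWithinAt {ε : ℝ} {x : ℝ → State n m₁ m₂}
    (hx : ∀ t ∈ Icc 0 g.tf, HasDerivWithinAt x (g.field ε t (x t)) (Icc 0 g.tf) t)
    (h : x g.tf = (g.F1, 0, 0, 0, 0, 0)) : g.IsSolution ε fun t => blocksOf (x t) where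
  deriv1 t ht := hasDerivWithinAt_fst (hx t ht)
  deriv2 t ht := hasDerivWithinAt_fst (hasDerivWithinAt_snd (hx t ht))
  deriv3 t ht := hasDerivWithinAt_fst (hasDerivWithinAt_snd (hasDerivWithinAt_snd (hx t ht)))
  deriv4 t ht := hasDerivWithinAt_fst (hasDerivWithinAt_snd (hasDerivWithinAt_snd
    (hasDerivWithinAt_snd (hx t ht))))
  deriv5 t ht := hasDerivWithinAt_fst (hasDerivWithinAt_snd (hasDerivWithinAt_snd
    (hasDerivWithinAt_snd (hasDerivWithinAt_snd (hx t ht)))))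
  deriv6 t ht := hasDerivWithinAt_snd (hasDerivWithinAt_snd (hasDerivWithinAt_snd
    (hasDerivWithinAt_snd (hasDerivWithinAt_snd (hx t ht)))))
  terminal := by rw [h]; rfl

theorem IsSolution.eqOn (hc : g.ContData) {ε : ℝ} (hε : ε ∈ Icc (0 : ℝ) 1)
    {K K' : ℝ → Blocks n m₁ m₂} (h : g.IsSolution ε K) (h' : g.IsSolution ε K') :
    EqOn K' K (Icc 0 g.tf) := by
  intro t ht
  have := eqOn_of_terminal (unifLip_field hc hε) h'.hasDerivWithinAt h.hasDerivWithinAt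
    (by simp only [h.terminal, h'.terminal]) ht
  exact congrArg blocksOf this

theorem transpose_Sv (hg : g.Standing) {t : ℝ} (ht : t ∈ Icc 0 g.tf) : (g.Sv t)ᵀ = g.Sv t := by
  have h_G : ((g.G t)⁻¹)ᵀ = (g.G t)⁻¹ := by
    rw [transpose_nonsing_inv]
    congr 1
    exact (hg.G_posDef t ht).1
  simp only [Sv, transpose_mul, transpose_transpose, h_G, Matrix.mul_assoc]

theorem transpose_S1 (hg : g.Standing) {t : ℝ} (ht : t ∈ Icc 0 g.tf) : (g.S1 t)ᵀ = g.S1 t := by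
  ext i j; exact congrFun (congrFun (transpose_Sv hg ht) (Sum.inl i)) (Sum.inl j)

theorem transpose_S4 (hg : g.Standing) {t : ℝ} (ht : t ∈ Icc 0 g.tf) : (g.S4 t)ᵀ = g.S4 t := by
  ext i j
  exact congrFun (congrFun (transpose_Sv hg ht) (Sum.inr (Sum.inl i))) (Sum.inr (Sum.inl j))

theorem transpose_S6 (hg : g.Standing) {t : ℝ} (ht : t ∈ Icc 0 g.tf) : (g.S6 t)ᵀ = g.S6 t := by
  ext i j
  exact congrFun (congrFun (transpose_Sv hg ht) (Sum.inr (Sum.inr i))) (Sum.inr (Sum.inr j))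

/-- Each of these three right-hand sides involves only one of `K₁`, `K₄`, `K₆`, so transposing the
equation transposes that block and leaves the others as they are. Symmetry can thus be proved for
one block at a time. -/
theorem rhs_transpose (hg : g.Standing) (ε : ℝ) {t : ℝ} (ht : t ∈ Icc 0 g.tf)
    (k : Blocks n m₁ m₂) :
    (g.rhs ε t k).K1ᵀ = (g.rhs ε t { k with K1 := k.K1ᵀ }).K1 ∧
    (g.rhs ε t k).K4ᵀ = (g.rhs ε t { k with K4 := k.K4ᵀ }).K4 ∧
    (g.rhs ε t k).K6ᵀ = (g.rhs ε t { k with K6 := k.K6ᵀ }).K6 := by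
  have hD : (g.D1 t)ᵀ = g.D1 t := (hg.D1_posSemidef t ht).1
  have hL : (g.Lam t)ᵀ = g.Lam t := diagonal_transpose _
  refine ⟨?_, ?_, ?_⟩ <;>
  · simp only [rhs, R1, R4, R6, transpose_add, transpose_sub, transpose_neg, transpose_smul,
      transpose_mul, transpose_transpose, Matrix.mul_assoc, hD, hL, transpose_S1 hg ht,
      transpose_S4 hg ht, transpose_S6 hg ht, smul_add, smul_sub, pow_two (M := Matrix _ _ ℝ)]
    abel

/-- The two states compared differ in a single block, so the Lipschitz bound controls the derivative
of the block minus its transpose by that same difference, which vanishes at `t_f`. -/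
theorem IsSolution.symmetric (hg : g.Standing) (hc : g.ContData) {ε : ℝ}
    (hε : ε ∈ Icc (0 : ℝ) 1) {K : ℝ → Blocks n m₁ m₂} (h : g.IsSolution ε K) :
    ∀ t ∈ Icc 0 g.tf, (K t).K1ᵀ = (K t).K1 ∧ (K t).K4ᵀ = (K t).K4 ∧ (K t).K6ᵀ = (K t).K6 := by
  obtain ⟨R, hR⟩ := isCompact_Icc.exists_bound_of_continuousOn
    (fun t ht => (h.hasDerivWithinAt t ht).continuousWithinAt :
      ContinuousOn (fun t => stateOf (K t)) (Icc 0 g.tf))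
  obtain ⟨L, hL₀, hL⟩ := (unifLip_field hc hε).exists_lipschitz R
  have hK : ∀ t ∈ Icc 0 g.tf, ‖(K t).K1‖ ≤ R ∧ ‖(K t).K2‖ ≤ R ∧ ‖(K t).K3‖ ≤ R ∧ ‖(K t).K4‖ ≤ R ∧
      ‖(K t).K5‖ ≤ R ∧ ‖(K t).K6‖ ≤ R := fun t ht => by
    simpa only [stateOf, norm_prod_le_iff] using hR t ht
  intro t ht
  refine ⟨?_, ?_, ?_⟩
  · refine (sub_eq_zero.1 (eq_zero_of_terminal (C := L) (fun t ht => (h.deriv1 t ht).sub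
      (hasDerivWithinAt_matrix_transpose (h.deriv1 t ht))) ?_ (fun t ht => ?_) t ht)).symm
    · change (K g.tf).K1 - (K g.tf).K1ᵀ = 0
      rw [h.terminal]
      exact sub_eq_zero.2 hg.F1_posSemidef.1.symm
    · rw [(rhs_transpose hg ε ht _).1]
      refine (norm_fst_le _).trans ((hL t ht (stateOf (K t))
        (stateOf { K t with K1 := (K t).K1ᵀ }) (hR t ht) ?_).trans ?_)
      · simpa only [stateOf, norm_prod_le_iff, frobenius_norm_transpose] using hK t ht
      · simp [stateOf]
  · refine (sub_eq_zero.1 (eq_zero_of_terminal (C := L) (fun t ht => (h.deriv4 t ht).sub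
      (hasDerivWithinAt_matrix_transpose (h.deriv4 t ht))) ?_ (fun t ht => ?_) t ht)).symm
    · simp [h.terminal]
    · rw [transpose_smul, (rhs_transpose hg ε ht _).2.1]
      refine ((norm_fst_le _).trans ((norm_snd_le _).trans ((norm_snd_le _).trans
        (norm_snd_le _)))).trans ((hL t ht (stateOf (K t))
        (stateOf { K t with K4 := (K t).K4ᵀ }) (hR t ht) ?_).trans ?_)
      · simpa only [stateOf, norm_prod_le_iff, frobenius_norm_transpose] using hK t ht
      · simp [stateOf]
  · refine (sub_eq_zero.1 (eq_zero_of_terminal (C := L) (fun t ht => (h.deriv6 t ht).sub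
      (hasDerivWithinAt_matrix_transpose (h.deriv6 t ht))) ?_ (fun t ht => ?_) t ht)).symm
    · simp [h.terminal]
    · rw [(rhs_transpose hg ε ht _).2.2]
      refine ((norm_snd_le _).trans ((norm_snd_le _).trans ((norm_snd_le _).trans
        ((norm_snd_le _).trans (norm_snd_le _))))).trans ((hL t ht (stateOf (K t))
        (stateOf { K t with K6 := (K t).K6ᵀ }) (hR t ht) ?_).trans ?_)
      · simpa only [stateOf, norm_prod_le_iff, frobenius_norm_transpose] using hK t ht
      · simp [stateOf]

theorem exists_outerK6 (hg : g.Standing) (hc : g.ContData) :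
    ∃ K : ℝ → Matrix (Fin m₂) (Fin m₂) ℝ, g.IsOuterK6 K := by
  obtain ⟨K, hK, h0⟩ := exists_riccati hg.tf_pos.le hc.a9 hc.a6
  exact ⟨K, hK, h0⟩

theorem IsOuterK6.eqOn (hc : g.ContData) {K K' : ℝ → Matrix (Fin m₂) (Fin m₂) ℝ}
    (h : g.IsOuterK6 K) (h' : g.IsOuterK6 K') : EqOn K' K (Icc 0 g.tf) := by
  have a6 := UnifLip.coeff (E := Matrix (Fin m₂) (Fin m₂) ℝ) isCompact_Icc hc.a6
  have a9 := UnifLip.coeff (E := Matrix (Fin m₂) (Fin m₂) ℝ) isCompact_Icc hc.a9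
  have hx : UnifLip (Icc 0 g.tf) fun _ (x : Matrix (Fin m₂) (Fin m₂) ℝ) => x := UnifLip.id
  have hV : UnifLip (Icc 0 g.tf) fun t (x : Matrix (Fin m₂) (Fin m₂) ℝ) =>
      -(x * g.Abar9 t) - (g.Abar9 t)ᵀ * x + x ^ 2 - (g.Abar6 t)ᵀ * g.Abar6 t := by
    simp only [pow_two]
    exact (((hx.matrix_mul a9).neg.sub (a9.matrix_transpose.matrix_mul hx)).add
      (hx.matrix_mul hx)).sub (a6.matrix_transpose.matrix_mul a6)
  exact eqOn_of_terminal hV h'.deriv h.deriv (by rw [h.terminal, h'.terminal])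

end GameData

end System

end CheapControl

namespace CheapControl

/-! ### Functions with a bounded derivative. -/

section BddDeriv

variable {F : Type*} [NormedAddCommGroup F] [NormedSpace ℝ F] {T : ℝ}

/-- The function is differentiable on `[0, T]` with a bounded derivative. -/
def BddDeriv (T : ℝ) (f : ℝ → F) : Prop :=
  ∃ f' : ℝ → F, ∃ C, 0 ≤ C ∧ ∀ t ∈ Icc 0 T, HasDerivWithinAt f (f' t) (Icc 0 T) t ∧ ‖f' t‖ ≤ C

namespace BddDeriv

theorem continuousOn {f : ℝ → F} (h : BddDeriv T f) : ContinuousOn f (Icc 0 T) := by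
  obtain ⟨f', C, -, hf⟩ := h
  exact fun t ht => (hf t ht).1.continuousWithinAt

theorem of_continuousOn {f f' : ℝ → F} (hT : 0 ≤ T)
    (h : ∀ t ∈ Icc 0 T, HasDerivWithinAt f (f' t) (Icc 0 T) t)
    (hf' : ContinuousOn f' (Icc 0 T)) : BddDeriv T f := by
  obtain ⟨C, hC⟩ := isCompact_Icc.exists_bound_of_continuousOn hf'
  exact ⟨f', C, (norm_nonneg _).trans (hC 0 ⟨le_rfl, hT⟩), fun t ht => ⟨h t ht, hC t ht⟩⟩

theorem of_contDiffOn {f : ℝ → F} (hT : 0 < T) (h : ContDiffOn ℝ 1 f (Icc 0 T)) :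
    BddDeriv T f :=
  of_continuousOn hT.le (fun t ht => ((h.differentiableOn one_ne_zero) t ht).hasDerivWithinAt)
    (h.continuousOn_derivWithin (uniqueDiffOn_Icc hT) le_rfl)

theorem lipschitz {f : ℝ → F} (h : BddDeriv T f) :
    ∃ C, 0 ≤ C ∧ ∀ t ∈ Icc 0 T, ∀ u ∈ Icc 0 T, ‖f t - f u‖ ≤ C * |t - u| := by
  obtain ⟨f', C, hC, hf⟩ := h
  exact ⟨C, hC, fun t ht u hu => (convex_Icc 0 T).norm_image_sub_le_of_norm_hasDerivWithin_le
    (fun x hx => (hf x hx).1) (fun x hx => (hf x hx).2) hu ht⟩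

theorem matrix_mul {a b c : Type*} [Fintype a] [Fintype b] [Fintype c] {f : ℝ → Matrix a b ℝ}
    {g : ℝ → Matrix b c ℝ} (hf : BddDeriv T f) (hg : BddDeriv T g) :
    BddDeriv T fun t => f t * g t := by
  obtain ⟨M, hM⟩ := isCompact_Icc.exists_bound_of_continuousOn hf.continuousOn
  obtain ⟨N, hN⟩ := isCompact_Icc.exists_bound_of_continuousOn hg.continuousOn
  obtain ⟨f', C, hC, hf⟩ := hf
  obtain ⟨g', D, hD, hg⟩ := hg
  refine ⟨fun t => f t * g' t + f' t * g t, |M| * D + C * |N|, by positivity, fun t ht =>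
    ⟨hasDerivWithinAt_matrix_mul (hf t ht).1 (hg t ht).1, ?_⟩⟩
  refine (norm_add_le _ _).trans (add_le_add ?_ ?_)
  · exact (frobenius_norm_mul _ _).trans (mul_le_mul ((hM t ht).trans (le_abs_self M))
      (hg t ht).2 (norm_nonneg _) (abs_nonneg _))
  · exact (frobenius_norm_mul _ _).trans (mul_le_mul (hf t ht).2
      ((hN t ht).trans (le_abs_self N)) (norm_nonneg _) hC)

theorem matrix {a b : ℕ} {f : ℝ → Matrix (Fin a) (Fin b) ℝ}
    (h : ∀ i j, BddDeriv T fun t => f t i j) : BddDeriv T f := by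
  choose f' C hC hf using h
  refine ⟨fun t => Matrix.of fun i j => f' i j t, a * b * ∑ i, ∑ j, C i j,
    mul_nonneg (by positivity) (Finset.sum_nonneg fun i _ => Finset.sum_nonneg fun j _ => hC i j),
    fun t ht => ⟨?_, ?_⟩⟩
  · exact hasDerivWithinAt_pi.2 fun i => hasDerivWithinAt_pi.2 fun j => (hf i j t ht).1
  · refine norm_matrix_le_of_entry_le fun i j => ((hf i j t ht).2).trans ?_
    exact (Finset.single_le_sum (f := fun j => C i j) (fun j _ => hC i j)
      (Finset.mem_univ j)).trans (Finset.single_le_sum (f := fun i => ∑ j, C i j)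
        (fun i _ => Finset.sum_nonneg fun j _ => hC i j) (Finset.mem_univ i))

end BddDeriv

theorem contDiffOn_entry {ι κ : Type*} [Fintype ι] [Fintype κ] {f : ℝ → Matrix ι κ ℝ} {s : Set ℝ}
    (h : ContDiffOn ℝ 1 f s) (i : ι) (j : κ) : ContDiffOn ℝ 1 (fun t => f t i j) s :=
  (entryCLM i j).contDiff.comp_contDiffOn h

end BddDeriv

/-! ### The scalar boundary-layer profiles. -/

section Layer

open Real

/-- The profile `2 e^{2aτ} / (1 + e^{2aτ})` of the initial layer. -/
noncomputable def layerPhi (a τ : ℝ) : ℝ := 2 * exp (2 * (τ * a)) / (1 + exp (2 * (τ * a)))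

/-- The profile `2 e^{aτ} / (1 + e^{2aτ})` of the initial layer. -/
noncomputable def layerPsi (a τ : ℝ) : ℝ := 2 * exp (τ * a) / (1 + exp (2 * (τ * a)))

/-- By this logistic equation `κ = -a φ` solves `κ' = 2 a κ + κ²`, which is the layer equation of
`K₄` about the equilibrium `a`. -/
theorem hasDerivAt_layerPhi (a τ : ℝ) :
    HasDerivAt (layerPhi a) (a * layerPhi a τ * (2 - layerPhi a τ)) τ := by
  have h1 : HasDerivAt (fun τ : ℝ => 2 * (τ * a)) (2 * a) τ := by
    simpa using ((hasDerivAt_id τ).mul_const a).const_mul 2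
  have hpos : (1 + exp (2 * (τ * a))) ≠ 0 := by positivity
  refine ((h1.exp.const_mul 2).div (h1.exp.const_add 1) hpos).congr_deriv ?_
  simp only [layerPhi]
  field_simp

theorem hasDerivAt_layerPsi (a τ : ℝ) :
    HasDerivAt (layerPsi a) (a * layerPsi a τ * (1 - layerPhi a τ)) τ := by
  have h1 : HasDerivAt (fun τ : ℝ => 2 * (τ * a)) (2 * a) τ := by
    simpa using ((hasDerivAt_id τ).mul_const a).const_mul 2
  have h2 : HasDerivAt (fun τ : ℝ => τ * a) a τ := by
    simpa using (hasDerivAt_id τ).mul_const a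
  have hpos : (1 + exp (2 * (τ * a))) ≠ 0 := by positivity
  refine ((h2.exp.const_mul 2).div (h1.exp.const_add 1) hpos).congr_deriv ?_
  simp only [layerPhi, layerPsi]
  field_simp

theorem hasDerivAt_layerPhi_reverse (a ε s : ℝ) :
    HasDerivAt (fun s => layerPhi a (-s / ε))
      (-(ε⁻¹ * (a * layerPhi a (-s / ε) * (2 - layerPhi a (-s / ε))))) s := by
  have h1 : HasDerivAt (fun s : ℝ => -s / ε) (-1 / ε) s := (hasDerivAt_id s).fun_neg.div_const ε
  refine ((hasDerivAt_layerPhi a (-s / ε)).comp s h1).congr_deriv ?_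
  ring

theorem hasDerivAt_layerPsi_reverse (a ε s : ℝ) :
    HasDerivAt (fun s => layerPsi a (-s / ε))
      (-(ε⁻¹ * (a * layerPsi a (-s / ε) * (1 - layerPhi a (-s / ε))))) s := by
  have h1 : HasDerivAt (fun s : ℝ => -s / ε) (-1 / ε) s := (hasDerivAt_id s).fun_neg.div_const ε
  refine ((hasDerivAt_layerPsi a (-s / ε)).comp s h1).congr_deriv ?_
  ring

theorem abs_layerPhi_le {a β τ : ℝ} (hβ : 0 ≤ β) (ha : β ≤ a) (hτ : τ ≤ 0) :
    |layerPhi a τ| ≤ 2 * exp (β * τ) := by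
  have h0 : 0 ≤ layerPhi a τ := by unfold layerPhi; positivity
  rw [abs_of_nonneg h0, layerPhi, div_le_iff₀ (by positivity)]
  have h1 : exp (2 * (τ * a)) ≤ exp (β * τ) := exp_le_exp.2 (by nlinarith)
  have h2 : 0 ≤ 2 * exp (β * τ) * exp (2 * (τ * a)) := by positivity
  linarith

theorem abs_layerPsi_le {a β τ : ℝ} (ha : β ≤ a) (hτ : τ ≤ 0) :
    |layerPsi a τ| ≤ 2 * exp (β * τ) := by
  have h0 : 0 ≤ layerPsi a τ := by unfold layerPsi; positivity
  rw [abs_of_nonneg h0, layerPsi, div_le_iff₀ (by positivity)]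
  have h1 : exp (τ * a) ≤ exp (β * τ) := exp_le_exp.2 (by nlinarith)
  have h2 : 0 ≤ 2 * exp (β * τ) * exp (2 * (τ * a)) := by positivity
  linarith

/-- With `x = βs/ε` this is `x ≤ e^x`. It turns the error `O(s)` of freezing a coefficient at `t_f`,
multiplied by the decay of the layer, into `O(ε)`. -/
theorem mul_exp_neg_le {β ε s : ℝ} (hβ : 0 < β) (hε : 0 < ε) :
    s * exp (-(β * s / ε)) ≤ ε / β := by
  have h := add_one_le_exp (β * s / ε)
  rw [exp_neg, ← div_eq_mul_inv, div_le_div_iff₀ (exp_pos _) hβ]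
  have : s * β = ε * (β * s / ε) := by field_simp
  rw [this]
  exact mul_le_mul_of_nonneg_left (by linarith) hε.le

end Layer

/-! ### The outer solution and the boundary corrections in diagonal form. -/

section Approximation

variable {n m₁ m₂ l : ℕ}

namespace GameData

variable {g : GameData n m₁ m₂ l}

/-- The diagonal entries of `Λ^{1/2}(t)`. -/
noncomputable def sqrtLam (g : GameData n m₁ m₂ l) (t : ℝ) : Fin m₁ → ℝ :=
  fun p => √(g.lam t (Sum.inl p))

theorem LamSqrt_eq (t : ℝ) : g.LamSqrt t = diagonal (g.sqrtLam t) := rfl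

theorem sqrtLam_pos (hg : g.Standing) {t : ℝ} (ht : t ∈ Icc 0 g.tf) (p : Fin m₁) :
    0 < g.sqrtLam t p := Real.sqrt_pos.2 (hg.lam_pos t ht p)

theorem Lam_eq (hg : g.Standing) {t : ℝ} (ht : t ∈ Icc 0 g.tf) :
    g.Lam t = diagonal fun p => g.sqrtLam t p ^ 2 := by
  unfold Lam sqrtLam
  congr 1
  ext p
  rw [Real.sq_sqrt (hg.lam_pos t ht p).le]

theorem inv_LamSqrt (hg : g.Standing) {t : ℝ} (ht : t ∈ Icc 0 g.tf) :
    (g.LamSqrt t)⁻¹ = diagonal fun p => (g.sqrtLam t p)⁻¹ := by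
  refine inv_eq_right_inv ?_
  rw [LamSqrt_eq, diagonal_mul_diagonal, ← diagonal_one]
  congr 1
  ext p
  exact mul_inv_cancel₀ (sqrtLam_pos hg ht p).ne'

theorem inv_Lam (hg : g.Standing) {t : ℝ} (ht : t ∈ Icc 0 g.tf) :
    (g.Lam t)⁻¹ = (g.LamSqrt t)⁻¹ * (g.LamSqrt t)⁻¹ := by
  rw [inv_LamSqrt hg ht, Lam_eq hg ht]
  refine inv_eq_right_inv ?_
  rw [diagonal_mul_diagonal, diagonal_mul_diagonal, ← diagonal_one]
  congr 1
  ext p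
  have := (sqrtLam_pos hg ht p).ne'
  field_simp

theorem contDiffOn_sqrtLam (hg : g.Standing) (hs : g.SmoothData) (p : Fin m₁) :
    ContDiffOn ℝ 1 (fun t => g.sqrtLam t p) (Icc 0 g.tf) := by
  have h := contDiffOn_entry hs.D2_contDiff (Sum.inl p) (Sum.inl p)
  have h' : ContDiffOn ℝ 1 (fun t => g.lam t (Sum.inl p)) (Icc 0 g.tf) :=
    h.congr fun t _ => by simp [D2]
  exact h'.sqrt fun t ht => (hg.lam_pos t ht p).ne'

theorem bddDeriv_diagonal {v : ℝ → Fin m₁ → ℝ} {T : ℝ} (hT : 0 < T)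
    (h : ∀ p, ContDiffOn ℝ 1 (fun t => v t p) (Icc 0 T)) :
    BddDeriv T fun t => (diagonal (v t) : Matrix (Fin m₁) (Fin m₁) ℝ) := by
  refine BddDeriv.matrix fun i j => BddDeriv.of_contDiffOn hT ?_
  by_cases hij : i = j
  · subst hij; simpa using h i
  · simpa [hij] using contDiffOn_const

theorem bddDeriv_LamSqrt (hg : g.Standing) (hs : g.SmoothData) : BddDeriv g.tf g.LamSqrt :=
  bddDeriv_diagonal hg.tf_pos (contDiffOn_sqrtLam hg hs)

theorem bddDeriv_inv_LamSqrt (hg : g.Standing) (hs : g.SmoothData) :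
    BddDeriv g.tf fun t => diagonal fun p => (g.sqrtLam t p)⁻¹ :=
  bddDeriv_diagonal hg.tf_pos fun p =>
    (contDiffOn_sqrtLam hg hs p).inv fun _ ht => (sqrtLam_pos hg ht p).ne'

theorem bddDeriv_Abar2 (hg : g.Standing) (hs : g.SmoothData) : BddDeriv g.tf g.Abar2 :=
  BddDeriv.matrix fun i j =>
    BddDeriv.of_contDiffOn hg.tf_pos (contDiffOn_entry hs.A2_contDiff i (Sum.inl j))

theorem bddDeriv_Abar6 (hg : g.Standing) (hs : g.SmoothData) : BddDeriv g.tf g.Abar6 :=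
  BddDeriv.matrix fun i j =>
    BddDeriv.of_contDiffOn hg.tf_pos (contDiffOn_entry hs.A4_contDiff (Sum.inl i) (Sum.inr j))

theorem exists_lower_bound_sqrtLam (hg : g.Standing) (hs : g.SmoothData) :
    ∃ β > 0, ∀ t ∈ Icc 0 g.tf, ∀ p, β ≤ g.sqrtLam t p := by
  have h : ∀ p, ∃ β > 0, ∀ t ∈ Icc 0 g.tf, β ≤ g.sqrtLam t p := by
    intro p
    obtain ⟨u, hu, hmin⟩ := isCompact_Icc.exists_isMinOn (nonempty_Icc.2 hg.tf_pos.le)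
      (contDiffOn_sqrtLam hg hs p).continuousOn
    exact ⟨g.sqrtLam u p, sqrtLam_pos hg hu p, fun t ht => hmin ht⟩
  choose β hβ hle using h
  rcases isEmpty_or_nonempty (Fin m₁) with h | h
  · exact ⟨1, one_pos, fun t _ p => (h.false p).elim⟩
  · obtain ⟨p₀, hp₀⟩ := Finite.exists_min β
    exact ⟨β p₀, hβ p₀, fun t ht p => (hp₀ p).trans (hle p t ht)⟩

theorem continuousOn_quadratic_coeff (hg : g.Standing) (hs : g.SmoothData) :
    ContinuousOn (fun t => g.Abar2 t * (g.Lam t)⁻¹ * (g.Abar2 t)ᵀ - g.S1 t) (Icc 0 g.tf) := by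
  have hc := contData hg hs
  have hLinv : ContinuousOn (fun t => (g.Lam t)⁻¹) (Icc 0 g.tf) := by
    have := (bddDeriv_inv_LamSqrt hg hs).continuousOn
    refine (continuousOn_matrix_mul this this).congr fun t ht => ?_
    rw [inv_Lam hg ht, inv_LamSqrt hg ht]
  exact (continuousOn_matrix_mul (continuousOn_matrix_mul hc.a2 hLinv)
    (continuousOn_matrix_transpose hc.a2)).sub hc.s1

/-- The transpose solves the same terminal-value problem. Symmetry is needed to recognise `K₂ K₂ᵀ`,
for the outer `K₂`, as the quadratic term of the reduced Riccati equation. -/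
theorem IsOuterK1.transpose_eq (hg : g.Standing) (hs : g.SmoothData)
    {K : ℝ → Matrix (Fin n) (Fin n) ℝ} (h : g.IsOuterK1 K) :
    ∀ t ∈ Icc 0 g.tf, (K t)ᵀ = K t := by
  have hc := contData hg hs
  have hx : UnifLip (Icc 0 g.tf) fun _ (x : Matrix (Fin n) (Fin n) ℝ) => x := UnifLip.id
  have a1 := UnifLip.coeff (E := Matrix (Fin n) (Fin n) ℝ) isCompact_Icc hc.a1
  have d1 := UnifLip.coeff (E := Matrix (Fin n) (Fin n) ℝ) isCompact_Icc hc.d1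
  have q := UnifLip.coeff (E := Matrix (Fin n) (Fin n) ℝ) isCompact_Icc
    (continuousOn_quadratic_coeff hg hs)
  have hV : UnifLip (Icc 0 g.tf) fun t (x : Matrix (Fin n) (Fin n) ℝ) =>
      -(x * g.Abar1 t) - (g.Abar1 t)ᵀ * x
        + x * (g.Abar2 t * (g.Lam t)⁻¹ * (g.Abar2 t)ᵀ - g.S1 t) * x - g.D1 t :=
    (((hx.matrix_mul a1).neg.sub (a1.matrix_transpose.matrix_mul hx)).add
      ((hx.matrix_mul q).matrix_mul hx)).sub d1
  refine eqOn_of_terminal (x := fun t => (K t)ᵀ) hV (fun t ht => ?_) h.deriv ?_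
  · refine (hasDerivWithinAt_matrix_transpose (h.deriv t ht)).congr_deriv ?_
    have hD : (g.D1 t)ᵀ = g.D1 t := (hg.D1_posSemidef t ht).1
    have hL : ((g.Lam t)⁻¹)ᵀ = (g.Lam t)⁻¹ := by
      rw [transpose_nonsing_inv]; congr 1; exact diagonal_transpose _
    simp only [transpose_add, transpose_sub, transpose_neg, transpose_mul, transpose_transpose,
      hD, hL, transpose_S1 hg ht, Matrix.mul_assoc]
    abel
  · rw [h.terminal]
    exact hg.F1_posSemidef.1

/-- The outer term `K_{2,0}^o` in terms of `K_{1,0}^o`. -/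
noncomputable def outerK2 (g : GameData n m₁ m₂ l) (K10 : ℝ → Matrix (Fin n) (Fin n) ℝ) (t : ℝ) :
    Matrix (Fin n) (Fin m₁) ℝ := K10 t * g.Abar2 t * (g.LamSqrt t)⁻¹

theorem IsOuterK1.continuousOn {K : ℝ → Matrix (Fin n) (Fin n) ℝ} (h : g.IsOuterK1 K) :
    ContinuousOn K (Icc 0 g.tf) := fun t ht => (h.deriv t ht).continuousWithinAt

theorem IsOuterK6.continuousOn {K : ℝ → Matrix (Fin m₂) (Fin m₂) ℝ} (h : g.IsOuterK6 K) :
    ContinuousOn K (Icc 0 g.tf) := fun t ht => (h.deriv t ht).continuousWithinAt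

theorem IsOuterK1.bddDeriv (hg : g.Standing) (hs : g.SmoothData)
    {K : ℝ → Matrix (Fin n) (Fin n) ℝ} (h : g.IsOuterK1 K) : BddDeriv g.tf K := by
  have hc := contData hg hs
  have hK := h.continuousOn
  exact BddDeriv.of_continuousOn hg.tf_pos.le h.deriv
    ((((continuousOn_matrix_mul hK hc.a1).neg.sub
      (continuousOn_matrix_mul (continuousOn_matrix_transpose hc.a1) hK)).add
      (continuousOn_matrix_mul (continuousOn_matrix_mul hK
        (continuousOn_quadratic_coeff hg hs)) hK)).sub hc.d1)

theorem bddDeriv_outerK2 (hg : g.Standing) (hs : g.SmoothData)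
    {K : ℝ → Matrix (Fin n) (Fin n) ℝ} (h : g.IsOuterK1 K) : BddDeriv g.tf (g.outerK2 K) := by
  have h1 := ((h.bddDeriv hg hs).matrix_mul (bddDeriv_Abar2 hg hs)).matrix_mul
    (bddDeriv_inv_LamSqrt hg hs)
  obtain ⟨f', C, hC, hf⟩ := h1
  have e : ∀ t ∈ Icc 0 g.tf, g.outerK2 K t
      = K t * g.Abar2 t * diagonal fun p => (g.sqrtLam t p)⁻¹ := fun t ht => by
    rw [outerK2, inv_LamSqrt hg ht]
  exact ⟨f', C, hC, fun t ht => ⟨(hf t ht).1.congr e (e t ht), (hf t ht).2⟩⟩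

/-- This is the second equation at `ε = 0`, with `K₄` equal to `Λ^{1/2}`. -/
theorem outerK2_mul (hg : g.Standing) (K : ℝ → Matrix (Fin n) (Fin n) ℝ) {t : ℝ}
    (ht : t ∈ Icc 0 g.tf) : g.outerK2 K t * diagonal (g.sqrtLam t) = K t * g.Abar2 t := by
  rw [outerK2, inv_LamSqrt hg ht, Matrix.mul_assoc _ (diagonal _), diagonal_mul_diagonal]
  convert Matrix.mul_one _
  rw [← diagonal_one]
  congr 1
  ext p
  exact inv_mul_cancel₀ (sqrtLam_pos hg ht p).ne'

theorem H1_eq (τ : ℝ) : g.H1 τ = diagonal fun p => Real.exp (τ * g.sqrtLam g.tf p) := by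
  rw [H1, LamSqrt_eq, ← diagonal_smul, exp_diagonal]
  congr 1
  ext p
  rw [Pi.coe_exp, Real.exp_eq_exp_ℝ]
  rfl

theorem H1_sq (τ : ℝ) : g.H1 τ ^ 2 = diagonal fun p => Real.exp (2 * (τ * g.sqrtLam g.tf p)) := by
  rw [H1_eq, diagonal_pow]
  congr 1
  ext p
  rw [Pi.pow_apply, ← Real.exp_nat_mul]
  norm_num

theorem H2_eq (τ : ℝ) :
    g.H2 τ = diagonal fun p => (1 + Real.exp (2 * (τ * g.sqrtLam g.tf p)))⁻¹ := by
  rw [H2, H1_sq]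
  refine inv_eq_right_inv ?_
  rw [← diagonal_one, diagonal_add, diagonal_mul_diagonal]
  congr 1
  ext p
  exact mul_inv_cancel₀ (by positivity)

/-- The layer profiles of `K₂` and `K₄` at `τ`, one for each fast direction. -/
noncomputable def phi (g : GameData n m₁ m₂ l) (τ : ℝ) : Fin m₁ → ℝ :=
  fun p => layerPhi (g.sqrtLam g.tf p) τ

/-- The layer profiles of `K₅` at `τ`, one for each fast direction. -/
noncomputable def psi (g : GameData n m₁ m₂ l) (τ : ℝ) : Fin m₁ → ℝ :=
  fun p => layerPsi (g.sqrtLam g.tf p) τ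

/-- `ℋ₁`, `ℋ₂` and `Λ^{1/2}` are diagonal, so each correction is minus the outer term at `t_f` with
its columns (`K₂`), diagonal (`K₄`) or rows (`K₅`) scaled by a scalar profile. -/
theorem boundary_eq {K10 : ℝ → Matrix (Fin n) (Fin n) ℝ} (h : K10 g.tf = g.F1) (τ : ℝ) :
    g.boundary τ = ⟨0, -(g.outerK2 K10 g.tf * diagonal (g.phi τ)), 0,
      -diagonal (fun p => g.sqrtLam g.tf p * g.phi τ p), -(diagonal (g.psi τ) * g.Abar6 g.tf),
      0⟩ := by
  rw [boundary, Blocks.mk.injEq]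
  refine ⟨rfl, ?_, rfl, ?_, ?_, rfl⟩
  · rw [outerK2, h, H1_sq, H2_eq, Matrix.mul_assoc _ (diagonal _) (diagonal _),
      diagonal_mul_diagonal]
    ext i j
    simp only [Matrix.smul_apply, Matrix.neg_apply, mul_diagonal, smul_eq_mul, phi, layerPhi]
    field_simp
  · rw [LamSqrt_eq, H1_sq, H2_eq, diagonal_mul_diagonal, diagonal_mul_diagonal]
    ext i j
    by_cases hij : i = j
    · subst hij
      simp only [Matrix.smul_apply, Matrix.neg_apply, diagonal_apply_eq, smul_eq_mul, phi, layerPhi]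
      field_simp
    · simp [hij]
  · rw [H1_eq, H2_eq, diagonal_mul_diagonal]
    ext i j
    simp only [Matrix.smul_apply, Matrix.neg_apply, diagonal_mul, smul_eq_mul, psi, layerPsi]
    field_simp

/-- The choice `K₅ = Ā₆` cancels `K₂ K₅ - K₂ Ā₆`, so `K₃ = 0` is consistent, and it reduces the
terms of the sixth equation in `K₅` to `-Ā₆ᵀ Ā₆`. In the first equation `K₂ K₂ᵀ` supplies the term
with `Λ⁻¹`. -/
theorem outer_slow (hg : g.Standing) (hs : g.SmoothData) {K10 : ℝ → Matrix (Fin n) (Fin n) ℝ}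
    (hK10 : g.IsOuterK1 K10) (K60 : ℝ → Matrix (Fin m₂) (Fin m₂) ℝ) {t : ℝ}
    (ht : t ∈ Icc 0 g.tf) :
    (g.rhs 0 t (g.outer K10 K60 t)).K1 = -(K10 t * g.Abar1 t) - (g.Abar1 t)ᵀ * K10 t
        + K10 t * (g.Abar2 t * (g.Lam t)⁻¹ * (g.Abar2 t)ᵀ - g.S1 t) * K10 t - g.D1 t ∧
    (g.rhs 0 t (g.outer K10 K60 t)).K3 = 0 ∧
    (g.rhs 0 t (g.outer K10 K60 t)).K6 =
      -(K60 t * g.Abar9 t) - (g.Abar9 t)ᵀ * K60 t + K60 t ^ 2 - (g.Abar6 t)ᵀ * g.Abar6 t := by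
  have hL : ((g.LamSqrt t)⁻¹)ᵀ = (g.LamSqrt t)⁻¹ := by
    rw [transpose_nonsing_inv]; congr 1; exact diagonal_transpose _
  refine ⟨?_, ?_, ?_⟩
  · simp only [rhs, outer, zero_smul, sub_zero, inv_Lam hg ht, transpose_mul, hL,
      hK10.transpose_eq hg hs t ht, Matrix.zero_mul, add_zero, Matrix.mul_sub, Matrix.sub_mul,
      Matrix.mul_assoc]
    abel
  · simp only [rhs, outer, zero_smul, sub_zero, Matrix.zero_mul, Matrix.mul_zero, add_zero]
    abel
  · simp only [rhs, outer, zero_smul, sub_zero, Matrix.zero_mul, Matrix.mul_zero, transpose_zero]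
    abel

end GameData

end Approximation

end CheapControl

namespace CheapControl

/-! ### Algebra of the error equations of the fast blocks. -/

section FastIdentities

variable {n m₁ m₂ : ℕ}

theorem hasDerivWithinAt_diagonal {v : ℝ → Fin m₁ → ℝ} {v' : Fin m₁ → ℝ} {S : Set ℝ} {s : ℝ}
    (h : ∀ p, HasDerivWithinAt (fun s => v s p) (v' p) S s) :
    HasDerivWithinAt (fun s => (diagonal (v s) : Matrix (Fin m₁) (Fin m₁) ℝ)) (diagonal v') S
      s := by
  refine hasDerivWithinAt_pi.2 fun i => hasDerivWithinAt_pi.2 fun j => ?_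
  by_cases hij : i = j
  · subst hij; simpa using h i
  · simpa [hij] using hasDerivWithinAt_const s S (0 : ℝ)

/-- Here `a` and `b` are the entries of `Λ^{1/2}` at `t_f` and at the current time, and `Bf`, `B`
the corresponding outer terms. The layer equation is frozen at `t_f`, so the surplus layer terms
carry a factor `B - Bf` or `b - a` next to `φ`. -/
theorem fast_identity₂ {K1 K10 : Matrix (Fin n) (Fin n) ℝ}
    {A2 B Bf K2 R B' : Matrix (Fin n) (Fin m₁) ℝ} {K4 : Matrix (Fin m₁) (Fin m₁) ℝ}
    {a b φ : Fin m₁ → ℝ} (h : B * diagonal b = K10 * A2) (ε : ℝ) :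
    -(K1 * A2) + K2 * K4 - ε • R - ε • B' + Bf * diagonal (fun p => a p * φ p * (2 - φ p)) =
      (K2 - (B - Bf * diagonal φ)) * diagonal (fun p => b p - a p * φ p) +
      (-((K1 - K10) * A2) + K2 * (K4 - diagonal fun p => b p - a p * φ p)
        - ((B - Bf) * diagonal (fun p => a p * φ p) + Bf * diagonal fun p => φ p * (b p - a p))
        - ε • (R + B')) := by
  rw [Matrix.sub_mul K1, ← h, Matrix.mul_sub K2]
  ext i j
  simp only [Matrix.add_apply, Matrix.sub_apply, Matrix.neg_apply, Matrix.smul_apply, smul_eq_mul,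
    mul_diagonal]
  ring

/-- Expanding `K₄ = d + δ` gives the damping `d δ + δ d` and the square `δ²`. The diagonal rest `d²
- b² + a² φ (2 - φ)` collapses to `2 a φ (a - b)`. -/
theorem fast_identity₄ {K4 R L' : Matrix (Fin m₁) (Fin m₁) ℝ} {a b φ : Fin m₁ → ℝ} (ε : ℝ) :
    K4 ^ 2 - diagonal (fun p => b p ^ 2) - ε • R - ε • L'
        + diagonal (fun p => a p * (a p * φ p * (2 - φ p))) =
      diagonal (fun p => b p - a p * φ p) * (K4 - diagonal fun p => b p - a p * φ p) +
      (K4 - diagonal fun p => b p - a p * φ p) * diagonal (fun p => b p - a p * φ p) +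
      ((K4 - diagonal fun p => b p - a p * φ p) * (K4 - diagonal fun p => b p - a p * φ p)
        + diagonal (fun p => 2 * a p * φ p * (a p - b p)) - ε • (R + L')) := by
  simp only [pow_two K4, Matrix.mul_sub, Matrix.sub_mul]
  ext i j
  simp only [Matrix.add_apply, Matrix.sub_apply, Matrix.smul_apply, smul_eq_mul,
    mul_diagonal, diagonal_mul]
  by_cases hij : i = j
  · subst hij
    simp only [diagonal_apply_eq]
    ring
  · simp only [diagonal_apply_ne _ hij]
    ring

theorem fast_identity₅ {K3 : Matrix (Fin n) (Fin m₂) ℝ} {A2 : Matrix (Fin n) (Fin m₁) ℝ}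
    {K5 A6 A6f R A6' : Matrix (Fin m₁) (Fin m₂) ℝ} {K4 : Matrix (Fin m₁) (Fin m₁) ℝ}
    {a b φ ψ : Fin m₁ → ℝ} (ε : ℝ) :
    -(K4 * A6) - A2ᵀ * K3 + K4 * K5 - ε • R - ε • A6'
        + diagonal (fun p => a p * ψ p * (1 - φ p)) * A6f =
      diagonal (fun p => b p - a p * φ p) * (K5 - (A6 - diagonal ψ * A6f)) +
      ((K4 - diagonal fun p => b p - a p * φ p) * (K5 - A6) - A2ᵀ * K3
        - diagonal (fun p => (b p - a p) * ψ p) * A6f - ε • (R + A6')) := by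
  rw [Matrix.sub_mul K4, Matrix.mul_sub K4]
  ext i j
  simp only [Matrix.add_apply, Matrix.sub_apply, Matrix.neg_apply, Matrix.smul_apply, smul_eq_mul,
    diagonal_mul]
  ring

end FastIdentities

/-! ### Bounds for the forcing of the error equations, uniform in `ε`. -/

section Remainders

variable {n m₁ m₂ l : ℕ}

namespace GameData

variable {g : GameData n m₁ m₂ l} {K10 : ℝ → Matrix (Fin n) (Fin n) ℝ}
  {K60 : ℝ → Matrix (Fin m₂) (Fin m₂) ℝ}

/-- The diagonal entries of the approximation of `K₄` at the time `t_f - s`. -/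
noncomputable def damping (g : GameData n m₁ m₂ l) (ε s : ℝ) : Fin m₁ → ℝ :=
  fun p => g.sqrtLam (g.tf - s) p - g.sqrtLam g.tf p * g.phi (-s / ε) p

/-- The forcing in the equation for the error of `K₂`. -/
noncomputable def forcing₂ (g : GameData n m₁ m₂ l) (K10 : ℝ → Matrix (Fin n) (Fin n) ℝ)
    (B' : ℝ → Matrix (Fin n) (Fin m₁) ℝ) (ε s : ℝ) (x : State n m₁ m₂) :
    Matrix (Fin n) (Fin m₁) ℝ :=
  -((x.1 - K10 (g.tf - s)) * g.Abar2 (g.tf - s))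
    + x.2.1 * (x.2.2.2.1 - diagonal (g.damping ε s))
    - ((g.outerK2 K10 (g.tf - s) - g.outerK2 K10 g.tf)
        * diagonal (fun p => g.sqrtLam g.tf p * g.phi (-s / ε) p)
      + g.outerK2 K10 g.tf * diagonal fun p =>
        g.phi (-s / ε) p * (g.sqrtLam (g.tf - s) p - g.sqrtLam g.tf p))
    - ε • (g.R2 ε (g.tf - s) (blocksOf x) + B' (g.tf - s))

/-- The forcing in the equation for the error of `K₄`. -/
noncomputable def forcing₄ (g : GameData n m₁ m₂ l) (L' : ℝ → Matrix (Fin m₁) (Fin m₁) ℝ)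
    (ε s : ℝ) (x : State n m₁ m₂) : Matrix (Fin m₁) (Fin m₁) ℝ :=
  (x.2.2.2.1 - diagonal (g.damping ε s)) * (x.2.2.2.1 - diagonal (g.damping ε s))
    + diagonal (fun p => 2 * g.sqrtLam g.tf p * g.phi (-s / ε) p
      * (g.sqrtLam g.tf p - g.sqrtLam (g.tf - s) p))
    - ε • (g.R4 ε (g.tf - s) (blocksOf x) + L' (g.tf - s))

/-- The forcing in the equation for the error of `K₅`. -/
noncomputable def forcing₅ (g : GameData n m₁ m₂ l) (A6' : ℝ → Matrix (Fin m₁) (Fin m₂) ℝ)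
    (ε s : ℝ) (x : State n m₁ m₂) : Matrix (Fin m₁) (Fin m₂) ℝ :=
  (x.2.2.2.1 - diagonal (g.damping ε s)) * (x.2.2.2.2.1 - g.Abar6 (g.tf - s))
    - (g.Abar2 (g.tf - s))ᵀ * x.2.2.1
    - diagonal (fun p => (g.sqrtLam (g.tf - s) p - g.sqrtLam g.tf p) * g.psi (-s / ε) p)
      * g.Abar6 g.tf
    - ε • (g.R5 ε (g.tf - s) (blocksOf x) + A6' (g.tf - s))

theorem rhs_K2_eq (hg : g.Standing) (B' : ℝ → Matrix (Fin n) (Fin m₁) ℝ) (ε : ℝ) {s : ℝ}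
    (hs : s ∈ Icc 0 g.tf) (x : State n m₁ m₂) :
    (g.rhs ε (g.tf - s) (blocksOf x)).K2 - ε • B' (g.tf - s) + g.outerK2 K10 g.tf
        * diagonal (fun p => g.sqrtLam g.tf p * g.phi (-s / ε) p * (2 - g.phi (-s / ε) p)) =
      (x.2.1 - (g.outerK2 K10 (g.tf - s) - g.outerK2 K10 g.tf * diagonal (g.phi (-s / ε))))
        * diagonal (g.damping ε s) + g.forcing₂ K10 B' ε s x :=
  fast_identity₂ (outerK2_mul hg K10 (reverse_mem_Icc hs)) ε

theorem rhs_K4_eq (hg : g.Standing) (L' : ℝ → Matrix (Fin m₁) (Fin m₁) ℝ) (ε : ℝ) {s : ℝ}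
    (hs : s ∈ Icc 0 g.tf) (x : State n m₁ m₂) :
    (g.rhs ε (g.tf - s) (blocksOf x)).K4 - ε • L' (g.tf - s)
        + diagonal (fun p => g.sqrtLam g.tf p
          * (g.sqrtLam g.tf p * g.phi (-s / ε) p * (2 - g.phi (-s / ε) p))) =
      diagonal (g.damping ε s) * (x.2.2.2.1 - diagonal (g.damping ε s))
        + (x.2.2.2.1 - diagonal (g.damping ε s)) * diagonal (g.damping ε s)
        + g.forcing₄ L' ε s x := by
  have h := fast_identity₄ (K4 := x.2.2.2.1) (R := g.R4 ε (g.tf - s) (blocksOf x))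
    (L' := L' (g.tf - s)) (a := g.sqrtLam g.tf) (b := g.sqrtLam (g.tf - s))
    (φ := g.phi (-s / ε)) ε
  rw [← Lam_eq hg (reverse_mem_Icc hs)] at h
  exact h

theorem rhs_K5_eq (A6' : ℝ → Matrix (Fin m₁) (Fin m₂) ℝ) (ε s : ℝ) (x : State n m₁ m₂) :
    (g.rhs ε (g.tf - s) (blocksOf x)).K5 - ε • A6' (g.tf - s)
        + diagonal (fun p => g.sqrtLam g.tf p * g.psi (-s / ε) p * (1 - g.phi (-s / ε) p))
          * g.Abar6 g.tf =
      diagonal (g.damping ε s)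
        * (x.2.2.2.2.1 - (g.Abar6 (g.tf - s) - diagonal (g.psi (-s / ε)) * g.Abar6 g.tf))
        + g.forcing₅ A6' ε s x :=
  fast_identity₅ ε

theorem stateOf_approx_reverse (hK10 : g.IsOuterK1 K10) (ε s : ℝ) :
    stateOf (g.approx K10 K60 ε (g.tf - s)) =
      (K10 (g.tf - s),
        g.outerK2 K10 (g.tf - s) - g.outerK2 K10 g.tf * diagonal (g.phi (-s / ε)), 0,
        diagonal (g.damping ε s),
        g.Abar6 (g.tf - s) - diagonal (g.psi (-s / ε)) * g.Abar6 g.tf, K60 (g.tf - s)) := by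
  have hτ : (g.tf - s - g.tf) / ε = -s / ε := by ring
  have h4 : g.LamSqrt (g.tf - s)
      + -diagonal (fun p => g.sqrtLam g.tf p * g.phi (-s / ε) p) = diagonal (g.damping ε s) := by
    rw [LamSqrt_eq, ← sub_eq_add_neg, diagonal_sub]
    rfl
  simp only [approx, hτ, boundary_eq hK10.terminal, stateOf, outer, add_zero, h4,
    ← sub_eq_add_neg]
  rfl

theorem reverse_exponent (β ε s : ℝ) : β * (-s / ε) = -(β * s / ε) := by ring

theorem abs_phi_le {β : ℝ} (hβ : 0 < β) (hle : ∀ p, β ≤ g.sqrtLam g.tf p) {ε s : ℝ} (hε : 0 < ε)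
    (hs : 0 ≤ s) (p : Fin m₁) : |g.phi (-s / ε) p| ≤ 2 * Real.exp (-(β * s / ε)) := by
  rw [← reverse_exponent]
  exact abs_layerPhi_le hβ.le (hle p) (div_nonpos_of_nonpos_of_nonneg (neg_nonpos.2 hs) hε.le)

theorem abs_psi_le {β : ℝ} (hle : ∀ p, β ≤ g.sqrtLam g.tf p) {ε s : ℝ} (hε : 0 < ε)
    (hs : 0 ≤ s) (p : Fin m₁) : |g.psi (-s / ε) p| ≤ 2 * Real.exp (-(β * s / ε)) := by
  rw [← reverse_exponent]
  exact abs_layerPsi_le (hle p) (div_nonpos_of_nonpos_of_nonneg (neg_nonpos.2 hs) hε.le)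

/-- Bounds for the diagonal entries of `Λ^{1/2}`. -/
theorem exists_bound_sqrtLam (hg : g.Standing) (hs : g.SmoothData) :
    ∃ N c, 0 ≤ N ∧ 0 ≤ c ∧ (∀ p, |g.sqrtLam g.tf p| ≤ N) ∧
      ∀ s ∈ Icc 0 g.tf, ∀ p, |g.sqrtLam (g.tf - s) p - g.sqrtLam g.tf p| ≤ c * s := by
  obtain ⟨c, hc, hlip⟩ := (bddDeriv_LamSqrt hg hs).lipschitz
  refine ⟨‖g.LamSqrt g.tf‖, c, norm_nonneg _, hc, fun p => ?_, fun s hs p => ?_⟩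
  · simpa [LamSqrt_eq] using norm_entry_le (g.LamSqrt g.tf) p p
  · have h := (norm_entry_le (g.LamSqrt (g.tf - s) - g.LamSqrt g.tf) p p).trans
      (hlip _ (reverse_mem_Icc hs) _ ⟨hg.tf_pos.le, le_rfl⟩)
    simpa [LamSqrt_eq, abs_of_nonneg hs.1] using h

/-- The error of `K₄` enters multiplied by `K₂`, which is bounded on the ball. The freezing terms
are at most a constant times `s e^{-βs/ε}`, hence `O(ε)`. -/
theorem exists_bound_forcing₂ (hg : g.Standing) (hs : g.SmoothData) (hK10 : g.IsOuterK1 K10)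
    {β : ℝ} (hβ : 0 < β) (hle : ∀ p, β ≤ g.sqrtLam g.tf p) {B' : ℝ → Matrix (Fin n) (Fin m₁) ℝ}
    {C' : ℝ} (hB' : ∀ t ∈ Icc 0 g.tf, ‖B' t‖ ≤ C') (R : ℝ) :
    ∃ C, 0 ≤ C ∧ ∀ ε ∈ Ioc (0 : ℝ) 1, ∀ s ∈ Icc 0 g.tf, ∀ x : State n m₁ m₂, ‖x‖ ≤ R →
      ‖g.forcing₂ K10 B' ε s x‖ ≤
        C * (‖x.1 - K10 (g.tf - s)‖ + ‖x.2.2.2.1 - diagonal (g.damping ε s)‖ + ε) := by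
  have hc := contData hg hs
  have htf : g.tf ∈ Icc 0 g.tf := ⟨hg.tf_pos.le, le_rfl⟩
  obtain ⟨α, hα⟩ := isCompact_Icc.exists_bound_of_continuousOn hc.a2
  obtain ⟨c, hc₀, hB⟩ := (bddDeriv_outerK2 hg hs hK10).lipschitz
  obtain ⟨N, d, hN, hd, hbN, hbd⟩ := exists_bound_sqrtLam hg hs
  obtain ⟨M, hM, hR2⟩ := (unifLip_remainders hc).2.1.exists_bound R
  have hα₀ : 0 ≤ α := (norm_nonneg _).trans (hα _ htf)
  have hC' : 0 ≤ C' := (norm_nonneg _).trans (hB' _ htf)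
  set NB := ‖g.outerK2 K10 g.tf‖
  have hNB : 0 ≤ NB := norm_nonneg _
  refine ⟨α + |R| + (c * (m₁ * m₁ * (N * 2)) + NB * (m₁ * m₁ * (2 * d))) / β + (M + C'),
    by positivity, fun ε hε s hs x hx => ?_⟩
  have ht := reverse_mem_Icc hs
  set e := Real.exp (-(β * s / ε)) with he
  have he₀ : 0 < e := Real.exp_pos _
  have hse : s * e ≤ ε / β := mul_exp_neg_le hβ hε.1
  have hφ := fun p => abs_phi_le (g := g) hβ hle hε.1 hs.1 p
  have h1 : ‖-((x.1 - K10 (g.tf - s)) * g.Abar2 (g.tf - s))‖ ≤ α * ‖x.1 - K10 (g.tf - s)‖ := by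
    rw [norm_neg, mul_comm α]
    exact (frobenius_norm_mul _ _).trans (mul_le_mul_of_nonneg_left (hα _ ht) (norm_nonneg _))
  have h2 : ‖x.2.1 * (x.2.2.2.1 - diagonal (g.damping ε s))‖
      ≤ |R| * ‖x.2.2.2.1 - diagonal (g.damping ε s)‖ := by
    refine (frobenius_norm_mul _ _).trans (mul_le_mul_of_nonneg_right ?_ (norm_nonneg _))
    exact ((norm_fst_le x.2).trans (norm_snd_le x)).trans (hx.trans (le_abs_self R))
  have h3 : ‖(g.outerK2 K10 (g.tf - s) - g.outerK2 K10 g.tf)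
      * diagonal (fun p => g.sqrtLam g.tf p * g.phi (-s / ε) p)‖
      ≤ c * (m₁ * m₁ * (N * 2)) * (s * e) := by
    have h := hB _ ht _ htf
    rw [sub_sub_cancel_left, abs_neg, abs_of_nonneg hs.1] at h
    calc _ ≤ c * s * (m₁ * m₁ * (N * (2 * e))) := by
          refine (frobenius_norm_mul _ _).trans (mul_le_mul h ?_ (norm_nonneg _)
            (mul_nonneg hc₀ hs.1))
          refine norm_diagonal_le (by positivity) fun p => ?_
          rw [abs_mul]
          exact mul_le_mul (hbN p) (hφ p) (abs_nonneg _) hN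
      _ = _ := by ring
  have h4 : ‖g.outerK2 K10 g.tf * diagonal fun p =>
      g.phi (-s / ε) p * (g.sqrtLam (g.tf - s) p - g.sqrtLam g.tf p)‖
      ≤ NB * (m₁ * m₁ * (2 * d)) * (s * e) := by
    have hs₀ := hs.1
    calc _ ≤ NB * (m₁ * m₁ * (2 * e * (d * s))) := by
          refine (frobenius_norm_mul _ _).trans (mul_le_mul_of_nonneg_left ?_ hNB)
          refine norm_diagonal_le (by positivity) fun p => ?_
          rw [abs_mul]
          exact mul_le_mul (hφ p) (hbd s hs p) (abs_nonneg _) (by positivity)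
      _ = _ := by ring
  have h5 : ‖ε • (g.R2 ε (g.tf - s) (blocksOf x) + B' (g.tf - s))‖ ≤ ε * (M + C') := by
    rw [norm_smul, Real.norm_of_nonneg hε.1.le]
    exact mul_le_mul_of_nonneg_left ((norm_add_le _ _).trans
      (add_le_add (hR2 (ε, g.tf - s) ⟨⟨hε.1.le, hε.2⟩, ht⟩ x hx) (hB' _ ht))) hε.1.le
  set P := ‖x.1 - K10 (g.tf - s)‖ with hP
  set Q := ‖x.2.2.2.1 - diagonal (g.damping ε s)‖ with hQ
  have hP₀ : 0 ≤ P := norm_nonneg _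
  have hQ₀ : 0 ≤ Q := norm_nonneg _
  set W := c * (m₁ * m₁ * (N * 2)) + NB * (m₁ * m₁ * (2 * d)) with hW
  have hW₀ : 0 ≤ W := by positivity
  have h6 : W * (s * e) ≤ W / β * ε := by
    calc W * (s * e) ≤ W * (ε / β) := mul_le_mul_of_nonneg_left hse hW₀
      _ = _ := by ring
  calc ‖g.forcing₂ K10 B' ε s x‖ ≤ α * P + |R| * Q + W * (s * e) + ε * (M + C') := by
        rw [hW, add_mul]
        exact (norm_sub_le _ _).trans (add_le_add ((norm_sub_le _ _).trans (add_le_add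
          ((norm_add_le _ _).trans (add_le_add h1 h2))
          ((norm_add_le _ _).trans (add_le_add h3 h4)))) h5)
    _ ≤ α * P + |R| * Q + W / β * ε + ε * (M + C') := by linarith
    _ ≤ _ := by
        have hε₀ := hε.1
        have q1 : 0 ≤ (|R| + W / β + (M + C')) * P := by positivity
        have q2 : 0 ≤ (α + W / β + (M + C')) * Q := by positivity
        have q3 : 0 ≤ (α + |R|) * ε := by positivity
        linarith

/-- No slow error occurs at order one, and the error of `K₄` itself occurs only squared; this lets
its estimate close first. -/
theorem exists_bound_forcing₄ (hg : g.Standing) (hs : g.SmoothData)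
    {β : ℝ} (hβ : 0 < β) (hle : ∀ p, β ≤ g.sqrtLam g.tf p) {L' : ℝ → Matrix (Fin m₁) (Fin m₁) ℝ}
    {C' : ℝ} (hL' : ∀ t ∈ Icc 0 g.tf, ‖L' t‖ ≤ C') (R : ℝ) :
    ∃ C, 0 ≤ C ∧ ∀ ε ∈ Ioc (0 : ℝ) 1, ∀ s ∈ Icc 0 g.tf, ∀ x : State n m₁ m₂, ‖x‖ ≤ R →
      ‖g.forcing₄ L' ε s x‖ ≤ ‖x.2.2.2.1 - diagonal (g.damping ε s)‖ ^ 2 + C * ε := by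
  have hc := contData hg hs
  have htf : g.tf ∈ Icc 0 g.tf := ⟨hg.tf_pos.le, le_rfl⟩
  obtain ⟨N, d, hN, hd, hbN, hbd⟩ := exists_bound_sqrtLam hg hs
  obtain ⟨M, hM, hR4⟩ := (unifLip_remainders hc).2.2.2.1.exists_bound R
  have hC' : 0 ≤ C' := (norm_nonneg _).trans (hL' _ htf)
  refine ⟨m₁ * m₁ * (2 * N * 2 * d) / β + (M + C'), by positivity, fun ε hε s hs x hx => ?_⟩
  have ht := reverse_mem_Icc hs
  set e := Real.exp (-(β * s / ε)) with he
  have he₀ : 0 < e := Real.exp_pos _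
  have hse : s * e ≤ ε / β := mul_exp_neg_le hβ hε.1
  have hφ := fun p => abs_phi_le (g := g) hβ hle hε.1 hs.1 p
  have hs₀ := hs.1
  have h3 : ‖(diagonal (fun p => 2 * g.sqrtLam g.tf p * g.phi (-s / ε) p
      * (g.sqrtLam g.tf p - g.sqrtLam (g.tf - s) p)) : Matrix (Fin m₁) (Fin m₁) ℝ)‖
      ≤ m₁ * m₁ * (2 * N * 2 * d) / β * ε := by
    calc _ ≤ m₁ * m₁ * (2 * N * (2 * e) * (d * s)) := by
          refine norm_diagonal_le (by positivity) fun p => ?_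
          rw [abs_mul, abs_mul, abs_mul, abs_two, abs_sub_comm (g.sqrtLam g.tf p)]
          have e1 := hbN p
          have e2 := hφ p
          have e3 := hbd s hs p
          gcongr
      _ = m₁ * m₁ * (2 * N * 2 * d) * (s * e) := by ring
      _ ≤ m₁ * m₁ * (2 * N * 2 * d) * (ε / β) := by gcongr
      _ = _ := by ring
  have h5 : ‖ε • (g.R4 ε (g.tf - s) (blocksOf x) + L' (g.tf - s))‖ ≤ ε * (M + C') := by
    rw [norm_smul, Real.norm_of_nonneg hε.1.le]
    exact mul_le_mul_of_nonneg_left ((norm_add_le _ _).trans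
      (add_le_add (hR4 (ε, g.tf - s) ⟨⟨hε.1.le, hε.2⟩, ht⟩ x hx) (hL' _ ht))) hε.1.le
  calc ‖g.forcing₄ L' ε s x‖ ≤ ‖x.2.2.2.1 - diagonal (g.damping ε s)‖ ^ 2
        + m₁ * m₁ * (2 * N * 2 * d) / β * ε + ε * (M + C') := by
        rw [pow_two]
        exact (norm_sub_le _ _).trans (add_le_add ((norm_add_le _ _).trans (add_le_add
          (frobenius_norm_mul _ _) h3)) h5)
    _ = _ := by ring

/-- The slow variables enter at order one only through `K₃`, which is its own error because its
approximation is zero. -/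
theorem exists_bound_forcing₅ (hg : g.Standing) (hs : g.SmoothData)
    {β : ℝ} (hβ : 0 < β) (hle : ∀ p, β ≤ g.sqrtLam g.tf p) {A6' : ℝ → Matrix (Fin m₁) (Fin m₂) ℝ}
    {C' : ℝ} (hA6' : ∀ t ∈ Icc 0 g.tf, ‖A6' t‖ ≤ C') (R : ℝ) :
    ∃ C, 0 ≤ C ∧ ∀ ε ∈ Ioc (0 : ℝ) 1, ∀ s ∈ Icc 0 g.tf, ∀ x : State n m₁ m₂, ‖x‖ ≤ R →
      ‖g.forcing₅ A6' ε s x‖ ≤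
        C * (‖x.2.2.1‖ + ‖x.2.2.2.1 - diagonal (g.damping ε s)‖ + ε) := by
  have hc := contData hg hs
  have htf : g.tf ∈ Icc 0 g.tf := ⟨hg.tf_pos.le, le_rfl⟩
  obtain ⟨α, hα⟩ := isCompact_Icc.exists_bound_of_continuousOn hc.a2
  obtain ⟨γ, hγ⟩ := isCompact_Icc.exists_bound_of_continuousOn hc.a6
  obtain ⟨N, d, hN, hd, hbN, hbd⟩ := exists_bound_sqrtLam hg hs
  obtain ⟨M, hM, hR5⟩ := (unifLip_remainders hc).2.2.2.2.1.exists_bound R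
  have hα₀ : 0 ≤ α := (norm_nonneg _).trans (hα _ htf)
  have hγ₀ : 0 ≤ γ := (norm_nonneg _).trans (hγ _ htf)
  have hC' : 0 ≤ C' := (norm_nonneg _).trans (hA6' _ htf)
  refine ⟨α + (|R| + γ) + m₁ * m₁ * (d * 2) * γ / β + (M + C'), by positivity,
    fun ε hε s hs x hx => ?_⟩
  have ht := reverse_mem_Icc hs
  set e := Real.exp (-(β * s / ε)) with he
  have he₀ : 0 < e := Real.exp_pos _
  have hse : s * e ≤ ε / β := mul_exp_neg_le hβ hε.1
  have hψ := fun p => abs_psi_le (g := g) hle hε.1 hs.1 p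
  have hs₀ := hs.1
  set P := ‖x.2.2.1‖ with hP
  set Q := ‖x.2.2.2.1 - diagonal (g.damping ε s)‖ with hQ
  have hP₀ : 0 ≤ P := norm_nonneg _
  have hQ₀ : 0 ≤ Q := norm_nonneg _
  have h1 : ‖(x.2.2.2.1 - diagonal (g.damping ε s)) * (x.2.2.2.2.1 - g.Abar6 (g.tf - s))‖
      ≤ (|R| + γ) * Q := by
    rw [mul_comm]
    refine (frobenius_norm_mul _ _).trans (mul_le_mul_of_nonneg_left ?_ hQ₀)
    refine (norm_sub_le _ _).trans (add_le_add ?_ (hγ _ ht))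
    exact ((norm_fst_le x.2.2.2.2).trans ((norm_snd_le x.2.2.2).trans ((norm_snd_le x.2.2).trans
      ((norm_snd_le x.2).trans (norm_snd_le x))))).trans (hx.trans (le_abs_self R))
  have h2 : ‖(g.Abar2 (g.tf - s))ᵀ * x.2.2.1‖ ≤ α * P := by
    refine (frobenius_norm_mul _ _).trans (mul_le_mul_of_nonneg_right ?_ hP₀)
    rw [frobenius_norm_transpose]
    exact hα _ ht
  have h3 : ‖diagonal (fun p => (g.sqrtLam (g.tf - s) p - g.sqrtLam g.tf p) * g.psi (-s / ε) p)
      * g.Abar6 g.tf‖ ≤ m₁ * m₁ * (d * 2) * γ / β * ε := by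
    calc _ ≤ m₁ * m₁ * (d * s * (2 * e)) * γ := by
          refine (frobenius_norm_mul _ _).trans (mul_le_mul ?_ (hγ _ htf) (norm_nonneg _)
            (by positivity))
          refine norm_diagonal_le (by positivity) fun p => ?_
          rw [abs_mul]
          exact mul_le_mul (hbd s hs p) (hψ p) (abs_nonneg _) (by positivity)
      _ = m₁ * m₁ * (d * 2) * γ * (s * e) := by ring
      _ ≤ m₁ * m₁ * (d * 2) * γ * (ε / β) := by gcongr
      _ = _ := by ring
  have h5 : ‖ε • (g.R5 ε (g.tf - s) (blocksOf x) + A6' (g.tf - s))‖ ≤ ε * (M + C') := by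
    rw [norm_smul, Real.norm_of_nonneg hε.1.le]
    exact mul_le_mul_of_nonneg_left ((norm_add_le _ _).trans
      (add_le_add (hR5 (ε, g.tf - s) ⟨⟨hε.1.le, hε.2⟩, ht⟩ x hx) (hA6' _ ht))) hε.1.le
  set W := m₁ * m₁ * (d * 2) * γ / β with hW
  have hW₀ : 0 ≤ W := by positivity
  calc ‖g.forcing₅ A6' ε s x‖ ≤ (|R| + γ) * Q + α * P + W * ε + ε * (M + C') :=
        (norm_sub_le _ _).trans (add_le_add ((norm_sub_le _ _).trans (add_le_add
          ((norm_sub_le _ _).trans (add_le_add h1 h2)) h3)) h5)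
    _ ≤ _ := by
        have hε₀ := hε.1
        have q1 : 0 ≤ ((|R| + γ) + W + (M + C')) * P := by positivity
        have q2 : 0 ≤ (α + W + (M + C')) * Q := by positivity
        have q3 : 0 ≤ (α + (|R| + γ)) * ε := by positivity
        linarith

theorem exists_bound_boundary (hK10 : g.IsOuterK1 K10) {β : ℝ} (hβ : 0 < β)
    (hle : ∀ p, β ≤ g.sqrtLam g.tf p) :
    ∃ E, 0 ≤ E ∧ ∀ ε, 0 < ε → ∀ s, 0 ≤ s →
      ‖stateOf (g.boundary (-s / ε))‖ ≤ E * Real.exp (-(β * s / ε)) := by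
  set b := ‖g.outerK2 K10 g.tf‖
  set c := ‖g.Abar6 g.tf‖
  set N := ‖g.LamSqrt g.tf‖
  have hb : 0 ≤ b := norm_nonneg _
  have hc : 0 ≤ c := norm_nonneg _
  have hN : 0 ≤ N := norm_nonneg _
  have hbN : ∀ p, |g.sqrtLam g.tf p| ≤ N := fun p => by
    have h := norm_entry_le (g.LamSqrt g.tf) p p
    rwa [LamSqrt_eq, diagonal_apply_eq] at h
  refine ⟨m₁ * m₁ * 2 * (b + N + c), by positivity, fun ε hε s hs => ?_⟩
  set e := Real.exp (-(β * s / ε)) with he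
  have he₀ : 0 < e := Real.exp_pos _
  have hφ := fun p => abs_phi_le (g := g) hβ hle hε hs p
  have hψ := fun p => abs_psi_le (g := g) hle hε hs p
  have p1 : 0 ≤ m₁ * m₁ * 2 * b * e := by positivity
  have p2 : 0 ≤ m₁ * m₁ * 2 * N * e := by positivity
  have p3 : 0 ≤ m₁ * m₁ * 2 * c * e := by positivity
  have hsum : m₁ * m₁ * 2 * (b + N + c) * e
      = m₁ * m₁ * 2 * b * e + m₁ * m₁ * 2 * N * e + m₁ * m₁ * 2 * c * e := by ring
  have h0 : 0 ≤ m₁ * m₁ * 2 * (b + N + c) * e := by positivity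
  rw [boundary_eq hK10.terminal]
  simp only [stateOf, norm_prod_le_iff, norm_neg, norm_zero]
  refine ⟨h0, ?_, h0, ?_, ?_, h0⟩
  · calc _ ≤ b * (m₁ * m₁ * (2 * e)) :=
          (frobenius_norm_mul _ _).trans (mul_le_mul_of_nonneg_left
            (norm_diagonal_le (by positivity) hφ) hb)
      _ = m₁ * m₁ * 2 * b * e := by ring
      _ ≤ _ := by linarith
  · calc _ ≤ m₁ * m₁ * (N * (2 * e)) := by
          refine norm_diagonal_le (by positivity) fun p => ?_
          rw [abs_mul]
          exact mul_le_mul (hbN p) (hφ p) (abs_nonneg _) hN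
      _ = m₁ * m₁ * 2 * N * e := by ring
      _ ≤ _ := by linarith
  · calc _ ≤ m₁ * m₁ * (2 * e) * c :=
          (frobenius_norm_mul _ _).trans (mul_le_mul_of_nonneg_right
            (norm_diagonal_le (by positivity) hψ) hc)
      _ = m₁ * m₁ * 2 * c * e := by ring
      _ ≤ _ := by linarith

theorem stateOf_approx (ε t : ℝ) :
    stateOf (g.approx K10 K60 ε t)
      = stateOf (g.outer K10 K60 t) + stateOf (g.boundary ((t - g.tf) / ε)) := rfl

/-- The slow blocks have no layer correction, so the comparison is with the outer solution. Passing
from it to the full approximation costs `e^{-βs/ε}`, and dropping the remainders costs `O(ε)`. -/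
theorem exists_bound_slow (hg : g.Standing) (hs : g.SmoothData) (hK10 : g.IsOuterK1 K10)
    {β : ℝ} (hβ : 0 < β) (hle : ∀ p, β ≤ g.sqrtLam g.tf p) {R : ℝ}
    (hR : ∀ t ∈ Icc 0 g.tf, ‖stateOf (g.outer K10 K60 t)‖ ≤ R) :
    ∃ C, 0 ≤ C ∧ ∀ ε ∈ Ioc (0 : ℝ) 1, ∀ s ∈ Icc 0 g.tf, ∀ x : State n m₁ m₂, ‖x‖ ≤ R →
      ‖((g.rhs ε (g.tf - s) (blocksOf x)).K1 - (g.rhs 0 (g.tf - s) (g.outer K10 K60 (g.tf - s))).K1,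
        (g.rhs ε (g.tf - s) (blocksOf x)).K3 -
          (g.rhs 0 (g.tf - s) (g.outer K10 K60 (g.tf - s))).K3,
        (g.rhs ε (g.tf - s) (blocksOf x)).K6 -
          (g.rhs 0 (g.tf - s) (g.outer K10 K60 (g.tf - s))).K6)‖
      ≤ C * (ε + Real.exp (-(β * s / ε)) + ‖x - stateOf (g.approx K10 K60 ε (g.tf - s))‖) := by
  have hc := contData hg hs
  obtain ⟨L, hL₀, hL⟩ := (unifLip_fieldOf hc).exists_lipschitz R
  obtain ⟨r1, -, r3, -, -, r6⟩ := unifLip_remainders hc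
  obtain ⟨M₁, hM₁, hR1⟩ := r1.exists_bound R
  obtain ⟨M₃, hM₃, hR3⟩ := r3.exists_bound R
  obtain ⟨M₆, hM₆, hR6⟩ := r6.exists_bound R
  obtain ⟨E, hE₀, hE⟩ := exists_bound_boundary (g := g) hK10 hβ hle
  refine ⟨L * (1 + E) + (M₁ + M₃ + M₆), by positivity, fun ε hε s hs x hx => ?_⟩
  have ht := reverse_mem_Icc hs
  have hp : (ε, g.tf - s) ∈ g.paramSet := ⟨⟨hε.1.le, hε.2⟩, ht⟩
  have hR' := hR _ ht
  set o := stateOf (g.outer K10 K60 (g.tf - s)) with ho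
  set e := Real.exp (-(β * s / ε)) with he
  have he₀ : 0 < e := Real.exp_pos _
  set D := ‖x - stateOf (g.approx K10 K60 ε (g.tf - s))‖ with hD
  have hD₀ : 0 ≤ D := norm_nonneg _
  have hxo : ‖x - o‖ ≤ D + E * e := by
    have hτ : (g.tf - s - g.tf) / ε = -s / ε := by ring
    have hsplit : x - o = (x - stateOf (g.approx K10 K60 ε (g.tf - s)))
        + stateOf (g.boundary (-s / ε)) := by
      rw [stateOf_approx, hτ]; abel
    rw [hsplit]
    exact (norm_add_le _ _).trans (add_le_add le_rfl (hE ε hε.1 s hs.1))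
  have hLx : ‖g.fieldOf (ε, g.tf - s) x - g.fieldOf (ε, g.tf - s) o‖ ≤ L * (D + E * e) :=
    (hL _ hp x o hx hR').trans (mul_le_mul_of_nonneg_left hxo hL₀)
  have hfin : ∀ M, 0 ≤ M → M ≤ M₁ + M₃ + M₆ → L * (D + E * e) + ε * M ≤
      (L * (1 + E) + (M₁ + M₃ + M₆)) * (ε + e + D) := by
    intro M hM hle
    have hε₀ := hε.1
    have q1 : ε * M ≤ ε * (M₁ + M₃ + M₆) := mul_le_mul_of_nonneg_left hle hε₀.le
    have q2 : 0 ≤ L * (1 + E) * ε := by positivity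
    have q3 : 0 ≤ L * e := by positivity
    have q4 : 0 ≤ L * E * D := by positivity
    have q5 : 0 ≤ (M₁ + M₃ + M₆) * (e + D) := by positivity
    linarith
  have hsm : ∀ {a b : ℕ} (Z : Matrix (Fin a) (Fin b) ℝ) (M : ℝ), ‖Z‖ ≤ M → ‖ε • Z‖ ≤ ε * M := by
    intro a b Z M hZ
    rw [norm_smul, Real.norm_of_nonneg hε.1.le]
    exact mul_le_mul_of_nonneg_left hZ hε.1.le
  simp only [norm_prod_le_iff]
  refine ⟨?_, ?_, ?_⟩
  · have hsplit : (g.rhs ε (g.tf - s) (blocksOf x)).K1 - (g.rhs 0 (g.tf - s) (blocksOf o)).K1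
        = (g.fieldOf (ε, g.tf - s) x - g.fieldOf (ε, g.tf - s) o).1
          - ε • g.R1 ε (g.tf - s) (blocksOf o) := by
      change _ = (g.rhs ε (g.tf - s) (blocksOf x)).K1 - (g.rhs ε (g.tf - s) (blocksOf o)).K1 - _
      simp only [rhs, zero_smul, sub_zero]
      abel
    refine (congrArg norm hsplit).trans_le ((norm_sub_le _ _).trans ?_)
    exact (add_le_add ((norm_fst_le _).trans hLx) (hsm _ _ (hR1 _ hp o hR'))).trans
      (hfin M₁ hM₁ (by linarith))
  · have hsplit : (g.rhs ε (g.tf - s) (blocksOf x)).K3 - (g.rhs 0 (g.tf - s) (blocksOf o)).K3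
        = (g.fieldOf (ε, g.tf - s) x - g.fieldOf (ε, g.tf - s) o).2.2.1
          - ε • g.R3 ε (g.tf - s) (blocksOf o) := by
      change _ = (g.rhs ε (g.tf - s) (blocksOf x)).K3 - (g.rhs ε (g.tf - s) (blocksOf o)).K3 - _
      simp only [rhs, zero_smul, sub_zero]
      abel
    refine (congrArg norm hsplit).trans_le ((norm_sub_le _ _).trans ?_)
    exact (add_le_add (((norm_fst_le _).trans ((norm_snd_le _).trans (norm_snd_le _))).trans hLx)
      (hsm _ _ (hR3 _ hp o hR'))).trans (hfin M₃ hM₃ (by linarith))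
  · have hsplit : (g.rhs ε (g.tf - s) (blocksOf x)).K6 - (g.rhs 0 (g.tf - s) (blocksOf o)).K6
        = (g.fieldOf (ε, g.tf - s) x - g.fieldOf (ε, g.tf - s) o).2.2.2.2.2
          - ε • g.R6 ε (g.tf - s) (blocksOf o) := by
      change _ = (g.rhs ε (g.tf - s) (blocksOf x)).K6 - (g.rhs ε (g.tf - s) (blocksOf o)).K6 - _
      simp only [rhs, zero_smul, sub_zero]
      abel
    refine (congrArg norm hsplit).trans_le ((norm_sub_le _ _).trans ?_)
    exact (add_le_add (((norm_snd_le _).trans ((norm_snd_le _).trans ((norm_snd_le _).trans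
      ((norm_snd_le _).trans (norm_snd_le _))))).trans hLx)
      (hsm _ _ (hR6 _ hp o hR'))).trans (hfin M₆ hM₆ (by linarith))

end GameData

end Remainders

end CheapControl

namespace CheapControl

/-! ### The a priori estimate around the approximation. -/

section Main

variable {n m₁ m₂ l : ℕ}

namespace GameData

variable {g : GameData n m₁ m₂ l} {K10 : ℝ → Matrix (Fin n) (Fin n) ℝ}
  {K60 : ℝ → Matrix (Fin m₂) (Fin m₂) ℝ}

theorem continuousOn_outer (hg : g.Standing) (hs : g.SmoothData) (hK10 : g.IsOuterK1 K10)
    (hK60 : g.IsOuterK6 K60) :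
    ContinuousOn (fun t => stateOf (g.outer K10 K60 t)) (Icc 0 g.tf) :=
  hK10.continuousOn.prodMk ((bddDeriv_outerK2 hg hs hK10).continuousOn.prodMk
    (continuousOn_const.prodMk ((bddDeriv_LamSqrt hg hs).continuousOn.prodMk
      ((bddDeriv_Abar6 hg hs).continuousOn.prodMk hK60.continuousOn))))

theorem hasDerivAt_phi (ε s : ℝ) (p : Fin m₁) :
    HasDerivAt (fun s => g.phi (-s / ε) p)
      (-(ε⁻¹ * (g.sqrtLam g.tf p * g.phi (-s / ε) p * (2 - g.phi (-s / ε) p)))) s :=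
  hasDerivAt_layerPhi_reverse _ ε s

theorem hasDerivAt_psi (ε s : ℝ) (p : Fin m₁) :
    HasDerivAt (fun s => g.psi (-s / ε) p)
      (-(ε⁻¹ * (g.sqrtLam g.tf p * g.psi (-s / ε) p * (1 - g.phi (-s / ε) p)))) s :=
  hasDerivAt_layerPsi_reverse _ ε s

theorem neg_smul_sub_identity {G : Type*} [AddCommGroup G] [Module ℝ G] {ε : ℝ} (hε : ε ≠ 0)
    (r B Z : G) : -(ε⁻¹ • r) - (-B + ε⁻¹ • Z) = -(ε⁻¹ • (r - ε • B + Z)) := by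
  rw [smul_add, smul_sub, smul_smul, inv_mul_cancel₀ hε, one_smul]
  abel

/-- The derivative of the approximation of `K₂` in reversed time. -/
theorem hasDerivWithinAt_approx₂ {B' : ℝ → Matrix (Fin n) (Fin m₁) ℝ}
    (hB' : ∀ t ∈ Icc 0 g.tf, HasDerivWithinAt (g.outerK2 K10) (B' t) (Icc 0 g.tf) t)
    (ε : ℝ) {s : ℝ} (hs : s ∈ Icc 0 g.tf) :
    HasDerivWithinAt
      (fun s => g.outerK2 K10 (g.tf - s) - g.outerK2 K10 g.tf * diagonal (g.phi (-s / ε)))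
      (-B' (g.tf - s) + ε⁻¹ • (g.outerK2 K10 g.tf * diagonal fun p =>
        g.sqrtLam g.tf p * g.phi (-s / ε) p * (2 - g.phi (-s / ε) p))) (Icc 0 g.tf) s := by
  have h1 := hasDerivWithinAt_reverse (hB' _ (reverse_mem_Icc hs))
  have h2 := hasDerivWithinAt_matrix_mul
    (hasDerivWithinAt_const s (Icc 0 g.tf) (g.outerK2 K10 g.tf))
    (hasDerivWithinAt_diagonal fun p => (hasDerivAt_phi (g := g) ε s p).hasDerivWithinAt)
  refine (h1.sub h2).congr_deriv ?_
  ext i j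
  simp only [Matrix.add_apply, Matrix.sub_apply, Matrix.neg_apply, Matrix.smul_apply, smul_eq_mul,
    mul_diagonal, Matrix.zero_mul, Matrix.zero_apply]
  ring

theorem hasDerivWithinAt_approx₄ {L' : ℝ → Matrix (Fin m₁) (Fin m₁) ℝ}
    (hL' : ∀ t ∈ Icc 0 g.tf, HasDerivWithinAt g.LamSqrt (L' t) (Icc 0 g.tf) t)
    (ε : ℝ) {s : ℝ} (hs : s ∈ Icc 0 g.tf) :
    HasDerivWithinAt (fun s => (diagonal (g.damping ε s) : Matrix (Fin m₁) (Fin m₁) ℝ))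
      (-L' (g.tf - s) + ε⁻¹ • diagonal fun p =>
        g.sqrtLam g.tf p * (g.sqrtLam g.tf p * g.phi (-s / ε) p * (2 - g.phi (-s / ε) p)))
      (Icc 0 g.tf) s := by
  have h1 := hasDerivWithinAt_reverse (hL' _ (reverse_mem_Icc hs))
  have h2 := hasDerivWithinAt_diagonal fun p =>
    ((hasDerivAt_phi (g := g) ε s p).const_mul (g.sqrtLam g.tf p)).hasDerivWithinAt
      (s := Icc 0 g.tf)
  have h3 := h1.sub h2
  have e : (fun s => (diagonal (g.damping ε s) : Matrix (Fin m₁) (Fin m₁) ℝ)) =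
      (fun s => g.LamSqrt (g.tf - s)) -
        fun s => diagonal fun p => g.sqrtLam g.tf p * g.phi (-s / ε) p := by
    funext s
    rw [Pi.sub_apply, LamSqrt_eq, diagonal_sub]
    rfl
  rw [e]
  refine h3.congr_deriv ?_
  rw [sub_eq_add_neg]
  congr 1
  ext i j
  by_cases hij : i = j
  · subst hij
    simp only [Matrix.neg_apply, Matrix.smul_apply, diagonal_apply_eq, smul_eq_mul]
    ring
  · simp [hij]

theorem hasDerivWithinAt_approx₅ {A6' : ℝ → Matrix (Fin m₁) (Fin m₂) ℝ}
    (hA6' : ∀ t ∈ Icc 0 g.tf, HasDerivWithinAt g.Abar6 (A6' t) (Icc 0 g.tf) t)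
    (ε : ℝ) {s : ℝ} (hs : s ∈ Icc 0 g.tf) :
    HasDerivWithinAt
      (fun s => g.Abar6 (g.tf - s) - diagonal (g.psi (-s / ε)) * g.Abar6 g.tf)
      (-A6' (g.tf - s) + ε⁻¹ • (diagonal (fun p =>
        g.sqrtLam g.tf p * g.psi (-s / ε) p * (1 - g.phi (-s / ε) p)) * g.Abar6 g.tf))
      (Icc 0 g.tf) s := by
  have h1 := hasDerivWithinAt_reverse (hA6' _ (reverse_mem_Icc hs))
  have h2 := hasDerivWithinAt_matrix_mul
    (hasDerivWithinAt_diagonal fun p => (hasDerivAt_psi (g := g) ε s p).hasDerivWithinAt)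
    (hasDerivWithinAt_const s (Icc 0 g.tf) (g.Abar6 g.tf))
  refine (h1.sub h2).congr_deriv ?_
  ext i j
  simp only [Matrix.add_apply, Matrix.sub_apply, Matrix.neg_apply, Matrix.smul_apply, smul_eq_mul,
    diagonal_mul, Matrix.mul_zero, Matrix.zero_apply]
  ring

/-- At `s = 0` both profiles equal 1, so the corrections cancel the outer values of `K₂`, `K₄`, `K₅`
exactly and every error starts from zero. -/
theorem approx_terminal (hK10 : g.IsOuterK1 K10) (hK60 : g.IsOuterK6 K60) (ε : ℝ) :
    stateOf (g.approx K10 K60 ε (g.tf - 0)) = (g.F1, 0, 0, 0, 0, 0) := by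
  have hφ : g.phi (-0 / ε) = fun _ => 1 := by
    ext p
    simp only [phi, layerPhi, neg_zero, zero_div, zero_mul, mul_zero, Real.exp_zero]
    norm_num
  have hψ : g.psi (-0 / ε) = fun _ => 1 := by
    ext p
    simp only [psi, layerPsi, neg_zero, zero_div, zero_mul, mul_zero, Real.exp_zero]
    norm_num
  have hd : g.damping ε 0 = 0 := by
    ext p
    rw [damping, hφ]
    simp
  rw [stateOf_approx_reverse hK10, hφ, hψ, hd, sub_zero, hK10.terminal, hK60.terminal,
    diagonal_one]
  simp

theorem continuousOn_approx (hg : g.Standing) (hs : g.SmoothData) (hK10 : g.IsOuterK1 K10)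
    (hK60 : g.IsOuterK6 K60) (ε : ℝ) :
    ContinuousOn (fun s => stateOf (g.approx K10 K60 ε (g.tf - s))) (Icc 0 g.tf) := by
  obtain ⟨B', _, -, hB⟩ := bddDeriv_outerK2 hg hs hK10
  obtain ⟨L', _, -, hL⟩ := bddDeriv_LamSqrt hg hs
  obtain ⟨A6', _, -, hA⟩ := bddDeriv_Abar6 hg hs
  have hrev : ContinuousOn (fun s : ℝ => g.tf - s) (Icc 0 g.tf) := by fun_prop
  have hmaps : MapsTo (fun s : ℝ => g.tf - s) (Icc 0 g.tf) (Icc 0 g.tf) :=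
    fun s hs => reverse_mem_Icc hs
  simp only [stateOf_approx_reverse hK10]
  refine (hK10.continuousOn.comp hrev hmaps).prodMk (.prodMk ?_ (continuousOn_const.prodMk
    (.prodMk ?_ (.prodMk ?_ (hK60.continuousOn.comp hrev hmaps)))))
  · exact fun s hs => (hasDerivWithinAt_approx₂ (fun t ht => (hB t ht).1) ε hs).continuousWithinAt
  · exact fun s hs => (hasDerivWithinAt_approx₄ (fun t ht => (hL t ht).1) ε hs).continuousWithinAt
  · exact fun s hs => (hasDerivWithinAt_approx₅ (fun t ht => (hA t ht).1) ε hs).continuousWithinAt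

/-- A solution in reversed time that stays close to the approximation stays within distance `O(ε)`
of it. -/
theorem exists_apriori_bound (hg : g.Standing) (hsm : g.SmoothData) (hK10 : g.IsOuterK1 K10)
    (hK60 : g.IsOuterK6 K60) :
    ∃ η ∈ Ioc (0 : ℝ) 1, ∃ A > 0, ∀ ε ∈ Ioc (0 : ℝ) 1, ∀ S ∈ Icc 0 g.tf, ∀ x : ℝ → State n m₁ m₂,
      x 0 = (g.F1, 0, 0, 0, 0, 0) → ContinuousOn x (Icc 0 S) →
      (∀ s ∈ Ico 0 S, HasDerivWithinAt x (-g.field ε (g.tf - s) (x s)) (Ici s) s) →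
      (∀ s ∈ Icc 0 S, ‖x s - stateOf (g.approx K10 K60 ε (g.tf - s))‖ ≤ η) →
      ∀ s ∈ Icc 0 S, ‖x s - stateOf (g.approx K10 K60 ε (g.tf - s))‖ ≤ A * ε := by
  have htf : g.tf ∈ Icc 0 g.tf := ⟨hg.tf_pos.le, le_rfl⟩
  obtain ⟨β, hβ, hβle⟩ := exists_lower_bound_sqrtLam hg hsm
  have hle := hβle g.tf htf
  obtain ⟨N, -, hN, -, hbN, -⟩ := exists_bound_sqrtLam hg hsm
  obtain ⟨Ro, hRo⟩ := isCompact_Icc.exists_bound_of_continuousOn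
    (continuousOn_outer hg hsm hK10 hK60)
  obtain ⟨E, hE₀, hE⟩ := exists_bound_boundary hK10 hβ hle
  -- A ball containing the outer solution, the layer and a deviation of at most `η ≤ 1`; all forcing
  -- bounds are taken on it, uniformly in `ε`.
  set R := Ro + E + 1 with hR
  obtain ⟨B', CB, -, hB⟩ := bddDeriv_outerK2 hg hsm hK10
  obtain ⟨L', CL, -, hL⟩ := bddDeriv_LamSqrt hg hsm
  obtain ⟨A6', CA, -, hA⟩ := bddDeriv_Abar6 hg hsm
  obtain ⟨C₂, hC₂, hf₂⟩ := exists_bound_forcing₂ hg hsm hK10 hβ hle (fun t ht => (hB t ht).2) R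
  obtain ⟨C₄, hC₄, hf₄⟩ := exists_bound_forcing₄ hg hsm hβ hle (fun t ht => (hL t ht).2) R
  obtain ⟨C₅, hC₅, hf₅⟩ := exists_bound_forcing₅ hg hsm hβ hle (fun t ht => (hA t ht).2) R
  obtain ⟨Cs, hCs, hfs⟩ := exists_bound_slow (K60 := K60) hg hsm hK10 hβ hle (R := R)
    (fun t ht => (hRo t ht).trans (by linarith))
  set C := C₂ + C₄ + C₅ + Cs with hC
  -- The slow group collects `K₁`, `K₃`, `K₆`. The loss of damping is at most `2 * N` times the
  -- exponential, because `|φ| ≤ 2 e^{-βs/ε}` and the entries of `Λ^{1/2}(t_f)` are at most `N`.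
  obtain ⟨η, hη, A, hA₀, hmain⟩ := two_scale_estimate (Y := Matrix (Fin n) (Fin n) ℝ ×
    Matrix (Fin n) (Fin m₂) ℝ × Matrix (Fin m₂) (Fin m₂) ℝ) n m₁ m₂ hβ
    (show 0 ≤ 2 * N by positivity) (show 0 ≤ C by positivity) hg.tf_pos.le
  -- The total error is at most the sum of four groups: the slow one and the three fast blocks.
  refine ⟨η, hη, 4 * A, by positivity, fun ε hε S hS x hx0 hxc hx hxη => ?_⟩
  have hST : ∀ s ∈ Ico 0 S, s ∈ Ico 0 g.tf := fun s hs => ⟨hs.1, hs.2.trans_le hS.2⟩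
  have hIcc : ∀ s ∈ Icc 0 S, s ∈ Icc 0 g.tf := fun s hs => ⟨hs.1, hs.2.trans hS.2⟩
  have hIco : ∀ s ∈ Ico 0 S, s ∈ Icc 0 g.tf := fun s hs => hIcc s ⟨hs.1, hs.2.le⟩
  have hxR : ∀ s ∈ Icc 0 S, ‖x s‖ ≤ R := by
    intro s hs
    have h1 := hxη s hs
    have h2 := hRo _ (reverse_mem_Icc (hIcc s hs))
    have h3 := hE ε hε.1 s hs.1
    have h4 : Real.exp (-(β * s / ε)) ≤ 1 := by
      have := hs.1
      have := hε.1
      exact Real.exp_le_one_iff.2 (neg_nonpos.2 (by positivity))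
    have h5 : E * Real.exp (-(β * s / ε)) ≤ E := mul_le_of_le_one_right hE₀ h4
    have h6 : x s = (x s - stateOf (g.approx K10 K60 ε (g.tf - s)))
        + (stateOf (g.outer K10 K60 (g.tf - s)) + stateOf (g.boundary (-s / ε))) := by
      have hτ : (g.tf - s - g.tf) / ε = -s / ε := by ring
      rw [stateOf_approx, hτ]; abel
    rw [h6]
    refine (norm_add_le _ _).trans ((add_le_add h1 ((norm_add_le _ _).trans
      (add_le_add h2 (h3.trans h5)))).trans ?_)
    have := hη.2
    linarith
  have hcont : ContinuousOn (fun s => x s - stateOf (g.approx K10 K60 ε (g.tf - s))) (Icc 0 S) :=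
    hxc.sub ((continuousOn_approx hg hsm hK10 hK60 ε).mono hIcc)
  have hzero : x 0 - stateOf (g.approx K10 K60 ε (g.tf - 0)) = 0 := by
    rw [approx_terminal hK10 hK60, hx0, sub_self]
  have hnorm : ∀ s, ‖x s - stateOf (g.approx K10 K60 ε (g.tf - s))‖ ≤
      ‖((x s).1 - K10 (g.tf - s), (x s).2.2.1, (x s).2.2.2.2.2 - K60 (g.tf - s))‖
      + ‖(x s).2.1 - (g.outerK2 K10 (g.tf - s)
        - g.outerK2 K10 g.tf * diagonal (g.phi (-s / ε)))‖
      + ‖(x s).2.2.2.1 - diagonal (g.damping ε s)‖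
      + ‖(x s).2.2.2.2.1 - (g.Abar6 (g.tf - s) - diagonal (g.psi (-s / ε)) * g.Abar6 g.tf)‖ := by
    intro s
    rw [stateOf_approx_reverse hK10]
    set y := ((x s).1 - K10 (g.tf - s), (x s).2.2.1, (x s).2.2.2.2.2 - K60 (g.tf - s)) with hy
    set p := ‖(x s).2.1 - (g.outerK2 K10 (g.tf - s)
        - g.outerK2 K10 g.tf * diagonal (g.phi (-s / ε)))‖
    set q := ‖(x s).2.2.2.1 - diagonal (g.damping ε s)‖
    set r := ‖(x s).2.2.2.2.1 - (g.Abar6 (g.tf - s) - diagonal (g.psi (-s / ε)) * g.Abar6 g.tf)‖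
    have hy₀ := norm_nonneg y
    have hp : 0 ≤ p := norm_nonneg _
    have hq : 0 ≤ q := norm_nonneg _
    have hr : 0 ≤ r := norm_nonneg _
    have y1 : ‖(x s).1 - K10 (g.tf - s)‖ ≤ ‖y‖ := norm_fst_le y
    have y2 : ‖(x s).2.2.1 - 0‖ ≤ ‖y‖ := by
      rw [sub_zero]; exact (norm_fst_le y.2).trans (norm_snd_le y)
    have y3 : ‖(x s).2.2.2.2.2 - K60 (g.tf - s)‖ ≤ ‖y‖ := (norm_snd_le y.2).trans (norm_snd_le y)
    simp only [norm_prod_le_iff, Prod.fst_sub, Prod.snd_sub]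
    refine ⟨?_, ?_, ?_, ?_, ?_, ?_⟩ <;> linarith
  have hcont' := hcont
  simp only [stateOf_approx_reverse hK10] at hcont'
  have hzero' := hzero
  rw [stateOf_approx_reverse hK10] at hzero'
  have hIci : ∀ {G : Type} [NormedAddCommGroup G] [NormedSpace ℝ G] {f : ℝ → G} {f' : G} {s : ℝ},
      s ∈ Ico 0 S → HasDerivWithinAt f f' (Icc 0 g.tf) s → HasDerivWithinAt f f' (Ici s) s :=
    fun hs h => hasDerivWithinAt_Ici_of_Icc (hST _ hs) h
  have hconcl := hmain ε hε.1 S hS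
    (fun s => ((x s).1 - K10 (g.tf - s), (x s).2.2.1, (x s).2.2.2.2.2 - K60 (g.tf - s)))
    (fun s => -((g.rhs ε (g.tf - s) (blocksOf (x s))).K1
          - (g.rhs 0 (g.tf - s) (g.outer K10 K60 (g.tf - s))).K1,
        (g.rhs ε (g.tf - s) (blocksOf (x s))).K3
          - (g.rhs 0 (g.tf - s) (g.outer K10 K60 (g.tf - s))).K3,
        (g.rhs ε (g.tf - s) (blocksOf (x s))).K6
          - (g.rhs 0 (g.tf - s) (g.outer K10 K60 (g.tf - s))).K6))
    (fun s => (x s).2.1 - (g.outerK2 K10 (g.tf - s)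
        - g.outerK2 K10 g.tf * diagonal (g.phi (-s / ε))))
    (fun s => g.forcing₂ K10 B' ε s (x s))
    (fun s => (x s).2.2.2.1 - diagonal (g.damping ε s))
    (fun s => g.forcing₄ L' ε s (x s))
    (fun s => (x s).2.2.2.2.1
        - (g.Abar6 (g.tf - s) - diagonal (g.psi (-s / ε)) * g.Abar6 g.tf))
    (fun s => g.forcing₅ A6' ε s (x s)) (g.damping ε) ?_ ?_ ?_ ?_ ?_ ?_ ?_ ?_ ?_ ?_ ?_ ?_ ?_ ?_ ?_
    ?_ ?_ ?_
  · intro s hs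
    obtain ⟨h1, h2, h4, h5⟩ := hconcl s hs
    refine (hnorm s).trans ?_
    linarith
  · exact (continuous_fst.comp_continuousOn hcont').prodMk
      ((continuous_fst.comp_continuousOn (continuous_snd.comp_continuousOn
        (continuous_snd.comp_continuousOn hxc))).prodMk
      (continuous_snd.comp_continuousOn (continuous_snd.comp_continuousOn
        (continuous_snd.comp_continuousOn (continuous_snd.comp_continuousOn
          (continuous_snd.comp_continuousOn hcont'))))))
  · exact continuous_fst.comp_continuousOn (continuous_snd.comp_continuousOn hcont')
  · exact continuous_fst.comp_continuousOn (continuous_snd.comp_continuousOn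
      (continuous_snd.comp_continuousOn (continuous_snd.comp_continuousOn hcont')))
  · exact continuous_fst.comp_continuousOn (continuous_snd.comp_continuousOn
      (continuous_snd.comp_continuousOn (continuous_snd.comp_continuousOn
        (continuous_snd.comp_continuousOn hcont'))))
  · exact Prod.ext (congrArg (fun z => z.1) hzero') (Prod.ext (by simp only [hx0]; rfl)
      (congrArg (fun z => z.2.2.2.2.2) hzero'))
  · exact congrArg (fun z => z.2.1) hzero'
  · exact congrArg (fun z => z.2.2.2.1) hzero'
  · exact congrArg (fun z => z.2.2.2.2.1) hzero'
  · intro s hs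
    have ht := reverse_mem_Icc (hIco s hs)
    obtain ⟨o1, o3, o6⟩ := outer_slow hg hsm hK10 K60 ht
    have d := hx s hs
    have d1 := (hasDerivWithinAt_fst d).sub
      (hIci hs (hasDerivWithinAt_reverse (hK10.deriv _ ht)))
    have d3 := hasDerivWithinAt_fst (hasDerivWithinAt_snd (hasDerivWithinAt_snd d))
    have d6 := (hasDerivWithinAt_snd (hasDerivWithinAt_snd (hasDerivWithinAt_snd
      (hasDerivWithinAt_snd (hasDerivWithinAt_snd d))))).sub
      (hIci hs (hasDerivWithinAt_reverse (hK60.deriv _ ht)))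
    rw [← o1] at d1
    rw [← o6] at d6
    refine (d1.prodMk (d3.prodMk d6)).congr_deriv (Prod.ext ?_ (Prod.ext ?_ ?_))
    · exact (neg_sub_neg _ _).trans (neg_sub _ _).symm
    · rw [o3, sub_zero]; rfl
    · exact (neg_sub_neg _ _).trans (neg_sub _ _).symm
  · intro s hs
    have d := (hasDerivWithinAt_fst (hasDerivWithinAt_snd (hx s hs))).sub
      (hIci hs (hasDerivWithinAt_approx₂ (fun t ht => (hB t ht).1) ε (hIco s hs)))
    refine d.congr_deriv ?_
    rw [← rhs_K2_eq hg B' ε (hIco s hs) (x s)]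
    exact neg_smul_sub_identity hε.1.ne' _ _ _
  · intro s hs
    have d := (hasDerivWithinAt_fst (hasDerivWithinAt_snd (hasDerivWithinAt_snd
      (hasDerivWithinAt_snd (hx s hs))))).sub
      (hIci hs (hasDerivWithinAt_approx₄ (fun t ht => (hL t ht).1) ε (hIco s hs)))
    refine d.congr_deriv ?_
    rw [← rhs_K4_eq hg L' ε (hIco s hs) (x s)]
    exact neg_smul_sub_identity hε.1.ne' _ _ _
  · intro s hs
    have d := (hasDerivWithinAt_fst (hasDerivWithinAt_snd (hasDerivWithinAt_snd
      (hasDerivWithinAt_snd (hasDerivWithinAt_snd (hx s hs)))))).sub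
      (hIci hs (hasDerivWithinAt_approx₅ (fun t ht => (hA t ht).1) ε (hIco s hs)))
    refine d.congr_deriv ?_
    rw [← rhs_K5_eq A6' ε s (x s)]
    exact neg_smul_sub_identity hε.1.ne' _ _ _
  · intro s hs p
    have h1 := hβle _ (reverse_mem_Icc (hIco s hs)) p
    have h2 : |g.sqrtLam g.tf p * g.phi (-s / ε) p| ≤ N * (2 * Real.exp (-(β * s / ε))) := by
      rw [abs_mul]
      exact mul_le_mul (hbN p) (abs_phi_le hβ hle hε.1 hs.1 p) (abs_nonneg _) hN
    have h3 := (abs_le.1 h2).2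
    unfold damping
    linarith
  · intro s hs
    refine (hf₂ ε hε s (hIco s hs) (x s) (hxR s ⟨hs.1, hs.2.le⟩)).trans ?_
    have hε₀ := hε.1
    exact mul_le_mul (by linarith) (add_le_add (add_le_add (norm_fst_le ((x s).1 - K10 (g.tf - s),
      (x s).2.2.1, (x s).2.2.2.2.2 - K60 (g.tf - s))) le_rfl) le_rfl) (by positivity)
      (by positivity)
  · intro s hs
    refine (hf₄ ε hε s (hIco s hs) (x s) (hxR s ⟨hs.1, hs.2.le⟩)).trans ?_
    exact add_le_add le_rfl (mul_le_mul_of_nonneg_right (by linarith) hε.1.le)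
  · intro s hs
    refine (hf₅ ε hε s (hIco s hs) (x s) (hxR s ⟨hs.1, hs.2.le⟩)).trans ?_
    have hε₀ := hε.1
    have hy3 : ‖(x s).2.2.1‖ ≤ ‖((x s).1 - K10 (g.tf - s), (x s).2.2.1,
        (x s).2.2.2.2.2 - K60 (g.tf - s))‖ :=
      (norm_fst_le ((x s).2.2.1, (x s).2.2.2.2.2 - K60 (g.tf - s))).trans
        (norm_snd_le ((x s).1 - K10 (g.tf - s), (x s).2.2.1,
          (x s).2.2.2.2.2 - K60 (g.tf - s)))
    exact mul_le_mul (by linarith) (add_le_add (add_le_add hy3 le_rfl) le_rfl) (by positivity)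
      (by positivity)
  · intro s hs
    have hε₀ := hε.1
    rw [norm_neg]
    refine (hfs ε hε s (hIco s hs) (x s) (hxR s ⟨hs.1, hs.2.le⟩)).trans ?_
    exact mul_le_mul (by linarith) (add_le_add le_rfl (hnorm s)) (by positivity) (by positivity)
  · intro s hs
    have h := hxη s hs
    rw [stateOf_approx_reverse hK10] at h
    exact ((norm_fst_le _).trans ((norm_snd_le _).trans ((norm_snd_le _).trans
      (norm_snd_le _)))).trans h

end GameData

end Main

end CheapControl

theorem lemma1 {n m₁ m₂ l : ℕ} (hm₁ : 1 ≤ m₁) (hm₂ : 1 ≤ m₂)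
    (g : GameData n m₁ m₂ l) (hg : g.Standing)
    (hblock : g.BlockVanishes) (hsmooth : g.SmoothData)
    (K10 : ℝ → Matrix (Fin n) (Fin n) ℝ) (hK10 : g.IsOuterK1 K10) :
    ∃ K60 : ℝ → Matrix (Fin m₂) (Fin m₂) ℝ, g.IsOuterK6 K60 ∧
      (∀ K60' : ℝ → Matrix (Fin m₂) (Fin m₂) ℝ, g.IsOuterK6 K60' →
        EqOn K60' K60 (Icc 0 g.tf)) ∧
      ∃ ε₀ > 0, ∃ a > 0, ∀ ε ∈ Ioc (0 : ℝ) ε₀,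
        ∃ K : ℝ → Blocks n m₁ m₂, g.IsSolution ε K ∧
          (∀ K' : ℝ → Blocks n m₁ m₂, g.IsSolution ε K' → EqOn K' K (Icc 0 g.tf)) ∧
          ∀ t ∈ Icc 0 g.tf,
            ((K t).K1ᵀ = (K t).K1 ∧ (K t).K4ᵀ = (K t).K4 ∧ (K t).K6ᵀ = (K t).K6) ∧
            ‖(K t).K1 - (g.approx K10 K60 ε t).K1‖ ≤ a * ε ∧
            ‖(K t).K2 - (g.approx K10 K60 ε t).K2‖ ≤ a * ε ∧
            ‖(K t).K3 - (g.approx K10 K60 ε t).K3‖ ≤ a * ε ∧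
            ‖(K t).K4 - (g.approx K10 K60 ε t).K4‖ ≤ a * ε ∧
            ‖(K t).K5 - (g.approx K10 K60 ε t).K5‖ ≤ a * ε ∧
            ‖(K t).K6 - (g.approx K10 K60 ε t).K6‖ ≤ a * ε := by
  have hc := GameData.contData hg hsmooth
  obtain ⟨K60, hK60⟩ := GameData.exists_outerK6 hg hc
  refine ⟨K60, hK60, fun K60' h' => hK60.eqOn hc h', ?_⟩
  obtain ⟨η, hη, A, hA, hap⟩ := GameData.exists_apriori_bound hg hsmooth hK10 hK60
  -- This choice gives `A ε ≤ η / 2 < η`, the strict gap between the a priori bound and the radius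
  -- of the tube.
  refine ⟨min 1 (η / (2 * A)), lt_min one_pos (div_pos hη.1 (by positivity)), A, hA,
    fun ε hε => ?_⟩
  have hε₁ : ε ∈ Ioc (0 : ℝ) 1 := ⟨hε.1, hε.2.trans (min_le_left _ _)⟩
  have hε₂ : ε ∈ Icc (0 : ℝ) 1 := Ioc_subset_Icc_self hε₁
  have hAε : 0 < A * ε := mul_pos hA hε.1
  have hAη : A * ε < η := by
    have h1 := (le_div_iff₀ (by positivity)).1 (hε.2.trans (min_le_right _ _))
    linarith
  have hV : UnifLip (Icc 0 g.tf) fun s x => -g.field ε (g.tf - s) x :=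
    ((GameData.unifLip_field hc hε₂).comp_param (f := fun s => g.tf - s) (by fun_prop)
      fun _ => reverse_mem_Icc).neg
  -- The tube has radius `η` and the improved bound is `A ε`, so existence on the whole interval and
  -- the error estimate come out together.
  obtain ⟨x, hx₀, hx, hxA⟩ := exists_solution_of_apriori hg.tf_pos.le hAε.le hAη hV
    (GameData.continuousOn_approx hg hsmooth hK10 hK60 ε) (g.F1, 0, 0, 0, 0, 0) (hap ε hε₁)
    (by rw [GameData.approx_terminal hK10 hK60, sub_self, norm_zero]; exact hAε.le)
  have hK : g.IsSolution ε fun t => blocksOf (x (g.tf - t)) := by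
    refine GameData.isSolution_of_hasDerivWithinAt (fun t ht => ?_) (by rw [sub_self, hx₀])
    have h := hasDerivWithinAt_reverse (hx _ (reverse_mem_Icc ht))
    simp only [sub_sub_cancel, neg_neg] at h
    exact h
  refine ⟨_, hK, fun K' hK' => hK.eqOn hc hε₂ hK', fun t ht =>
    ⟨hK.symmetric hg hc hε₂ t ht, ?_⟩⟩
  have h := hxA _ (reverse_mem_Icc ht)
  simp only [sub_sub_cancel, norm_prod_le_iff] at h
  exact h
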